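/- There are a closed smooth surface of revolution $M\subset\mathbb R^3$ (obtained by rotating around the $z$-axis a smooth regular simple curve $t\mapsto(r(t),0,h(t))$, $t\in[0,T]$, that meets the axis exactly at its two end points) and a parameter $m>0$, namely $m=10^{-10}$, such that, with $b\in M$ the pole corresponding to $t=0$, with $M$ carrying the Riemannian metric induced by $\mathbb R^3$, and with $d_b$ the Riemannian distance on $M$ to $b$, the following holds. Each of the two problems $$\min\Big\{\int_M |\nabla u|^2-mu\ :\ u\in H^1(M),\ |\nabla u|\le 1 \text{ a.e.},\ u(b)=0\Big\},\qquad \min\Big\{\int_M |\nabla u|^2-mu\ :\ u\in H^1(M),\ u\le d_b \text{ a.e.}\Big\}$$ has exactly one minimizer (up to equality almost everywhere), denoted by $u_m$ and $u_m^d$ respectively, and $$u_m\neq u_m^d \quad\text{(as elements of } H^1(M)\text{)}.$$ Here $H^1(M)$ is the closure of $C^1(M)$ for the norm $\|u\|_{H^1}^2=\int_M|\nabla u|^2+\int_M u^2$, integrals are with respect to the Riemannian area, and in the first problem $u(b)$ is the value at $b$ of the continuous representative of $u$. -/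

import Mathlib

open MeasureTheory Filter Topology Set
open scoped ContDiff

noncomputable section

/-- Euclidean three-space. -/
abbrev E3 : Type := EuclideanSpace ℝ (Fin 3)

/-- A set `M ⊆ ℝ³` is a smooth embedded surface (without boundary): locally it is the zero set of a
smooth function with nowhere vanishing differential. -/
def IsSmoothSurface (M : Set E3) : Prop :=
  ∀ p ∈ M, ∃ U : Set E3, IsOpen U ∧ p ∈ U ∧ ∃ F : E3 → ℝ,
    ContDiffOn ℝ ∞ F U ∧ (∀ x ∈ U, fderiv ℝ F x ≠ 0) ∧ M ∩ U = {x ∈ U | F x = 0}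

/-- The map `(t, θ) ↦ (r(t) cos θ, r(t) sin θ, h(t))`: the point `(r(t), 0, h(t))` of the profile
curve, rotated by the angle `θ` around the `z`-axis. -/
def revolve (r h : ℝ → ℝ) (q : ℝ × ℝ) : E3 :=
  !₂[r q.1 * Real.cos q.2, r q.1 * Real.sin q.2, h q.1]

/-- A closed surface of revolution in `ℝ³`: a smooth surface obtained by rotating around the
`z`-axis a smooth, regular, simple curve `t ↦ (r(t), 0, h(t))`, `t ∈ [0, T]`, which meets the axis
exactly at its two end points. (Only the values of `r` and `h` on `[0, T]` matter.) -/
structure SurfaceOfRevolution where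
  /-- length of the parameter interval -/
  T : ℝ
  /-- distance to the axis -/
  r : ℝ → ℝ
  /-- height -/
  h : ℝ → ℝ
  T_pos : 0 < T
  smooth_r : ContDiff ℝ ∞ r
  smooth_h : ContDiff ℝ ∞ h
  regular : ∀ t ∈ Icc 0 T, (deriv r t, deriv h t) ≠ (0, 0)
  simple : InjOn (fun t => (r t, h t)) (Icc 0 T)
  r_zero : r 0 = 0
  r_T : r T = 0
  r_pos : ∀ t ∈ Ioo 0 T, 0 < r t
  smooth_surface : IsSmoothSurface (revolve r h '' (Icc 0 T ×ˢ Ico 0 (2 * Real.pi)))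

namespace SurfaceOfRevolution

variable (S : SurfaceOfRevolution)

/-- The surface `M` itself, as a subset of `ℝ³`. -/
def carrier : Set E3 := revolve S.r S.h '' (Icc 0 S.T ×ˢ Ico 0 (2 * Real.pi))

/-- The base point `b`: the pole of `M` at the parameter `t = 0`. -/
def base : E3 := revolve S.r S.h (0, 0)

/-- The tangent space `T_p M`, as a subspace of `ℝ³`: it is spanned by the velocities at `p` of the
curves in `M` through `p`. -/
def tangentPlane (p : E3) : Submodule ℝ E3 :=
  Submodule.span ℝ {v | ∃ c : ℝ → E3, c 0 = p ∧ (∀ᶠ s in 𝓝 0, c s ∈ S.carrier) ∧ HasDerivAt c v 0}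

/-- The Riemannian gradient at `p ∈ M` of (the restriction to `M` of) a `C¹` function `f`: the
tangential part of the Euclidean gradient. -/
def surfaceGradient (f : E3 → ℝ) (p : E3) : E3 :=
  (S.tangentPlane p).starProjection (gradient f p)

/-- The density `√(det g)` of the Riemannian metric `g` induced by `ℝ³`, in the coordinates
`(t, θ)`. -/
def areaDensity (q : ℝ × ℝ) : ℝ :=
  let φt := fderiv ℝ (revolve S.r S.h) q (1, 0)
  let φθ := fderiv ℝ (revolve S.r S.h) q (0, 1)
  √(inner ℝ φt φt * inner ℝ φθ φθ - inner ℝ φt φθ ^ 2)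

/-- The Riemannian area measure of `M`, as a measure on `ℝ³` carried by `M`. The coordinates
`(t, θ) ∈ (0, T) × (0, 2π)` cover `M` up to one meridian, which has area zero. -/
def area : Measure E3 :=
  ((volume.restrict (Ioo 0 S.T ×ˢ Ioo 0 (2 * Real.pi))).withDensity
    (fun q => ENNReal.ofReal (S.areaDensity q))).map (revolve S.r S.h)

/-- The Riemannian distance `d_b(p)` from the base point: the infimum of the lengths of the `C¹`
curves in `M` from `b` to `p`. -/
def distBase (p : E3) : ℝ :=
  sInf {L : ℝ | ∃ c : ℝ → E3, ContDiff ℝ 1 c ∧ (∀ s ∈ Icc (0 : ℝ) 1, c s ∈ S.carrier) ∧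
    c 0 = S.base ∧ c 1 = p ∧ L = ∫ s in (0 : ℝ)..1, ‖deriv c s‖}

/-- `u ∈ H¹(M)` with gradient `G`. The space `H¹(M)` is the closure of `C¹(M)` for the norm
`(∫_M |∇u|² + ∫_M u²)^(1/2)`: `u` and `G` are the `L²` limits of functions `fₙ ∈ C¹(M)` and of their
gradients. As `M` is a closed smooth surface, `C¹(M)` consists of the restrictions to `M` of the
`C¹` functions on `ℝ³`. Functions on `M` are represented by functions on `ℝ³`, of which only
the restriction to `M` matters. -/
def HasSobolevGradient (u : E3 → ℝ) (G : E3 → E3) : Prop :=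
  MemLp u 2 S.area ∧ MemLp G 2 S.area ∧
    ∃ f : ℕ → E3 → ℝ, (∀ n, ContDiff ℝ 1 (f n)) ∧
      Tendsto (fun n => eLpNorm (fun p => f n p - u p) 2 S.area) atTop (𝓝 0) ∧
      Tendsto (fun n => eLpNorm (fun p => S.surfaceGradient (f n) p - G p) 2 S.area) atTop (𝓝 0)

/-- The functional `∫_M |∇u|² - m u`, where `G = ∇u`. -/
def energy (m : ℝ) (u : E3 → ℝ) (G : E3 → E3) : ℝ :=
  ∫ p, (‖G p‖ ^ 2 - m * u p) ∂S.area

/-- Competitors with the gradient constraint: `u ∈ H¹(M)`, `|∇u| ≤ 1` almost everywhere, `u(b) = 0`.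
A Sobolev function with bounded gradient has a continuous representative, and
it is this representative which is evaluated at `b`. -/
def GradientAdmissible (u : E3 → ℝ) (G : E3 → E3) : Prop :=
  S.HasSobolevGradient u G ∧ (∀ᵐ p ∂S.area, ‖G p‖ ≤ 1) ∧ ContinuousOn u S.carrier ∧ u S.base = 0

/-- Competitors with the distance constraint: `u ∈ H¹(M)`, `u ≤ d_b` almost everywhere. -/
def DistanceAdmissible (u : E3 → ℝ) (G : E3 → E3) : Prop :=
  S.HasSobolevGradient u G ∧ ∀ᵐ p ∂S.area, u p ≤ S.distBase p

/-- `u` minimizes `∫_M |∇u|² - m u` under the gradient constraint. -/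
def IsGradientMinimizer (m : ℝ) (u : E3 → ℝ) : Prop :=
  ∃ G, S.GradientAdmissible u G ∧
    ∀ v H, S.GradientAdmissible v H → S.energy m u G ≤ S.energy m v H

/-- `u` minimizes `∫_M |∇u|² - m u` under the distance constraint. -/
def IsDistanceMinimizer (m : ℝ) (u : E3 → ℝ) : Prop :=
  ∃ G, S.DistanceAdmissible u G ∧
    ∀ v H, S.DistanceAdmissible v H → S.energy m u G ≤ S.energy m v H

end SurfaceOfRevolution

end

/-!
The surface is a dumbbell: two bulges joined by a thin neck, scaled by a factor `l`. Its profile is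
explicit, and so is a polynomial of which it is the zero set (`Dumbbell.defFun`). In the coordinates
`(t, θ)`, a radial function is described by its slope, the derivative with respect to the arc length
of the meridians. Without constraints the minimal slope is `m A / (2 R)`, where `A` is the area
beyond the parameter `t`, divided by `2π`, and `R` is the radius; this is a multiple of
`Dumbbell.quot`. It is infinite at the pole `b`, decreases on the first bulge, and increases again
towards the neck, where `R` is small while half of the area still lies beyond.

Both minimizers are radial and explicit. With the gradient constraint the slope is truncated at `1`
(`Dumbbell.gradSlope`). With the distance constraint the minimizer coincides with the distance up to
the parameter `t₀` where the unconstrained slope first equals `1`, and has the unconstrained slope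
from there on (`Dumbbell.distSlope`). The scale `l` is chosen, in `Dumbbell.exists_level`, such that
the unconstrained slope exceeds `1` again beyond `t₀`, but so little that the second function still
stays below the distance. As one slope exceeds `1` somewhere and the other one does not, the two
functions differ.

Minimality is proved by calibration. Expanding the energy around a radial candidate
(`Dumbbell.energy_expansion`) leaves a square and a linear functional, and it has to be shown that
the linear functional is minimal at the candidate. Both cases rest on integration by parts along the
meridians, with a cutoff near the pole (`Dumbbell.integral_parts`); it holds for smooth functions by
the fundamental theorem of calculus, and passes to the limit in `L²`. With the gradient
constraint the cutoff can be removed, because a competitor is continuous and vanishes at `b`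
(`Dumbbell.integral_parts_of_gradientAdmissible`), and the linear functional becomes an integral of
the radial derivative that can be compared pointwise. With the distance constraint it becomes the
integral of the competitor against a nonpositive weight that lives on the contact set
(`Dumbbell.contact_le_linearized_sub`).

The square forces any other minimizer to have the same gradient. Integration by parts against
an arbitrary continuous function, which may depend on the angle as well, then shows that the two
minimizers coincide: with the gradient constraint since both vanish at `b`, with the distance
constraint since both equal the distance on the contact set.
-/

/-! ### The profile curve -/

namespace Dumbbell

/-- The radius of the unscaled dumbbell at parameter `t ∈ [0, π]`, where the height is `-cos t`.
The neck sits at `t = π / 2`, between two bulges. -/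
noncomputable def prof (t : ℝ) : ℝ := Real.sin t * √(1 / 100 + Real.cos t ^ 2)

/-- The derivative of `prof`. -/
noncomputable def dprof (t : ℝ) : ℝ :=
  Real.cos t * (1 / 100 + Real.cos t ^ 2 - Real.sin t ^ 2) / √(1 / 100 + Real.cos t ^ 2)

/-- The speed of the unscaled profile curve `t ↦ (prof t, -cos t)`. -/
noncomputable def speed (t : ℝ) : ℝ := √(dprof t ^ 2 + Real.sin t ^ 2)

/-- The area, divided by `2π`, of the part of the unscaled dumbbell with parameter at least `t`. -/
noncomputable def tail (t : ℝ) : ℝ := ∫ s in t..Real.pi, prof s * speed s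

lemma radicand_pos (t : ℝ) : 0 < 1 / 100 + Real.cos t ^ 2 := by positivity

lemma sqrt_radicand_pos (t : ℝ) : 0 < √(1 / 100 + Real.cos t ^ 2) :=
  Real.sqrt_pos.2 (radicand_pos t)

lemma sqrt_radicand_ge (t : ℝ) : 1 / 10 ≤ √(1 / 100 + Real.cos t ^ 2) := by
  apply Real.le_sqrt_of_sq_le
  nlinarith [sq_nonneg (Real.cos t)]

lemma contDiff_prof : ContDiff ℝ ∞ prof := by
  unfold prof
  refine Real.contDiff_sin.mul (ContDiff.sqrt ?_ fun t => (radicand_pos t).ne')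
  exact contDiff_const.add (Real.contDiff_cos.pow 2)

lemma hasDerivAt_prof (t : ℝ) : HasDerivAt prof (dprof t) t := by
  have h1 : HasDerivAt (fun s => 1 / 100 + Real.cos s ^ 2) (2 * Real.cos t * (-Real.sin t)) t := by
    have := ((Real.hasDerivAt_cos t).pow 2).const_add (1 / 100 : ℝ)
    simpa using this
  have h2 := (Real.hasDerivAt_sin t).mul (h1.sqrt (radicand_pos t).ne')
  refine h2.congr_deriv ?_
  rw [dprof]
  have hq := sqrt_radicand_pos t
  have hsq := Real.sq_sqrt (radicand_pos t).le
  set q := √(1 / 100 + Real.cos t ^ 2)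
  rw [← hsq]
  field_simp
  ring

lemma continuous_prof : Continuous prof := contDiff_prof.continuous

lemma continuous_dprof : Continuous dprof := by
  unfold dprof
  refine Continuous.div (by fun_prop) (by fun_prop) fun t => (sqrt_radicand_pos t).ne'

lemma continuous_speed : Continuous speed := by
  unfold speed
  have := continuous_dprof
  fun_prop

lemma speed_sq (t : ℝ) : speed t ^ 2 = dprof t ^ 2 + Real.sin t ^ 2 :=
  Real.sq_sqrt (by positivity)

lemma speed_pos (t : ℝ) : 0 < speed t := by
  apply Real.sqrt_pos.2
  rcases eq_or_ne (Real.sin t) 0 with h | h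
  · have hc : Real.cos t ^ 2 = 1 := by nlinarith [Real.sin_sq_add_cos_sq t]
    have : dprof t ≠ 0 := by
      unfold dprof
      refine div_ne_zero (mul_ne_zero ?_ ?_) (sqrt_radicand_pos t).ne'
      · intro h0; rw [h0] at hc; norm_num at hc
      · rw [hc, h]; norm_num
    positivity
  · positivity

lemma exists_speed_bounds : ∃ a b : ℝ, 0 < a ∧ 0 < b ∧
    ∀ t ∈ Icc 0 Real.pi, a ≤ speed t ∧ speed t ≤ b := by
  have hne : (Icc 0 Real.pi).Nonempty := ⟨0, by simp [Real.pi_pos.le]⟩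
  obtain ⟨x, -, hx⟩ := isCompact_Icc.exists_isMinOn hne continuous_speed.continuousOn
  obtain ⟨y, -, hy⟩ := isCompact_Icc.exists_isMaxOn hne continuous_speed.continuousOn
  exact ⟨speed x, speed y, speed_pos x, speed_pos y, fun t ht => ⟨hx ht, hy ht⟩⟩

lemma prof_pos {t : ℝ} (ht : t ∈ Ioo 0 Real.pi) : 0 < prof t :=
  mul_pos (Real.sin_pos_of_mem_Ioo ht) (sqrt_radicand_pos t)

lemma prof_nonneg {t : ℝ} (ht : t ∈ Icc 0 Real.pi) : 0 ≤ prof t :=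
  mul_nonneg (Real.sin_nonneg_of_mem_Icc ht) (sqrt_radicand_pos t).le

lemma prof_ge {t : ℝ} (ht : t ∈ Icc 0 Real.pi) : Real.sin t / 10 ≤ prof t := by
  have := mul_le_mul_of_nonneg_left (sqrt_radicand_ge t) (Real.sin_nonneg_of_mem_Icc ht)
  unfold prof; linarith

lemma prof_le {t : ℝ} (ht : t ∈ Icc 0 Real.pi) : prof t ≤ 2 * Real.sin t := by
  have h : √(1 / 100 + Real.cos t ^ 2) ≤ 2 := by
    apply Real.sqrt_le_iff.2
    exact ⟨by norm_num, by nlinarith [Real.cos_sq_le_one t]⟩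
  have := mul_le_mul_of_nonneg_left h (Real.sin_nonneg_of_mem_Icc ht)
  unfold prof; linarith

@[simp] lemma prof_zero : prof 0 = 0 := by simp [prof]
@[simp] lemma prof_pi : prof Real.pi = 0 := by simp [prof]

lemma continuous_prof_mul_speed : Continuous fun s => prof s * speed s :=
  continuous_prof.mul continuous_speed

lemma hasDerivAt_tail (t : ℝ) : HasDerivAt tail (-(prof t * speed t)) t :=
  intervalIntegral.integral_hasDerivAt_left (continuous_prof_mul_speed.intervalIntegrable _ _)
    (continuous_prof_mul_speed.stronglyMeasurableAtFilter _ _) continuous_prof_mul_speed.continuousAt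

lemma continuous_tail : Continuous tail :=
  continuous_iff_continuousAt.2 fun t => (hasDerivAt_tail t).continuousAt

@[simp] lemma tail_pi : tail Real.pi = 0 := by simp [tail]

lemma tail_pos {t : ℝ} (ht : t ∈ Ico 0 Real.pi) : 0 < tail t := by
  refine intervalIntegral.intervalIntegral_pos_of_pos_on
    (continuous_prof_mul_speed.intervalIntegrable _ _) (fun x hx => ?_) ht.2
  exact mul_pos (prof_pos ⟨ht.1.trans_lt hx.1, hx.2⟩) (speed_pos x)

lemma tail_antitoneOn : AntitoneOn tail (Icc 0 Real.pi) := by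
  refine antitoneOn_of_deriv_nonpos (convex_Icc _ _) continuous_tail.continuousOn
    (fun t _ => (hasDerivAt_tail t).differentiableAt.differentiableWithinAt) fun t ht => ?_
  rw [(hasDerivAt_tail t).deriv, interior_Icc] at *
  exact neg_nonpos.2 (mul_pos (prof_pos ht) (speed_pos t)).le

lemma tail_nonneg {t : ℝ} (ht : t ∈ Icc 0 Real.pi) : 0 ≤ tail t := by
  simpa using tail_antitoneOn ht (right_mem_Icc.2 Real.pi_pos.le) ht.2

/-- An integral from `t` to the upper end of a function bounded by a multiple of `sin` is bounded
by the same multiple of `1 + cos t`. -/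
lemma abs_integral_le_one_add_cos {f : ℝ → ℝ} {C t : ℝ}
    (hf : ∀ s ∈ Icc 0 Real.pi, |f s| ≤ C * Real.sin s) (ht : t ∈ Icc 0 Real.pi) :
    |∫ s in t..Real.pi, f s| ≤ C * (1 + Real.cos t) := by
  have h := intervalIntegral.norm_integral_le_of_norm_le (f := f) (μ := volume) ht.2
    (g := fun s => C * Real.sin s)
    (ae_of_all _ fun s hs => hf s ⟨ht.1.trans hs.1.le, hs.2⟩)
    (Continuous.intervalIntegrable (by fun_prop) _ _)
  rw [intervalIntegral.integral_const_mul, integral_sin] at h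
  simp only [Real.norm_eq_abs, Real.cos_pi] at h
  linarith

lemma exists_tail_le : ∃ C : ℝ, 0 < C ∧ ∀ t ∈ Icc 0 Real.pi, tail t ≤ C * (1 + Real.cos t) := by
  obtain ⟨a, b, ha, hb, hab⟩ := exists_speed_bounds
  refine ⟨2 * b, by positivity, fun t ht => (le_abs_self _).trans ?_⟩
  refine abs_integral_le_one_add_cos (fun s hs => ?_) ht
  rw [abs_of_nonneg (mul_nonneg (prof_nonneg hs) (speed_pos s).le)]
  have := mul_le_mul (prof_le hs) (hab s hs).2 (speed_pos s).le
    (mul_nonneg zero_le_two (Real.sin_nonneg_of_mem_Icc hs))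
  linarith

lemma prof_pi_sub (t : ℝ) : prof (Real.pi - t) = prof t := by
  simp [prof, Real.sin_pi_sub, Real.cos_pi_sub]

lemma speed_pi_sub (t : ℝ) : speed (Real.pi - t) = speed t := by
  simp [speed, dprof, Real.sin_pi_sub, Real.cos_pi_sub, div_pow, mul_pow]

/-- Half of the area lies above the neck. -/
lemma tail_pi_div_two : tail 0 = 2 * tail (Real.pi / 2) := by
  have h1 : tail 0 = (∫ s in (0 : ℝ)..(Real.pi / 2), prof s * speed s) + tail (Real.pi / 2) :=
    (intervalIntegral.integral_add_adjacent_intervals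
      (continuous_prof_mul_speed.intervalIntegrable _ _)
      (continuous_prof_mul_speed.intervalIntegrable _ _)).symm
  have h2 := intervalIntegral.integral_comp_sub_left (a := (0 : ℝ)) (b := Real.pi / 2)
    (fun s => prof s * speed s) Real.pi
  simp only [prof_pi_sub, speed_pi_sub, sub_zero] at h2
  rw [h1, h2, show Real.pi - Real.pi / 2 = Real.pi / 2 by ring]
  unfold tail; ring

lemma prof_pi_div_two : prof (Real.pi / 2) = 1 / 10 := by
  have : √(100 : ℝ) = 10 := by
    rw [show (100 : ℝ) = 10 ^ 2 by norm_num]; exact Real.sqrt_sq (by norm_num)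
  simp [prof, this]

lemma half_le_prof_pi_div_four : 1 / 2 ≤ prof (Real.pi / 4) := by
  have h1 : √(1 / 2 : ℝ) ≤ √(1 / 100 + Real.cos (Real.pi / 4) ^ 2) := by
    apply Real.sqrt_le_sqrt
    rw [Real.cos_pi_div_four, div_pow, Real.sq_sqrt (by norm_num)]; norm_num
  have h2 : Real.sin (Real.pi / 4) = √(1 / 2 : ℝ) := by
    rw [Real.sin_pi_div_four, Real.sqrt_div (by norm_num), Real.sqrt_one]
    rw [div_eq_div_iff (by norm_num) (by positivity)]; norm_num
  unfold prof
  rw [h2]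
  have := mul_le_mul_of_nonneg_left h1 (Real.sqrt_nonneg (1 / 2))
  rwa [Real.mul_self_sqrt (by norm_num)] at this

lemma dprof_nonneg {t : ℝ} (ht : t ∈ Icc 0 (Real.pi / 4)) : 0 ≤ dprof t := by
  have hpi := Real.pi_pos
  have hc : Real.cos (Real.pi / 4) ≤ Real.cos t :=
    Real.cos_le_cos_of_nonneg_of_le_pi ht.1 (by linarith) ht.2
  have hc0 : 0 ≤ Real.cos (Real.pi / 4) := by rw [Real.cos_pi_div_four]; positivity
  have hc2 : Real.cos (Real.pi / 4) ^ 2 = 1 / 2 := by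
    rw [Real.cos_pi_div_four, div_pow, Real.sq_sqrt (by norm_num)]; norm_num
  have h3 : 1 / 2 ≤ Real.cos t ^ 2 := by rw [← hc2]; gcongr
  refine div_nonneg (mul_nonneg (hc0.trans hc) ?_) (Real.sqrt_nonneg _)
  nlinarith [Real.sin_sq_add_cos_sq t]

lemma prof_monotoneOn : MonotoneOn prof (Icc 0 (Real.pi / 4)) := by
  refine monotoneOn_of_deriv_nonneg (convex_Icc _ _) continuous_prof.continuousOn
    (fun t _ => (hasDerivAt_prof t).differentiableAt.differentiableWithinAt) fun t ht => ?_
  rw [(hasDerivAt_prof t).deriv]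
  exact dprof_nonneg (interior_subset ht)

/-- The quotient of tail area and radius; the slope of the unconstrained minimizer is a multiple
of it. -/
noncomputable def quot (t : ℝ) : ℝ := tail t / prof t

lemma continuousOn_quot : ContinuousOn quot (Ioo 0 Real.pi) :=
  continuous_tail.continuousOn.div continuous_prof.continuousOn fun _ ht => (prof_pos ht).ne'

lemma quot_nonneg {t : ℝ} (ht : t ∈ Icc 0 Real.pi) : 0 ≤ quot t :=
  div_nonneg (tail_nonneg ht) (prof_nonneg ht)

lemma one_add_cos_le {t : ℝ} (ht : t ∈ Icc 0 Real.pi) {a : ℝ} (h0 : 0 < a) (ha : a ≤ t) :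
    (1 - Real.cos a) * (1 + Real.cos t) ≤ Real.sin t := by
  have h1 : Real.cos t ≤ Real.cos a :=
    Real.cos_le_cos_of_nonneg_of_le_pi h0.le ht.2 ha
  have h2 := Real.neg_one_le_cos t
  have h3 := Real.sin_nonneg_of_mem_Icc ht
  have h4 : (1 - Real.cos a) * (1 + Real.cos t) ≤ Real.sin t ^ 2 := by
    nlinarith [Real.sin_sq_add_cos_sq t]
  nlinarith [Real.sin_le_one t]

lemma exists_quot_le {a : ℝ} (h0 : 0 < a) (hpi : a < Real.pi) :
    ∃ C : ℝ, 0 < C ∧ ∀ t ∈ Ico a Real.pi, quot t ≤ C := by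
  obtain ⟨C, hC, h⟩ := exists_tail_le
  have hca : 0 < 1 - Real.cos a := by
    have := Real.cos_lt_cos_of_nonneg_of_le_pi le_rfl hpi.le h0
    rw [Real.cos_zero] at this; linarith
  refine ⟨10 * C / (1 - Real.cos a), by positivity, fun t ht => ?_⟩
  have ht0 : t ∈ Ioo 0 Real.pi := ⟨h0.trans_le ht.1, ht.2⟩
  have ht1 := Ioo_subset_Icc_self ht0
  rw [quot, div_le_div_iff₀ (prof_pos ht0) hca]
  have h1 := one_add_cos_le ht1 h0 ht.1
  have h2 := prof_ge ht1
  have h3 := h t ht1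
  calc tail t * (1 - Real.cos a) ≤ C * (1 + Real.cos t) * (1 - Real.cos a) :=
      mul_le_mul_of_nonneg_right h3 hca.le
    _ = C * ((1 - Real.cos a) * (1 + Real.cos t)) := by ring
    _ ≤ C * (10 * prof t) := mul_le_mul_of_nonneg_left (by linarith) hC.le
    _ = 10 * C * prof t := by ring

lemma quot_antitoneOn : AntitoneOn quot (Ioc 0 (Real.pi / 4)) := by
  have hpi := Real.pi_pos
  intro s hs t ht hst
  have hs' : s ∈ Ioo 0 Real.pi := ⟨hs.1, by linarith [hs.2]⟩
  have ht' : t ∈ Ioo 0 Real.pi := ⟨ht.1, by linarith [ht.2]⟩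
  exact div_le_div₀ (tail_nonneg (Ioo_subset_Icc_self hs'))
    (tail_antitoneOn (Ioo_subset_Icc_self hs') (Ioo_subset_Icc_self ht') hst) (prof_pos hs')
    (prof_monotoneOn (Ioc_subset_Icc_self hs) (Ioc_subset_Icc_self ht) hst)

/-- The choice of the scale. The quotient `tail / prof` decreases on the first bulge and is larger
again on the neck. A level `c` slightly below its supremum beyond the first bulge is attained at
some `t₀` on the first bulge and exceeded at some `t₁` beyond it, the excess being so small that it
is compensated by what is missing just after `t₀`. -/
theorem exists_level : ∃ c t₀ : ℝ, 0 < c ∧ t₀ ∈ Ioo 0 (Real.pi / 4) ∧ tail t₀ = c * prof t₀ ∧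
    (∀ t ∈ Ico t₀ Real.pi, 0 ≤ ∫ s in t₀..t, speed s * (c - quot s)) ∧
    ∃ t₁ ∈ Ioo t₀ Real.pi, c < quot t₁ := by
  have hpi := Real.pi_pos
  set a := Real.pi / 4 with ha
  have ha0 : 0 < a := by positivity
  have hapi : a < Real.pi := by rw [ha]; linarith
  set M := tail 0 with hM
  have hM0 : 0 < M := tail_pos ⟨le_rfl, hpi⟩
  have hprofa := half_le_prof_pi_div_four
  have htaila : tail a ≤ M := tail_antitoneOn ⟨le_rfl, hpi.le⟩ ⟨ha0.le, hapi.le⟩ ha0.le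
  have hneck : quot (Real.pi / 2) = 5 * M := by
    rw [quot, prof_pi_div_two, hM, tail_pi_div_two]; ring
  obtain ⟨B, hB0, hB⟩ := exists_quot_le ha0 hapi
  -- the supremum of the quotient beyond the first bulge
  set c' := sSup (quot '' Ico a Real.pi)
  have hbdd : BddAbove (quot '' Ico a Real.pi) := ⟨B, by rintro _ ⟨t, ht, rfl⟩; exact hB t ht⟩
  have hle : ∀ t ∈ Ico a Real.pi, quot t ≤ c' := fun t ht => le_csSup hbdd ⟨t, ht, rfl⟩
  have hc'5 : 5 * M ≤ c' := hneck ▸ hle _ ⟨by rw [ha]; linarith, by linarith⟩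
  -- the length `η` of a piece of the first bulge on which the quotient is at most `3 * M`
  obtain ⟨a', ha', hprofa'⟩ : ∃ a' ∈ Ioo 0 a, prof a' = 1 / 3 :=
    intermediate_value_Ioo ha0.le continuous_prof.continuousOn
      ⟨by rw [prof_zero]; norm_num, by linarith⟩
  have hquota' : quot a' ≤ 3 * M := by
    have : tail a' ≤ M := tail_antitoneOn ⟨le_rfl, hpi.le⟩ ⟨ha'.1.le, by linarith [ha'.2]⟩ ha'.1.le
    rw [quot, hprofa']; linarith
  set η := (∫ s in a'..a, speed s) / 4 with hη
  have hη0 : 0 < η := by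
    refine div_pos (intervalIntegral.intervalIntegral_pos_of_pos_on
      (continuous_speed.intervalIntegrable _ _) (fun x _ => speed_pos x) ha'.2) (by norm_num)
  set ℓ := ∫ s in a..Real.pi, speed s with hℓ
  have hℓ0 : 0 < ℓ := intervalIntegral.intervalIntegral_pos_of_pos_on
      (continuous_speed.intervalIntegrable _ _) (fun x _ => speed_pos x) hapi
  set c := max (4 * M) (c' * ℓ / (ℓ + η)) with hc
  have hc4 : 4 * M ≤ c := le_max_left _ _
  have hc0 : 0 < c := by linarith
  have hc'0 : 0 < c' := by linarith
  have hcc' : c < c' := by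
    refine max_lt (by linarith) ?_
    rw [div_lt_iff₀ (by positivity)]
    nlinarith
  have hcη : (c' - c) * ℓ ≤ η * c := by
    have : c' * ℓ / (ℓ + η) ≤ c := le_max_right _ _
    rw [div_le_iff₀ (by positivity)] at this
    linarith
  obtain ⟨t₀, ht₀, hzero⟩ : ∃ t₀ ∈ Ioo 0 a, c * prof t₀ - tail t₀ = 0 := by
    refine intermediate_value_Ioo ha0.le
      ((continuous_const.mul continuous_prof).sub continuous_tail).continuousOn ⟨?_, ?_⟩
    · change c * prof 0 - tail 0 < 0
      rw [prof_zero]; linarith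
    · change 0 < c * prof a - tail a
      nlinarith
  have ht₀' : t₀ ∈ Ioo 0 Real.pi := ⟨ht₀.1, ht₀.2.trans hapi⟩
  have hquot₀ : quot t₀ = c := by
    rw [quot, div_eq_iff (prof_pos ht₀').ne']; linarith
  have hta' : t₀ < a' := by
    by_contra! h
    have := quot_antitoneOn ⟨ha'.1, ha'.2.le⟩ ⟨ht₀.1, ht₀.2.le⟩ h
    linarith
  have hcont : ContinuousOn (fun s => speed s * (c - quot s)) (Ioo 0 Real.pi) :=
    continuous_speed.continuousOn.mul (continuousOn_const.sub continuousOn_quot)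
  have hint : ∀ x y : ℝ, x ∈ Ioo 0 Real.pi → y ∈ Ioo 0 Real.pi →
      IntervalIntegrable (fun s => speed s * (c - quot s)) volume x y := fun x y hx hy =>
    (hcont.mono (ordConnected_Ioo.uIcc_subset hx hy)).intervalIntegrable
  have hfirst : ∀ s ∈ Icc t₀ a, 0 ≤ speed s * (c - quot s) := fun s hs => by
    have := quot_antitoneOn ⟨ht₀.1, ht₀.2.le⟩ ⟨ht₀.1.trans_le hs.1, hs.2⟩ hs.1
    exact mul_nonneg (speed_pos s).le (by linarith)
  refine ⟨c, t₀, hc0, ht₀, by linarith, fun t ht => ?_, ?_⟩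
  · rcases le_total t a with hta | hta
    · exact intervalIntegral.integral_nonneg ht.1 fun s hs => hfirst s ⟨hs.1, hs.2.trans hta⟩
    have ha_mem : a ∈ Ioo 0 Real.pi := ⟨ha0, hapi⟩
    have ha'_mem : a' ∈ Ioo 0 Real.pi := ⟨ha'.1, ha'.2.trans hapi⟩
    have ht_mem : t ∈ Ioo 0 Real.pi := ⟨ha0.trans_le hta, ht.2⟩
    rw [← intervalIntegral.integral_add_adjacent_intervals (hint _ _ ht₀' ha'_mem)
      (hint _ _ ha'_mem ht_mem),
      ← intervalIntegral.integral_add_adjacent_intervals (hint _ _ ha'_mem ha_mem)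
      (hint _ _ ha_mem ht_mem)]
    have h1 : 0 ≤ ∫ s in t₀..a', speed s * (c - quot s) :=
      intervalIntegral.integral_nonneg hta'.le fun s hs => hfirst s ⟨hs.1, hs.2.trans ha'.2.le⟩
    have h2 : η * c ≤ ∫ s in a'..a, speed s * (c - quot s) := by
      have : η * c = ∫ s in a'..a, speed s * (c / 4) := by
        rw [intervalIntegral.integral_mul_const]; ring
      rw [this]
      refine intervalIntegral.integral_mono_on ha'.2.le
        (Continuous.intervalIntegrable (continuous_speed.mul continuous_const) _ _)
        (hint _ _ ha'_mem ha_mem) fun s hs => ?_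
      have := quot_antitoneOn ⟨ha'.1, ha'.2.le⟩ ⟨ha'.1.trans_le hs.1, hs.2⟩ hs.1
      exact mul_le_mul_of_nonneg_left (by linarith) (speed_pos s).le
    have h3 : -((c' - c) * ℓ) ≤ ∫ s in a..t, speed s * (c - quot s) := by
      have h4 : ∫ s in a..t, speed s * (c - c') ≤ ∫ s in a..t, speed s * (c - quot s) := by
        refine intervalIntegral.integral_mono_on hta
          (Continuous.intervalIntegrable (continuous_speed.mul continuous_const) _ _)
          (hint _ _ ha_mem ht_mem) fun s hs => ?_
        have := hle s ⟨hs.1, hs.2.trans_lt ht.2⟩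
        exact mul_le_mul_of_nonneg_left (by linarith) (speed_pos s).le
      have h5 : (∫ s in a..t, speed s) ≤ ℓ :=
        intervalIntegral.integral_mono_interval le_rfl hta ht.2.le
          (ae_of_all _ fun s => (speed_pos s).le) (continuous_speed.intervalIntegrable _ _)
      rw [intervalIntegral.integral_mul_const] at h4
      nlinarith
    linarith
  · obtain ⟨_, ⟨t₁, ht₁, rfl⟩, hlt⟩ := exists_lt_of_lt_csSup
      (Nonempty.image quot ⟨a, left_mem_Ico.2 hapi⟩) hcc'
    exact ⟨t₁, ⟨ht₀.2.trans_le ht₁.1, ht₁.2⟩, hlt⟩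

end Dumbbell

/-! ### The dumbbell as a surface of revolution -/

namespace Dumbbell

/-- The coordinates `(t, θ)` of the dumbbell scaled by `l`. -/
noncomputable def param (l : ℝ) : ℝ × ℝ → E3 :=
  revolve (fun t => l * prof t) (fun t => -(l * Real.cos t))

@[simp] lemma param_zero (l : ℝ) (q : ℝ × ℝ) : param l q 0 = l * prof q.1 * Real.cos q.2 := rfl
@[simp] lemma param_one (l : ℝ) (q : ℝ × ℝ) : param l q 1 = l * prof q.1 * Real.sin q.2 := rfl
@[simp] lemma param_two (l : ℝ) (q : ℝ × ℝ) : param l q 2 = -(l * Real.cos q.1) := rfl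

/-- A polynomial whose zero set is the dumbbell scaled by `l`. -/
noncomputable def defFun (l : ℝ) (p : E3) : ℝ :=
  p 0 ^ 2 + p 1 ^ 2 - (l ^ 2 - p 2 ^ 2) * (1 / 100 + p 2 ^ 2 / l ^ 2)

lemma prof_sq (t : ℝ) : prof t ^ 2 = Real.sin t ^ 2 * (1 / 100 + Real.cos t ^ 2) := by
  rw [prof, mul_pow, Real.sq_sqrt (radicand_pos t).le]

lemma defFun_param {l : ℝ} (hl : 0 < l) (q : ℝ × ℝ) : defFun l (param l q) = 0 := by
  have h1 : (l * prof q.1 * Real.cos q.2) ^ 2 + (l * prof q.1 * Real.sin q.2) ^ 2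
      = l ^ 2 * prof q.1 ^ 2 := by
    linear_combination l ^ 2 * prof q.1 ^ 2 * Real.sin_sq_add_cos_sq q.2
  simp only [defFun, param_zero, param_one, param_two]
  rw [h1, prof_sq, Real.sin_sq]
  field_simp
  ring

lemma exists_polar (x y : ℝ) : ∃ θ ∈ Ico 0 (2 * Real.pi),
    x = √(x ^ 2 + y ^ 2) * Real.cos θ ∧ y = √(x ^ 2 + y ^ 2) * Real.sin θ := by
  refine ⟨toIcoMod Real.two_pi_pos 0 (Complex.arg ⟨x, y⟩), ?_, ?_⟩
  · simpa using toIcoMod_mem_Ico Real.two_pi_pos 0 (Complex.arg ⟨x, y⟩)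
  have hn : √(x ^ 2 + y ^ 2) = ‖(⟨x, y⟩ : ℂ)‖ := by
    rw [Complex.norm_def, Complex.normSq_mk, sq, sq]
  have hc := Complex.norm_mul_cos_arg ⟨x, y⟩
  have hs := Complex.norm_mul_sin_arg ⟨x, y⟩
  rw [hn, toIcoMod]
  simp only [zsmul_eq_mul, Real.cos_sub_int_mul_two_pi, Real.sin_sub_int_mul_two_pi]
  exact ⟨hc.symm, hs.symm⟩

lemma exists_param_eq {l : ℝ} (hl : 0 < l) {p : E3} (hp : defFun l p = 0) :
    -(p 2) / l ∈ Icc (-1) 1 ∧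
      ∃ θ ∈ Ico 0 (2 * Real.pi), p = param l (Real.arccos (-(p 2) / l), θ) := by
  have hq : 0 < 1 / 100 + p 2 ^ 2 / l ^ 2 := by positivity
  unfold defFun at hp
  have hz : p 2 ^ 2 ≤ l ^ 2 := by
    by_contra! h
    nlinarith [sq_nonneg (p 0), sq_nonneg (p 1), mul_pos (sub_pos.2 h) hq]
  have habs := abs_le_of_sq_le_sq' hz hl.le
  have hmem : -(p 2) / l ∈ Icc (-1) 1 := by
    constructor
    · rw [le_div_iff₀ hl]; linarith
    · rw [div_le_iff₀ hl]; linarith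
  refine ⟨hmem, ?_⟩
  set t := Real.arccos (-(p 2) / l) with ht
  have hcos : Real.cos t = -(p 2) / l := Real.cos_arccos hmem.1 hmem.2
  have ht0 : t ∈ Icc 0 Real.pi := ⟨Real.arccos_nonneg _, Real.arccos_le_pi _⟩
  have hr : √(p 0 ^ 2 + p 1 ^ 2) = l * prof t := by
    rw [Real.sqrt_eq_iff_mul_self_eq (by positivity) (mul_nonneg hl.le (prof_nonneg ht0))]
    rw [← sq, mul_pow, prof_sq, Real.sin_sq, hcos]
    field_simp
    field_simp at hp
    linarith
  obtain ⟨θ, hθ, h0, h1⟩ := exists_polar (p 0) (p 1)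
  rw [hr] at h0 h1
  refine ⟨θ, hθ, ?_⟩
  ext i
  fin_cases i
  · exact h0
  · exact h1
  · change p 2 = -(l * Real.cos t)
    rw [hcos]; field_simp

lemma image_param {l : ℝ} (hl : 0 < l) :
    param l '' (Icc 0 Real.pi ×ˢ Ico 0 (2 * Real.pi)) = {p | defFun l p = 0} := by
  ext p
  constructor
  · rintro ⟨q, -, rfl⟩
    exact defFun_param hl q
  · intro hp
    obtain ⟨-, θ, hθ, h⟩ := exists_param_eq hl hp
    exact ⟨_, ⟨⟨Real.arccos_nonneg _, Real.arccos_le_pi _⟩, hθ⟩, h.symm⟩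

lemma hasDerivAt_coord {c : ℝ → E3} {v : E3} {s : ℝ} (hc : HasDerivAt c v s) (i : Fin 3) :
    HasDerivAt (fun s => c s i) (v i) s :=
  ((EuclideanSpace.proj (𝕜 := ℝ) i).hasFDerivAt (x := c s)).comp_hasDerivAt s hc

lemma hasDerivAt_of_coord {c : ℝ → E3} {v : E3} {s : ℝ}
    (h : ∀ i, HasDerivAt (fun s => c s i) (v i) s) : HasDerivAt c v s := by
  have h1 : HasDerivAt (fun s => (WithLp.ofLp (c s) : Fin 3 → ℝ)) (WithLp.ofLp v) s :=
    hasDerivAt_pi.2 h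
  exact ((PiLp.continuousLinearEquiv 2 ℝ (fun _ : Fin 3 => ℝ)).symm.hasFDerivAt).comp_hasDerivAt
    s h1

lemma contDiff_coord {n : WithTop ℕ∞} (i : Fin 3) : ContDiff ℝ n fun p : E3 => p i :=
  (EuclideanSpace.proj (𝕜 := ℝ) i).contDiff

lemma continuous_coord (i : Fin 3) : Continuous fun p : E3 => p i :=
  (EuclideanSpace.proj (𝕜 := ℝ) i).continuous

lemma contDiff_defFun (l : ℝ) : ContDiff ℝ ∞ (defFun l) := by
  have h := fun i => contDiff_coord (n := ∞) i
  unfold defFun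
  exact (((h 0).pow 2).add ((h 1).pow 2)).sub ((contDiff_const.sub ((h 2).pow 2)).mul
    (contDiff_const.add (((h 2).pow 2).div_const _)))

lemma hasDerivAt_defFun_comp (l : ℝ) {c : ℝ → E3} {v : E3} {s : ℝ} (hc : HasDerivAt c v s) :
    HasDerivAt (fun s => defFun l (c s)) (2 * c s 0 * v 0 + 2 * c s 1 * v 1 +
      2 * c s 2 * (1 / 100 + c s 2 ^ 2 / l ^ 2 - (l ^ 2 - c s 2 ^ 2) / l ^ 2) * v 2) s := by
  have h := fun i => (hasDerivAt_coord hc i).pow 2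
  have := ((h 0).add (h 1)).sub (((h 2).const_sub (l ^ 2)).mul (((h 2).div_const (l ^ 2)).const_add
    (1 / 100 : ℝ)))
  refine this.congr_deriv ?_
  simp only [Pi.pow_apply]
  push_cast
  ring

lemma isSmoothSurface {l : ℝ} (hl : 0 < l) : IsSmoothSurface {p : E3 | defFun l p = 0} := by
  intro p hp
  have hF := contDiff_defFun l
  refine ⟨{x | fderiv ℝ (defFun l) x ≠ 0}, ?_, ?_, defFun l, hF.contDiffOn, fun x hx => hx, ?_⟩
  · exact isOpen_ne_fun (hF.continuous_fderiv (by simp)) continuous_const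
  · intro h0
    have hline : ∀ v : E3, HasDerivAt (fun s : ℝ => p + s • v) v 0 := fun v => by
      simpa using ((hasDerivAt_id (0 : ℝ)).smul_const v).const_add p
    have key : ∀ v : E3, 2 * p 0 * v 0 + 2 * p 1 * v 1 +
        2 * p 2 * (1 / 100 + p 2 ^ 2 / l ^ 2 - (l ^ 2 - p 2 ^ 2) / l ^ 2) * v 2 = 0 := fun v => by
      have h1 := hasDerivAt_defFun_comp l (hline v)
      have h2 : HasDerivAt (fun s : ℝ => defFun l (p + s • v)) (fderiv ℝ (defFun l) p v) 0 := by
        have h3 : HasFDerivAt (defFun l) (fderiv ℝ (defFun l) p) (p + (0 : ℝ) • v) := by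
          rw [zero_smul, add_zero]; exact (hF.differentiable (by simp) p).hasFDerivAt
        exact h3.comp_hasDerivAt 0 (hline v)
      rw [h0] at h2
      have h4 := h1.unique h2
      simpa using h4
    have hxy := key !₂[p 0, p 1, 0]
    have hz := key !₂[0, 0, 1]
    simp at hxy hz
    have hp0 : p 0 = 0 := by nlinarith [sq_nonneg (p 0), sq_nonneg (p 1)]
    have hp1 : p 1 = 0 := by nlinarith [sq_nonneg (p 0), sq_nonneg (p 1)]
    have hq : 0 < 1 / 100 + p 2 ^ 2 / l ^ 2 := by positivity
    have hp' : (l ^ 2 - p 2 ^ 2) * (1 / 100 + p 2 ^ 2 / l ^ 2) = 0 := by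
      have : defFun l p = 0 := hp
      unfold defFun at this; rw [hp0, hp1] at this; linarith
    have hl2 : l ^ 2 - p 2 ^ 2 = 0 := by
      rcases mul_eq_zero.1 hp' with h | h
      · exact h
      · exact absurd h hq.ne'
    rw [hl2] at hz
    rcases hz with h | h
    · rw [h] at hl2; nlinarith
    · norm_num at h
      have : 0 ≤ p 2 ^ 2 / l ^ 2 := by positivity
      linarith
  · ext x; exact and_comm

lemma deriv_radius (l t : ℝ) : deriv (fun t => l * prof t) t = l * dprof t :=
  ((hasDerivAt_prof t).const_mul l).deriv

lemma hasDerivAt_height (l t : ℝ) :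
    HasDerivAt (fun t => -(l * Real.cos t)) (l * Real.sin t) t :=
  ((Real.hasDerivAt_cos t).const_mul l).neg.congr_deriv (by ring)

/-- The dumbbell scaled by `l`. -/
noncomputable def surf {l : ℝ} (hl : 0 < l) : SurfaceOfRevolution where
  T := Real.pi
  r := fun t => l * prof t
  h := fun t => -(l * Real.cos t)
  T_pos := Real.pi_pos
  smooth_r := contDiff_const.mul contDiff_prof
  smooth_h := (contDiff_const.mul Real.contDiff_cos).neg
  regular := fun t _ h => by
    rw [Prod.mk.injEq, deriv_radius, (hasDerivAt_height l t).deriv] at h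
    have h1 := (mul_eq_zero.1 h.1).resolve_left hl.ne'
    have h2 := (mul_eq_zero.1 h.2).resolve_left hl.ne'
    have := speed_sq t
    rw [h1, h2] at this
    have := speed_pos t
    nlinarith
  simple := fun s hs t ht h => by
    simp only [Prod.mk.injEq, neg_inj] at h
    exact Real.injOn_cos hs ht (mul_left_cancel₀ hl.ne' h.2)
  r_zero := by simp
  r_T := by simp
  r_pos := fun t ht => mul_pos hl (prof_pos ht)
  smooth_surface := by
    have := isSmoothSurface hl
    rwa [← image_param hl] at this

variable {l : ℝ} (hl : 0 < l)

lemma carrier_eq : (surf hl).carrier = {p | defFun l p = 0} := image_param hl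

lemma param_mem_carrier (q : ℝ × ℝ) : param l q ∈ (surf hl).carrier := by
  rw [carrier_eq]; exact defFun_param hl q

lemma base_eq (θ : ℝ) : param l (0, θ) = (surf hl).base := by
  change revolve _ _ _ = revolve _ _ _
  simp [revolve, surf]

/-- The unit vector at the point `(t, θ)` in the direction of the meridian. -/
noncomputable def frame (q : ℝ × ℝ) : E3 :=
  (speed q.1)⁻¹ • !₂[dprof q.1 * Real.cos q.2, dprof q.1 * Real.sin q.2, Real.sin q.1]

lemma norm_frame (q : ℝ × ℝ) : ‖frame q‖ = 1 := by
  have hs := speed_pos q.1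
  have h1 : ‖(!₂[dprof q.1 * Real.cos q.2, dprof q.1 * Real.sin q.2, Real.sin q.1] : E3)‖
      = speed q.1 := by
    rw [EuclideanSpace.norm_eq, speed]
    congr 1
    simp only [Fin.sum_univ_three, Real.norm_eq_abs, sq_abs]
    change (dprof q.1 * Real.cos q.2) ^ 2 + (dprof q.1 * Real.sin q.2) ^ 2 + Real.sin q.1 ^ 2 = _
    linear_combination dprof q.1 ^ 2 * Real.sin_sq_add_cos_sq q.2
  rw [frame, norm_smul, h1, norm_inv, Real.norm_of_nonneg hs.le, inv_mul_cancel₀ hs.ne']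

lemma inner_frame (q : ℝ × ℝ) (v : E3) : inner ℝ (frame q) v = (speed q.1)⁻¹ *
    (dprof q.1 * (Real.cos q.2 * v 0 + Real.sin q.2 * v 1) + Real.sin q.1 * v 2) := by
  rw [frame, real_inner_smul_left, PiLp.inner_apply]
  simp [Fin.sum_univ_three]
  left; ring

lemma continuous_frame : Continuous frame := by
  unfold frame
  have h1 := continuous_speed
  have h2 := continuous_dprof
  refine Continuous.smul ((h1.comp continuous_fst).inv₀ fun q => (speed_pos q.1).ne') ?_
  fun_prop

lemma hasDerivAt_param (l t θ : ℝ) :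
    HasDerivAt (fun s => param l (s, θ)) ((l * speed t) • frame (t, θ)) t := by
  have hs := (speed_pos t).ne'
  have hv : (l * speed t) • frame (t, θ) =
      !₂[l * dprof t * Real.cos θ, l * dprof t * Real.sin θ, l * Real.sin t] := by
    ext i
    fin_cases i <;> simp [frame] <;> field_simp
  rw [hv]
  refine hasDerivAt_of_coord fun i => ?_
  fin_cases i
  · exact ((hasDerivAt_prof t).const_mul l).mul_const (Real.cos θ)
  · exact ((hasDerivAt_prof t).const_mul l).mul_const (Real.sin θ)
  · exact hasDerivAt_height l t

lemma hasDerivAt_param_angle (l t θ : ℝ) : HasDerivAt (fun s => param l (t, s))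
    !₂[-(l * prof t * Real.sin θ), l * prof t * Real.cos θ, 0] θ := by
  refine hasDerivAt_of_coord fun i => ?_
  fin_cases i
  · exact ((Real.hasDerivAt_cos θ).const_mul (l * prof t)).congr_deriv (by simp)
  · exact (Real.hasDerivAt_sin θ).const_mul (l * prof t)
  · exact hasDerivAt_const θ (-(l * Real.cos t))

lemma contDiff_param (l : ℝ) : ContDiff ℝ ∞ (param l) := by
  rw [contDiff_euclidean]
  have h1 : ContDiff ℝ ∞ fun q : ℝ × ℝ => l * prof q.1 :=
    contDiff_const.mul (contDiff_prof.comp contDiff_fst)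
  intro i
  fin_cases i
  · exact h1.mul (Real.contDiff_cos.comp contDiff_snd)
  · exact h1.mul (Real.contDiff_sin.comp contDiff_snd)
  · exact (contDiff_const.mul (Real.contDiff_cos.comp contDiff_fst)).neg

lemma continuous_param (l : ℝ) : Continuous (param l) := (contDiff_param l).continuous

/-- The area density in the coordinates `(t, θ)`. -/
noncomputable def dens (l : ℝ) (q : ℝ × ℝ) : ℝ := l ^ 2 * (|prof q.1| * speed q.1)

lemma continuous_dens (l : ℝ) : Continuous (dens l) := by
  have := continuous_prof
  have := continuous_speed
  unfold dens
  fun_prop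

lemma areaDensity_eq (q : ℝ × ℝ) : (surf hl).areaDensity q = dens l q := by
  have hd : HasFDerivAt (param l) (fderiv ℝ (param l) q) q :=
    ((contDiff_param l).differentiable (by simp) q).hasFDerivAt
  have h1 : fderiv ℝ (param l) q (1, 0) = (l * speed q.1) • frame q := by
    refine HasDerivAt.unique ?_ (hasDerivAt_param l q.1 q.2)
    exact hd.comp_hasDerivAt q.1 ((hasDerivAt_id q.1).prodMk (hasDerivAt_const q.1 q.2))
  have h2 : fderiv ℝ (param l) q (0, 1) =
      !₂[-(l * prof q.1 * Real.sin q.2), l * prof q.1 * Real.cos q.2, 0] := by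
    refine HasDerivAt.unique ?_ (hasDerivAt_param_angle l q.1 q.2)
    exact hd.comp_hasDerivAt q.2 ((hasDerivAt_const q.2 q.1).prodMk (hasDerivAt_id q.2))
  change √(inner ℝ (fderiv ℝ (param l) q (1, 0)) (fderiv ℝ (param l) q (1, 0)) *
    inner ℝ (fderiv ℝ (param l) q (0, 1)) (fderiv ℝ (param l) q (0, 1)) -
    inner ℝ (fderiv ℝ (param l) q (1, 0)) (fderiv ℝ (param l) q (0, 1)) ^ 2) = _
  rw [h1, h2, real_inner_self_eq_norm_sq, norm_smul, norm_frame, real_inner_smul_left,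
    inner_frame, PiLp.inner_apply]
  simp only [Fin.sum_univ_three]
  have h3 : ∀ x y : ℝ, inner ℝ x y = y * x := fun x y => rfl
  simp only [h3]
  rw [show dens l q = √((dens l q) ^ 2) from (Real.sqrt_sq (by
    unfold dens; have := speed_pos q.1; positivity)).symm]
  congr 1
  simp only [dens, mul_pow, sq_abs]
  simp [mul_pow]
  linear_combination l ^ 4 * speed q.1 ^ 2 * prof q.1 ^ 2 * Real.sin_sq_add_cos_sq q.2

/-- The area measure in the coordinates `(t, θ)`. -/
noncomputable def coordMeasure (l : ℝ) : Measure (ℝ × ℝ) :=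
  (volume.restrict (Ioo 0 Real.pi ×ˢ Ioo 0 (2 * Real.pi))).withDensity
    fun q => ENNReal.ofReal (dens l q)

lemma area_eq : (surf hl).area = (coordMeasure l).map (param l) := by
  have : (surf hl).areaDensity = dens l := funext (areaDensity_eq hl)
  rw [SurfaceOfRevolution.area, this]
  rfl

lemma measurable_param (l : ℝ) : Measurable (param l) := (continuous_param l).measurable

lemma dens_pos (hl : 0 < l) {q : ℝ × ℝ} (hq : q.1 ∈ Ioo 0 Real.pi) : 0 < dens l q := by
  have h1 := prof_pos hq
  have h2 := speed_pos q.1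
  unfold dens
  positivity

lemma measurableSet_coordRect : MeasurableSet (Ioo 0 Real.pi ×ˢ Ioo 0 (2 * Real.pi)) :=
  measurableSet_Ioo.prod measurableSet_Ioo

lemma ae_coordMeasure_mem (l : ℝ) :
    ∀ᵐ q ∂coordMeasure l, q ∈ Ioo 0 Real.pi ×ˢ Ioo 0 (2 * Real.pi) :=
  (withDensity_absolutelyContinuous _ _).ae_le (ae_restrict_mem measurableSet_coordRect)

lemma ae_coordMeasure_fst (l : ℝ) : ∀ᵐ q ∂coordMeasure l, q.1 ∈ Ioo 0 Real.pi :=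
  (ae_coordMeasure_mem l).mono fun _ h => h.1

lemma ae_restrict_of_ae_coordMeasure (hl : 0 < l) {P : ℝ × ℝ → Prop}
    (h : ∀ᵐ q ∂coordMeasure l, P q) :
    ∀ᵐ q ∂volume.restrict (Ioo 0 Real.pi ×ˢ Ioo 0 (2 * Real.pi)), P q := by
  rw [coordMeasure, ae_withDensity_iff (continuous_dens l).measurable.ennreal_ofReal] at h
  filter_upwards [h, ae_restrict_mem measurableSet_coordRect] with q h1 h2
  exact h1 (ENNReal.ofReal_pos.2 (dens_pos hl h2.1)).ne'

lemma integral_coordMeasure (hl : 0 < l) (F : ℝ × ℝ → ℝ) : ∫ q, F q ∂coordMeasure l =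
    ∫ q in Ioo 0 Real.pi ×ˢ Ioo 0 (2 * Real.pi), dens l q * F q := by
  rw [coordMeasure, integral_withDensity_eq_integral_toReal_smul
    (continuous_dens l).measurable.ennreal_ofReal (ae_of_all _ fun _ => ENNReal.ofReal_lt_top)]
  refine setIntegral_congr_fun measurableSet_coordRect fun q hq => ?_
  simp only [ENNReal.toReal_ofReal (dens_pos hl hq.1).le, smul_eq_mul]

lemma _root_.Continuous.integrableOn_coordRect {F : ℝ × ℝ → ℝ} (hF : Continuous F) :
    IntegrableOn F (Ioo 0 Real.pi ×ˢ Ioo 0 (2 * Real.pi)) :=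
  (hF.continuousOn.integrableOn_compact (isCompact_Icc.prod isCompact_Icc)).mono_set
    (Set.prod_mono Ioo_subset_Icc_self Ioo_subset_Icc_self)

instance (l : ℝ) : IsFiniteMeasure (coordMeasure l) :=
  isFiniteMeasure_withDensity_ofReal (continuous_dens l).integrableOn_coordRect.2

instance : IsFiniteMeasure (surf hl).area := by
  rw [area_eq]; infer_instance

/-- A property holds almost everywhere on the dumbbell if it holds away from the poles. -/
lemma ae_area_of_forall {P : E3 → Prop}
    (h : ∀ t ∈ Ioo 0 Real.pi, ∀ θ ∈ Ico 0 (2 * Real.pi), P (param l (t, θ))) :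
    ∀ᵐ p ∂(surf hl).area, P p := by
  have hmeas : MeasurableSet {p : E3 | defFun l p = 0 ∧ p 2 ∈ Ioo (-l) l} :=
    ((isClosed_singleton.preimage (contDiff_defFun l).continuous).measurableSet).inter
      (isOpen_Ioo.preimage (continuous_coord 2)).measurableSet
  have hae : ∀ᵐ p ∂(surf hl).area, p ∈ {p : E3 | defFun l p = 0 ∧ p 2 ∈ Ioo (-l) l} := by
    rw [area_eq]
    refine (ae_map_iff (measurable_param l).aemeasurable hmeas).2 ?_
    filter_upwards [ae_coordMeasure_fst l] with q hq
    refine ⟨defFun_param hl q, ?_⟩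
    have h1 := Real.cos_lt_cos_of_nonneg_of_le_pi le_rfl hq.2.le hq.1
    have h2 := Real.cos_lt_cos_of_nonneg_of_le_pi hq.1.le le_rfl hq.2
    rw [Real.cos_zero] at h1
    rw [Real.cos_pi] at h2
    rw [param_two]
    constructor <;> nlinarith
  filter_upwards [hae] with p hp
  obtain ⟨-, θ, hθ, hpθ⟩ := exists_param_eq hl hp.1
  rw [hpθ]
  refine h _ ⟨Real.arccos_pos.2 ?_, Real.arccos_lt_pi.2 ?_⟩ _ hθ
  · rw [div_lt_one hl]; linarith [hp.2.1]
  · rw [lt_div_iff₀ hl]; linarith [hp.2.2]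

lemma ae_coordMeasure_of_ae_area {P : E3 → Prop} (h : ∀ᵐ p ∂(surf hl).area, P p) :
    ∀ᵐ q ∂coordMeasure l, P (param l q) := by
  rw [area_eq] at h
  exact ae_of_ae_map (measurable_param l).aemeasurable h

/-! ### The tangent planes -/

lemma frame_mem_tangentPlane (t θ : ℝ) :
    frame (t, θ) ∈ (surf hl).tangentPlane (param l (t, θ)) := by
  have h : (l * speed t) • frame (t, θ) ∈ (surf hl).tangentPlane (param l (t, θ)) := by
    refine Submodule.subset_span ⟨fun s => param l (t + s, θ), by simp,
      Eventually.of_forall fun s => param_mem_carrier hl _, ?_⟩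
    have := hasDerivAt_param l t θ
    rw [← add_zero t] at this
    simpa using this.comp_const_add t 0
  have hne : l * speed t ≠ 0 := (mul_pos hl (speed_pos t)).ne'
  exact (Submodule.smul_mem_iff _ hne).1 h

/-- A tangent vector away from the poles gains height only through its component along the
meridian. -/
lemma height_of_mem_tangentPlane {t θ : ℝ} (ht : t ∈ Ioo 0 Real.pi) {v : E3}
    (hv : v ∈ (surf hl).tangentPlane (param l (t, θ))) :
    v 2 = Real.sin t / speed t * inner ℝ (frame (t, θ)) v := by
  have hsin := Real.sin_pos_of_mem_Ioo ht
  have hspeed := speed_pos t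
  have hq := sqrt_radicand_pos t
  have hsq := Real.sq_sqrt (radicand_pos t).le
  have key : Real.sin t * (Real.cos θ * v 0 + Real.sin θ * v 1) = dprof t * v 2 := by
    refine Submodule.span_induction (p := fun v _ => Real.sin t * (Real.cos θ * v 0 +
      Real.sin θ * v 1) = dprof t * v 2) ?_ (by simp) ?_ ?_ hv
    · rintro v ⟨c, hc0, hc, hcv⟩
      have h1 := hasDerivAt_defFun_comp l hcv
      have h2 : (fun s => defFun l (c s)) =ᶠ[𝓝 0] fun _ => 0 := hc.mono fun s hs => by
        rw [carrier_eq] at hs; exact hs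
      have h3 := (h1.congr_of_eventuallyEq h2.symm).unique (hasDerivAt_const (0 : ℝ) (0 : ℝ))
      rw [hc0] at h3
      simp only [param_zero, param_one, param_two] at h3
      have h4 : 1 / 100 + (-(l * Real.cos t)) ^ 2 / l ^ 2
          - (l ^ 2 - (-(l * Real.cos t)) ^ 2) / l ^ 2
          = 1 / 100 + Real.cos t ^ 2 - Real.sin t ^ 2 := by
        rw [Real.sin_sq]; field_simp
      rw [h4] at h3
      have h5 : dprof t * √(1 / 100 + Real.cos t ^ 2)
          = Real.cos t * (1 / 100 + Real.cos t ^ 2 - Real.sin t ^ 2) := by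
        rw [dprof, div_mul_cancel₀ _ hq.ne']
      have h6 : l * √(1 / 100 + Real.cos t ^ 2) ≠ 0 := by positivity
      apply mul_left_cancel₀ h6
      unfold prof at h3
      linear_combination h3 / 2 - l * v 2 * h5
    · intro x y _ _ hx hy
      simp only [PiLp.add_apply]
      linear_combination hx + hy
    · intro a x _ hx
      simp only [PiLp.smul_apply, smul_eq_mul]
      linear_combination a * hx
  rw [inner_frame]
  have hs2 := speed_sq t
  field_simp
  linear_combination v 2 * hs2 - dprof t * key

lemma fderiv_eq_inner {f : E3 → ℝ} {p : E3} (v : E3) :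
    fderiv ℝ f p v = inner ℝ (gradient f p) v := by
  rw [gradient, InnerProductSpace.toDual_symm_apply]

lemma inner_frame_surfaceGradient (f : E3 → ℝ) (t θ : ℝ) :
    inner ℝ (frame (t, θ)) ((surf hl).surfaceGradient f (param l (t, θ))) =
      inner ℝ (frame (t, θ)) (gradient f (param l (t, θ))) := by
  have h := Submodule.starProjection_inner_eq_zero (gradient f (param l (t, θ))) (frame (t, θ))
    (K := (surf hl).tangentPlane (param l (t, θ))) (frame_mem_tangentPlane hl t θ)
  rw [SurfaceOfRevolution.surfaceGradient, real_inner_comm]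
  rw [inner_sub_left, sub_eq_zero] at h
  rw [← h, real_inner_comm]

lemma hasDerivAt_comp_param {f : E3 → ℝ} (hf : Differentiable ℝ f) (t θ : ℝ) :
    HasDerivAt (fun s => f (param l (s, θ)))
      (l * speed t * inner ℝ (frame (t, θ)) (gradient f (param l (t, θ)))) t := by
  have h := (hf (param l (t, θ))).hasFDerivAt.comp_hasDerivAt t (hasDerivAt_param l t θ)
  refine h.congr_deriv ?_
  rw [fderiv_eq_inner, real_inner_smul_right, real_inner_comm]

/-- The surface gradient of a function of the height. -/
lemma surfaceGradient_height {U : ℝ → ℝ} {k : ℝ} {t θ : ℝ} (ht : t ∈ Ioo 0 Real.pi)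
    (hU : HasDerivAt U k (-(l * Real.cos t))) :
    (surf hl).surfaceGradient (fun p => U (p 2)) (param l (t, θ)) =
      (k * (Real.sin t / speed t)) • frame (t, θ) := by
  have hf : HasFDerivAt (fun p : E3 => U (p 2))
      (k • (EuclideanSpace.proj (𝕜 := ℝ) (2 : Fin 3) : E3 →L[ℝ] ℝ)) (param l (t, θ)) :=
    HasDerivAt.comp_hasFDerivAt (param l (t, θ)) (f := fun p : E3 => p 2) hU
      (EuclideanSpace.proj (𝕜 := ℝ) (2 : Fin 3)).hasFDerivAt
  refine (Submodule.eq_starProjection_of_mem_of_inner_eq_zero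
    (Submodule.smul_mem _ _ (frame_mem_tangentPlane hl t θ)) fun v hv => ?_)
  rw [inner_sub_left, ← fderiv_eq_inner, hf.fderiv, real_inner_smul_left]
  change k * v 2 - _ = 0
  rw [height_of_mem_tangentPlane hl ht hv]
  ring

end Dumbbell

/-! ### Integration by parts along the meridians -/

namespace Dumbbell

/-- The parameter `t ∈ [0, π]` of a point of the dumbbell scaled by `l`, as a function on `ℝ³`. -/
noncomputable def param₁ (l : ℝ) (p : E3) : ℝ := Real.arccos (-(p 2) / l)

/-- The unit vector field along the meridians, as a vector field on `ℝ³`. -/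
noncomputable def merid (l : ℝ) (p : E3) : E3 :=
  (speed (param₁ l p))⁻¹ • !₂[dprof (param₁ l p) * (p 0 / (l * prof (param₁ l p))),
    dprof (param₁ l p) * (p 1 / (l * prof (param₁ l p))), Real.sin (param₁ l p)]

lemma continuous_param₁ (l : ℝ) : Continuous (param₁ l) :=
  Real.continuous_arccos.comp ((continuous_coord 2).neg.div_const l)

lemma param₁_mem (l : ℝ) (p : E3) : param₁ l p ∈ Icc 0 Real.pi :=
  ⟨Real.arccos_nonneg _, Real.arccos_le_pi _⟩

lemma param₁_param {l : ℝ} (hl : 0 < l) {q : ℝ × ℝ} (hq : q.1 ∈ Icc 0 Real.pi) :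
    param₁ l (param l q) = q.1 := by
  rw [param₁, param_two, neg_neg, mul_div_cancel_left₀ _ hl.ne', Real.arccos_cos hq.1 hq.2]

lemma merid_param {l : ℝ} (hl : 0 < l) {q : ℝ × ℝ} (hq : q.1 ∈ Ioo 0 Real.pi) :
    merid l (param l q) = frame q := by
  have h1 : l * prof q.1 ≠ 0 := (mul_pos hl (prof_pos hq)).ne'
  rw [merid, param₁_param hl (Ioo_subset_Icc_self hq), frame, param_zero, param_one,
    mul_div_cancel_left₀ _ h1, mul_div_cancel_left₀ _ h1]

lemma measurable_merid (l : ℝ) : Measurable (merid l) := by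
  have h1 := (continuous_param₁ l).measurable
  have h2 := continuous_speed.measurable.comp h1
  have h3 := continuous_dprof.measurable.comp h1
  have h4 := (continuous_prof.measurable.comp h1).const_mul l
  have h5 : ∀ i : Fin 3, Measurable fun p : E3 => p i := fun i => (continuous_coord i).measurable
  refine h2.inv.smul ((PiLp.continuous_toLp 2 (fun _ : Fin 3 => ℝ)).measurable.comp
    (measurable_pi_iff.2 fun i => ?_))
  fin_cases i
  · exact h3.mul ((h5 0).div h4)
  · exact h3.mul ((h5 1).div h4)
  · exact Real.measurable_sin.comp h1

lemma exists_abs_le_of_continuous {F : ℝ × ℝ → ℝ} (hF : Continuous F) :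
    ∃ C : ℝ, 0 < C ∧ ∀ q ∈ Icc 0 Real.pi ×ˢ Icc 0 (2 * Real.pi), |F q| ≤ C := by
  obtain ⟨C, hC⟩ := (isCompact_Icc.prod isCompact_Icc).exists_bound_of_continuousOn
    (hF.continuousOn (s := Icc 0 Real.pi ×ˢ Icc 0 (2 * Real.pi)))
  exact ⟨|C| + 1, by positivity, fun q hq => (hC q hq).trans (by linarith [le_abs_self C])⟩

lemma coordRect_subset : Ioo 0 Real.pi ×ˢ Ioo 0 (2 * Real.pi) ⊆
    Icc 0 Real.pi ×ˢ Icc 0 (2 * Real.pi) :=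
  Set.prod_mono Ioo_subset_Icc_self Ioo_subset_Icc_self

lemma ae_abs_le_of_continuous (l : ℝ) {F : ℝ × ℝ → ℝ} (hF : Continuous F) :
    ∃ C : ℝ, 0 < C ∧ ∀ᵐ q ∂coordMeasure l, |F q| ≤ C := by
  obtain ⟨C, hC, h⟩ := exists_abs_le_of_continuous hF
  exact ⟨C, hC, (ae_coordMeasure_mem l).mono fun q hq => h q (coordRect_subset hq)⟩

lemma _root_.Continuous.integrable_coordMeasure (l : ℝ) {F : ℝ × ℝ → ℝ} (hF : Continuous F) :
    Integrable F (coordMeasure l) := by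
  obtain ⟨C, -, h⟩ := ae_abs_le_of_continuous l hF
  exact Integrable.of_bound hF.aestronglyMeasurable C h

lemma exists_dens_bounds {l : ℝ} (hl : 0 < l) : ∃ a b : ℝ, 0 < a ∧ 0 < b ∧
    ∀ q : ℝ × ℝ, q.1 ∈ Icc 0 Real.pi → a * Real.sin q.1 ≤ dens l q ∧
      dens l q ≤ b * Real.sin q.1 := by
  obtain ⟨a, b, ha, hb, hab⟩ := exists_speed_bounds
  refine ⟨l ^ 2 * a / 10, l ^ 2 * b * 2, by positivity, by positivity, fun q hq => ?_⟩
  have h1 := Real.sin_nonneg_of_mem_Icc hq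
  have h2 := prof_ge hq
  have h3 := prof_le hq
  have h4 := hab _ hq
  have h5 := prof_nonneg hq
  rw [dens, abs_of_nonneg h5]
  constructor
  · have := mul_le_mul h2 h4.1 ha.le h5
    have := mul_le_mul_of_nonneg_left this (sq_nonneg l)
    linarith
  · have := mul_le_mul h3 h4.2 (speed_pos _).le (by positivity)
    have := mul_le_mul_of_nonneg_left this (sq_nonneg l)
    linarith

/-- The integral of a function `y` on the dumbbell, with respect to the area, along the part of the
meridian through the point `q` which lies beyond that point. -/
noncomputable def beyond (l : ℝ) (y : E3 → ℝ) (q : ℝ × ℝ) : ℝ :=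
  ∫ s in q.1..Real.pi, y (param l (s, q.2)) * dens l (s, q.2)

/-- `χ` is a cutoff near the pole `b`, with derivative `χ'` except at countably many points: both
vanish at `b` fast enough to make up for the singularity of the polar coordinates. -/
structure IsCutoff (χ χ' : ℝ → ℝ) (C : ℝ) : Prop where
  continuousOn : ContinuousOn χ (Icc 0 Real.pi)
  measurable : Measurable χ
  measurable' : Measurable χ'
  hasDerivAt : ∃ s : Set ℝ, s.Countable ∧ ∀ t ∈ Ioo 0 Real.pi \ s, HasDerivAt χ (χ' t) t
  bound : ∀ t ∈ Icc 0 Real.pi, |χ t| ≤ C * (1 - Real.cos t)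
  bound' : ∀ t ∈ Ioo 0 Real.pi, |χ' t| ≤ C * Real.sin t

section beyond

variable {l : ℝ} {y : E3 → ℝ}

lemma continuous_integrand (l : ℝ) (hy : Continuous y) :
    Continuous fun q : ℝ × ℝ => y (param l q) * dens l q :=
  (hy.comp (continuous_param l)).mul (continuous_dens l)

lemma continuous_beyond (hy : Continuous y) : Continuous (beyond l y) := by
  have h := continuous_integrand l hy
  have h1 : Continuous fun q : ℝ × ℝ => ∫ s in Real.pi..q.1,
      y (param l (s, q.2)) * dens l (s, q.2) := by
    refine intervalIntegral.continuous_parametric_intervalIntegral_of_continuous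
      (f := fun (q : ℝ × ℝ) s => y (param l (s, q.2)) * dens l (s, q.2)) ?_ continuous_fst
    exact h.comp (continuous_snd.prodMk (continuous_snd.comp continuous_fst))
  have h2 : beyond l y = fun q : ℝ × ℝ => -∫ s in Real.pi..q.1,
      y (param l (s, q.2)) * dens l (s, q.2) :=
    funext fun q => intervalIntegral.integral_symm _ _
  rw [h2]
  exact h1.neg

lemma hasDerivAt_beyond (hy : Continuous y) (t θ : ℝ) :
    HasDerivAt (fun s => beyond l y (s, θ)) (-(y (param l (t, θ)) * dens l (t, θ))) t := by
  have h : Continuous fun s => y (param l (s, θ)) * dens l (s, θ) :=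
    (continuous_integrand l hy).comp (continuous_id.prodMk continuous_const)
  exact intervalIntegral.integral_hasDerivAt_left (h.intervalIntegrable _ _)
    (h.stronglyMeasurableAtFilter _ _) h.continuousAt

@[simp] lemma beyond_pi (θ : ℝ) : beyond l y (Real.pi, θ) = 0 := by simp [beyond]

lemma exists_beyond_le (hl : 0 < l) (hy : Continuous y) : ∃ C : ℝ, 0 < C ∧
    ∀ q ∈ Icc 0 Real.pi ×ˢ Icc 0 (2 * Real.pi), |beyond l y q| ≤ C * (1 + Real.cos q.1) := by
  obtain ⟨M, hM, hyM⟩ := exists_abs_le_of_continuous (hy.comp (continuous_param l))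
  obtain ⟨a, b, ha, hb, hab⟩ := exists_dens_bounds hl
  refine ⟨M * b, by positivity, fun q hq => abs_integral_le_one_add_cos (fun s hs => ?_) hq.1⟩
  have h1 := hyM (s, q.2) ⟨hs, hq.2⟩
  have h2 := hab (s, q.2) hs
  have h3 : 0 ≤ dens l (s, q.2) :=
    (mul_nonneg ha.le (Real.sin_nonneg_of_mem_Icc hs)).trans h2.1
  rw [abs_mul, abs_of_nonneg h3, mul_assoc]
  exact mul_le_mul h1 h2.2 h3 hM.le

end beyond

section parts

variable {l : ℝ} {y : E3 → ℝ} {χ χ' : ℝ → ℝ} {C : ℝ}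

/-- The factor of the gradient in the formula of integration by parts. -/
noncomputable def gradWeight (l : ℝ) (y : E3 → ℝ) (χ : ℝ → ℝ) (q : ℝ × ℝ) : ℝ :=
  χ q.1 * beyond l y q / (l * prof q.1)

/-- The factor of the function in the formula of integration by parts. -/
noncomputable def funWeight (l : ℝ) (y : E3 → ℝ) (χ χ' : ℝ → ℝ) (q : ℝ × ℝ) : ℝ :=
  χ q.1 * y (param l q) - χ' q.1 * beyond l y q / dens l q

lemma measurable_gradWeight (hy : Continuous y) (hχ : Measurable χ) :
    Measurable (gradWeight l y χ) :=
  ((hχ.comp measurable_fst).mul (continuous_beyond hy).measurable).div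
    ((continuous_prof.measurable.comp measurable_fst).const_mul l)

lemma measurable_funWeight (hy : Continuous y) (hχ : Measurable χ) (hχ' : Measurable χ') :
    Measurable (funWeight l y χ χ') :=
  ((hχ.comp measurable_fst).mul (hy.measurable.comp (measurable_param l))).sub
    (((hχ'.comp measurable_fst).mul (continuous_beyond hy).measurable).div
      (continuous_dens l).measurable)

lemma IsCutoff.nonneg (hχ : IsCutoff χ χ' C) : 0 ≤ C := by
  have h := (abs_nonneg _).trans (hχ.bound Real.pi (right_mem_Icc.2 Real.pi_pos.le))
  rw [Real.cos_pi] at h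
  linarith

lemma gradWeight_bounded (hl : 0 < l) (hy : Continuous y) (hχ : IsCutoff χ χ' C) :
    ∃ B, ∀ᵐ q ∂coordMeasure l, ‖gradWeight l y χ q‖ ≤ B := by
  obtain ⟨D, hD, hyD⟩ := exists_beyond_le hl hy
  have hC := hχ.nonneg
  refine ⟨10 * C * D / l, (ae_coordMeasure_mem l).mono fun q hq => ?_⟩
  have h0 := Real.sin_pos_of_mem_Ioo hq.1
  have h1 := hχ.bound q.1 (Ioo_subset_Icc_self hq.1)
  have h2 := hyD q (coordRect_subset hq)
  have h3 := prof_ge (Ioo_subset_Icc_self hq.1)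
  have h4 := mul_pos hl (prof_pos hq.1)
  rw [gradWeight, Real.norm_eq_abs, abs_div, abs_of_pos h4, abs_mul, div_le_div_iff₀ h4 hl]
  have h5 : |χ q.1| * |beyond l y q| ≤ C * D * Real.sin q.1 ^ 2 := by
    refine (mul_le_mul h1 h2 (abs_nonneg _) ((abs_nonneg _).trans h1)).trans_eq ?_
    rw [Real.sin_sq]; ring
  have h6 : C * D * Real.sin q.1 ^ 2 ≤ C * D * (10 * prof q.1) := by
    gcongr
    nlinarith [Real.sin_le_one q.1]
  calc |χ q.1| * |beyond l y q| * l ≤ C * D * (10 * prof q.1) * l :=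
        mul_le_mul_of_nonneg_right (h5.trans h6) hl.le
    _ = 10 * C * D * (l * prof q.1) := by ring

lemma funWeight_bounded (hl : 0 < l) (hy : Continuous y) (hχ : IsCutoff χ χ' C) :
    ∃ B, ∀ᵐ q ∂coordMeasure l, ‖funWeight l y χ χ' q‖ ≤ B := by
  obtain ⟨D, hD, hyD⟩ := exists_beyond_le hl hy
  obtain ⟨M, hM, hyM⟩ := exists_abs_le_of_continuous (hy.comp (continuous_param l))
  obtain ⟨a, b, ha, hb, hab⟩ := exists_dens_bounds hl
  have hC := hχ.nonneg
  refine ⟨C * 2 * M + C * (D * 2) / a, (ae_coordMeasure_mem l).mono fun q hq => ?_⟩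
  have h0 := Real.sin_pos_of_mem_Ioo hq.1
  have hcos1 := Real.cos_le_one q.1
  have hcos2 := Real.neg_one_le_cos q.1
  have h1 : |χ q.1| ≤ C * 2 := (hχ.bound q.1 (Ioo_subset_Icc_self hq.1)).trans (by gcongr; linarith)
  have h2 : |beyond l y q| ≤ D * 2 := (hyD q (coordRect_subset hq)).trans (by gcongr; linarith)
  have h3 := hyM q (coordRect_subset hq)
  have h4 := hχ.bound' q.1 hq.1
  have h5 := (hab q (Ioo_subset_Icc_self hq.1)).1
  have h6 : 0 < dens l q := dens_pos hl hq.1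
  refine (norm_sub_le _ _).trans (add_le_add ?_ ?_)
  · rw [norm_mul]
    exact mul_le_mul h1 h3 (abs_nonneg _) (by positivity)
  · rw [Real.norm_eq_abs, abs_div, abs_of_pos h6, abs_mul, div_le_div_iff₀ h6 ha]
    calc |χ' q.1| * |beyond l y q| * a ≤ C * Real.sin q.1 * (D * 2) * a := by gcongr
      _ = C * (D * 2) * (a * Real.sin q.1) := by ring
      _ ≤ C * (D * 2) * dens l q := by gcongr

lemma integrableOn_mul {h : ℝ → ℝ} {F : ℝ × ℝ → ℝ} {B : ℝ} (hh : Measurable h)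
    (hB : ∀ t ∈ Ioo 0 Real.pi, |h t| ≤ B) (hF : Continuous F) :
    IntegrableOn (fun q => h q.1 * F q) (Ioo 0 Real.pi ×ˢ Ioo 0 (2 * Real.pi)) := by
  refine hF.integrableOn_coordRect.bdd_mul (c := B)
    (hh.comp measurable_fst).aestronglyMeasurable ?_
  filter_upwards [ae_restrict_mem measurableSet_coordRect] with q hq
  exact hB _ hq.1

lemma continuous_meridDeriv {f : E3 → ℝ} (hf : ContDiff ℝ 1 f) :
    Continuous fun q : ℝ × ℝ => inner ℝ (frame q) (gradient f (param l q)) := by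
  have h : Continuous (gradient f) :=
    (InnerProductSpace.toDual ℝ E3).symm.continuous.comp (hf.continuous_fderiv (by simp))
  exact continuous_frame.inner (h.comp (continuous_param l))

/-- Integration by parts along the meridians, for a smooth function. -/
lemma integral_parts_of_contDiff (hl : 0 < l) (hy : Continuous y) (hχ : IsCutoff χ χ' C)
    {f : E3 → ℝ} (hf : ContDiff ℝ 1 f) :
    ∫ q, gradWeight l y χ q * inner ℝ (frame q) (gradient f (param l q)) ∂coordMeasure l =
      ∫ q, funWeight l y χ χ' q * f (param l q) ∂coordMeasure l := by
  have hC := hχ.nonneg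
  have hfp : Continuous fun q => f (param l q) := hf.continuous.comp (continuous_param l)
  have hY := continuous_beyond (l := l) hy
  have hD : Continuous fun q : ℝ × ℝ =>
      l * speed q.1 * inner ℝ (frame q) (gradient f (param l q)) :=
    ((continuous_const.mul (continuous_speed.comp continuous_fst))).mul (continuous_meridDeriv hf)
  have hb : ∀ t ∈ Ioo 0 Real.pi, |χ t| ≤ C * 2 := fun t ht =>
    (hχ.bound t (Ioo_subset_Icc_self ht)).trans (by gcongr; linarith [Real.neg_one_le_cos t])
  have hb' : ∀ t ∈ Ioo 0 Real.pi, |χ' t| ≤ C := fun t ht =>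
    (hχ.bound' t ht).trans (mul_le_of_le_one_right hC (Real.sin_le_one t))
  have i1 : IntegrableOn (fun q : ℝ × ℝ => χ q.1 * (beyond l y q * (l * speed q.1 * inner ℝ (frame q) (gradient f (param l q)))))
      (Ioo 0 Real.pi ×ˢ Ioo 0 (2 * Real.pi)) :=
    integrableOn_mul hχ.measurable hb (hY.mul hD)
  have i2 : IntegrableOn (fun q : ℝ × ℝ => χ' q.1 * (beyond l y q * f (param l q)))
      (Ioo 0 Real.pi ×ˢ Ioo 0 (2 * Real.pi)) :=
    integrableOn_mul hχ.measurable' hb' (hY.mul hfp)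
  have i3 : IntegrableOn (fun q : ℝ × ℝ => χ q.1 * (y (param l q) * dens l q * f (param l q)))
      (Ioo 0 Real.pi ×ˢ Ioo 0 (2 * Real.pi)) :=
    integrableOn_mul hχ.measurable hb ((continuous_integrand l hy).mul hfp)
  have hzero : ∫ q in Ioo 0 Real.pi ×ˢ Ioo 0 (2 * Real.pi),
      (χ q.1 * (beyond l y q * (l * speed q.1 * inner ℝ (frame q) (gradient f (param l q)))) +
      (χ' q.1 * (beyond l y q * f (param l q)) -
        χ q.1 * (y (param l q) * dens l q * f (param l q)))) = 0 := by
    have i4 : IntegrableOn (fun q : ℝ × ℝ => χ q.1 * (beyond l y q * (l * speed q.1 * inner ℝ (frame q) (gradient f (param l q)))) +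
        (χ' q.1 * (beyond l y q * f (param l q)) -
        χ q.1 * (y (param l q) * dens l q * f (param l q))))
        (Ioo 0 Real.pi ×ˢ Ioo 0 (2 * Real.pi)) := i1.add (i2.sub i3)
    rw [IntegrableOn, Measure.volume_eq_prod, ← Measure.prod_restrict] at i4
    rw [Measure.volume_eq_prod, ← Measure.prod_restrict]
    rw [integral_prod_symm _ i4]
    refine (integral_congr_ae ?_).trans (integral_zero _ _)
    filter_upwards [i4.prod_left_ae] with θ hθ
    obtain ⟨s, hs, hderiv⟩ := hχ.hasDerivAt
    have hθ' : IntervalIntegrable _ volume 0 Real.pi :=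
      (intervalIntegrable_iff_integrableOn_Ioo_of_le Real.pi_pos.le).2 hθ
    have hline : Continuous fun t : ℝ => (t, θ) := continuous_id.prodMk continuous_const
    have hFTC := integral_eq_of_hasDerivAt_off_countable_of_le
      (fun t => χ t * (beyond l y (t, θ) * f (param l (t, θ)))) _ Real.pi_pos.le hs
      (hχ.continuousOn.mul ((hY.comp hline).mul (hfp.comp hline)).continuousOn)
      (fun t ht => ?_) hθ'
    · rw [← integral_Ioc_eq_integral_Ioo, ← intervalIntegral.integral_of_le Real.pi_pos.le]
      refine hFTC.trans ?_
      have h0 : χ 0 = 0 := by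
        have := hχ.bound 0 (left_mem_Icc.2 Real.pi_pos.le)
        simpa using this
      simp [h0]
    · have h1 := (hderiv t ht).mul ((hasDerivAt_beyond (l := l) hy t θ).mul
        (hasDerivAt_comp_param (l := l) (hf.differentiable (by simp)) t θ))
      refine h1.congr_deriv ?_
      simp only [Pi.mul_apply]
      ring
  rw [integral_coordMeasure hl, integral_coordMeasure hl]
  refine sub_eq_zero.1 (Eq.trans ?_ ((integral_add i1 (i2.sub i3)).symm.trans hzero))
  rw [sub_eq_add_neg, ← integral_neg]
  congr 1
  · refine setIntegral_congr_fun measurableSet_coordRect fun q hq => ?_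
    have h1 := prof_pos hq.1
    simp only [gradWeight, dens, abs_of_pos h1]
    field_simp
  · refine setIntegral_congr_fun measurableSet_coordRect fun q hq => ?_
    have h1 := dens_pos hl hq.1
    simp only [funWeight, Pi.sub_apply]
    field_simp
    ring

/-- In finite measure, convergence in `L²` implies convergence of the integrals against a bounded
function. -/
lemma tendsto_integral_mul_of_eLpNorm {α : Type*} [MeasurableSpace α] {μ : Measure α}
    [IsFiniteMeasure μ] {F : ℕ → α → ℝ} {G k : α → ℝ} {B : ℝ} (hk : AEStronglyMeasurable k μ)
    (hkB : ∀ᵐ x ∂μ, ‖k x‖ ≤ B) (hF : ∀ n, Integrable (F n) μ) (hG : Integrable G μ)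
    (h : Tendsto (fun n => eLpNorm (fun x => F n x - G x) 2 μ) atTop (𝓝 0)) :
    Tendsto (fun n => ∫ x, k x * F n x ∂μ) atTop (𝓝 (∫ x, k x * G x ∂μ)) := by
  refine tendsto_integral_of_L1' _ (hG.bdd_mul hk hkB).aestronglyMeasurable
    (Eventually.of_forall fun n => (hF n).bdd_mul hk hkB) ?_
  have hub : ∀ n, eLpNorm ((fun x => k x * F n x) - fun x => k x * G x) 1 μ ≤
      ENNReal.ofReal B * (eLpNorm (fun x => F n x - G x) 2 μ *
        μ univ ^ (1 / (1 : ENNReal).toReal - 1 / (2 : ENNReal).toReal)) := by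
    intro n
    have h1 : eLpNorm ((fun x => k x * F n x) - fun x => k x * G x) 1 μ ≤
        ENNReal.ofReal B * eLpNorm (fun x => F n x - G x) 1 μ := by
      refine eLpNorm_le_mul_eLpNorm_of_ae_le_mul ?_ 1
      filter_upwards [hkB] with x hx
      simp only [Pi.sub_apply, ← mul_sub, norm_mul]
      gcongr
    refine h1.trans (mul_le_mul_right ?_ _)
    exact eLpNorm_le_eLpNorm_mul_rpow_measure_univ (by norm_num)
      ((hF n).sub hG).aestronglyMeasurable
  refine tendsto_of_tendsto_of_tendsto_of_le_of_le tendsto_const_nhds ?_ (fun _ => zero_le) hub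
  have h2 : μ univ ^ (1 / (1 : ENNReal).toReal - 1 / (2 : ENNReal).toReal) ≠ ⊤ := by
    refine ENNReal.rpow_ne_top_of_nonneg ?_ (measure_ne_top _ _)
    norm_num
  have h3 := ENNReal.Tendsto.const_mul (a := ENNReal.ofReal B)
    (ENNReal.Tendsto.mul_const (b := μ univ ^ (1 / (1 : ENNReal).toReal -
      1 / (2 : ENNReal).toReal)) h (Or.inr h2)) (Or.inr ENNReal.ofReal_ne_top)
  simpa using h3

variable (hl : 0 < l) {v : E3 → ℝ} {H : E3 → E3}

lemma memLp_comp_param {E : Type*} [NormedAddCommGroup E] {g : E3 → E}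
    (hg : MemLp g 2 (surf hl).area) : MemLp (fun q => g (param l q)) 2 (coordMeasure l) := by
  rw [area_eq] at hg
  exact (memLp_map_measure_iff hg.aestronglyMeasurable (measurable_param l).aemeasurable).1 hg

/-- Integration by parts along the meridians, for a Sobolev function. -/
theorem integral_parts (hv : (surf hl).HasSobolevGradient v H) (hy : Continuous y)
    (hχ : IsCutoff χ χ' C) :
    ∫ q, gradWeight l y χ q * inner ℝ (frame q) (H (param l q)) ∂coordMeasure l =
      ∫ q, funWeight l y χ χ' q * v (param l q) ∂coordMeasure l := by
  obtain ⟨hv2, hH2, f, hf, hfv, hfH⟩ := hv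
  have hvi : Integrable (fun q => v (param l q)) (coordMeasure l) :=
    (memLp_comp_param hl hv2).integrable (by norm_num)
  have hHi : Integrable (fun q => H (param l q)) (coordMeasure l) :=
    (memLp_comp_param hl hH2).integrable (by norm_num)
  have hHfi : Integrable (fun q => inner ℝ (frame q) (H (param l q))) (coordMeasure l) := by
    refine hHi.norm.mono' (continuous_frame.aestronglyMeasurable.inner hHi.aestronglyMeasurable)
      (ae_of_all _ fun q => ?_)
    simpa [norm_frame] using norm_inner_le_norm (𝕜 := ℝ) (frame q) (H (param l q))
  have hv_tendsto : Tendsto (fun n => eLpNorm (fun q => f n (param l q) - v (param l q)) 2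
      (coordMeasure l)) atTop (𝓝 0) := by
    refine hfv.congr fun n => ?_
    have hm : AEStronglyMeasurable (fun p => f n p - v p) (surf hl).area :=
      (hf n).continuous.aestronglyMeasurable.sub hv2.aestronglyMeasurable
    rw [area_eq] at hm ⊢
    exact eLpNorm_map_measure hm (measurable_param l).aemeasurable
  have hH_tendsto : Tendsto (fun n => eLpNorm (fun q => inner ℝ (frame q)
      (gradient (f n) (param l q)) - inner ℝ (frame q) (H (param l q))) 2
      (coordMeasure l)) atTop (𝓝 0) := by
    refine tendsto_of_tendsto_of_tendsto_of_le_of_le tendsto_const_nhds hfH (fun _ => zero_le)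
      fun n => ?_
    have hgrad : Continuous (gradient (f n)) :=
      (InnerProductSpace.toDual ℝ E3).symm.continuous.comp ((hf n).continuous_fderiv (by simp))
    have hm : AEStronglyMeasurable (fun p => inner ℝ (merid l p) (gradient (f n) p) -
        inner ℝ (merid l p) (H p)) (surf hl).area :=
      ((measurable_merid l).aestronglyMeasurable.inner hgrad.aestronglyMeasurable).sub
        ((measurable_merid l).aestronglyMeasurable.inner hH2.aestronglyMeasurable)
    calc eLpNorm (fun q => inner ℝ (frame q) (gradient (f n) (param l q)) -
          inner ℝ (frame q) (H (param l q))) 2 (coordMeasure l)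
        = eLpNorm ((fun p => inner ℝ (merid l p) (gradient (f n) p) -
          inner ℝ (merid l p) (H p)) ∘ param l) 2 (coordMeasure l) := by
          refine eLpNorm_congr_ae ?_
          filter_upwards [ae_coordMeasure_fst l] with q hq
          simp only [Function.comp, merid_param hl hq]
      _ = eLpNorm (fun p => inner ℝ (merid l p) (gradient (f n) p) -
          inner ℝ (merid l p) (H p)) 2 (surf hl).area := by
          rw [area_eq] at hm ⊢
          exact (eLpNorm_map_measure hm (measurable_param l).aemeasurable).symm
      _ ≤ eLpNorm (fun p => (surf hl).surfaceGradient (f n) p - H p) 2 (surf hl).area := by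
          refine eLpNorm_mono_ae (ae_area_of_forall hl fun t ht θ _ => ?_)
          rw [merid_param hl ht, ← inner_frame_surfaceGradient hl, ← inner_sub_right]
          refine (norm_inner_le_norm _ _).trans_eq ?_
          rw [norm_frame, one_mul]
  obtain ⟨B, hB⟩ := gradWeight_bounded hl hy hχ
  obtain ⟨B', hB'⟩ := funWeight_bounded hl hy hχ
  have h1 := tendsto_integral_mul_of_eLpNorm
    (measurable_gradWeight (l := l) hy hχ.measurable).aestronglyMeasurable hB
    (fun n => (continuous_meridDeriv (hf n)).integrable_coordMeasure l) hHfi hH_tendsto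
  have h2 := tendsto_integral_mul_of_eLpNorm
    (measurable_funWeight (l := l) hy hχ.measurable hχ.measurable').aestronglyMeasurable hB'
    (fun n => ((hf n).continuous.comp (continuous_param l)).integrable_coordMeasure l) hvi
    hv_tendsto
  refine tendsto_nhds_unique h1 (h2.congr fun n => ?_)
  exact (integral_parts_of_contDiff hl hy hχ (hf n)).symm

end parts

end Dumbbell

/-! ### Radial functions -/

namespace Dumbbell

/-- `g` is the slope of a radial function: it is continuous and bounded away from the poles. -/
structure IsSlope (g : ℝ → ℝ) (B : ℝ) : Prop where
  measurable : Measurable g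
  continuousOn : ContinuousOn g (Ioo 0 Real.pi)
  bound : ∀ t ∈ Ioo 0 Real.pi, |g t| ≤ B

/-- The radial function with slope `g` that vanishes at the pole `b`, as a function of the
parameter `t`. -/
noncomputable def radialProfile (l : ℝ) (g : ℝ → ℝ) (t : ℝ) : ℝ :=
  ∫ s in (0 : ℝ)..t, l * speed s * g s

/-- The radial function with slope `g` that vanishes at the pole `b`. -/
noncomputable def radialFun (l : ℝ) (g : ℝ → ℝ) (p : E3) : ℝ := radialProfile l g (param₁ l p)

/-- The gradient of the radial function with slope `g`. -/
noncomputable def radialGrad (l : ℝ) (g : ℝ → ℝ) (p : E3) : E3 := g (param₁ l p) • merid l p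

lemma isSlope_one : IsSlope (fun _ => 1) 1 :=
  ⟨measurable_const, continuousOn_const, fun _ _ => by simp⟩

/-- In finite measure, dominated convergence to zero in `L²`. -/
lemma tendsto_eLpNorm_two_of_bound {α E : Type*} [MeasurableSpace α] [NormedAddCommGroup E]
    {μ : Measure α} [IsFiniteMeasure μ] {F : ℕ → α → E} {B : ℝ}
    (hF : ∀ n, AEStronglyMeasurable (F n) μ) (hB : ∀ n, ∀ᵐ x ∂μ, ‖F n x‖ ≤ B)
    (h : ∀ᵐ x ∂μ, Tendsto (fun n => F n x) atTop (𝓝 0)) :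
    Tendsto (fun n => eLpNorm (F n) 2 μ) atTop (𝓝 0) := by
  have h1 : Tendsto (fun n => ∫⁻ x, ‖F n x‖ₑ ^ (2 : ℝ) ∂μ) atTop (𝓝 (∫⁻ _, 0 ∂μ)) := by
    refine tendsto_lintegral_of_dominated_convergence' (fun _ => ENNReal.ofReal B ^ (2 : ℝ))
      (fun n => (hF n).enorm.pow_const _) (fun n => ?_) ?_ ?_
    · filter_upwards [hB n] with x hx
      gcongr
      rw [← ofReal_norm]
      exact ENNReal.ofReal_le_ofReal hx
    · rw [lintegral_const]
      exact ENNReal.mul_ne_top (ENNReal.rpow_ne_top_of_nonneg (by norm_num) ENNReal.ofReal_ne_top)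
        (measure_ne_top _ _)
    · filter_upwards [h] with x hx
      have h2 := (hx.enorm).ennrpow_const (2 : ℝ)
      simpa using h2
  rw [lintegral_zero] at h1
  have h2 := h1.ennrpow_const (1 / 2 : ℝ)
  simp only [one_div, ENNReal.zero_rpow_of_pos (show (0 : ℝ) < 2⁻¹ by norm_num)] at h2
  refine h2.congr fun n => ?_
  rw [eLpNorm_eq_lintegral_rpow_enorm_toReal (by norm_num) (by norm_num)]
  simp

section slope

variable {l : ℝ} {g : ℝ → ℝ} {B : ℝ}

lemma IsSlope.nonneg (hg : IsSlope g B) : 0 ≤ B :=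
  (abs_nonneg _).trans (hg.bound (Real.pi / 2) ⟨by positivity, by linarith [Real.pi_pos]⟩)

lemma exists_speed_le (l : ℝ) : ∃ M : ℝ, 0 < M ∧ ∀ t ∈ Icc 0 Real.pi, |l * speed t| ≤ M := by
  obtain ⟨a, b, -, hb, hab⟩ := exists_speed_bounds
  refine ⟨|l| * b + 1, by positivity, fun t ht => ?_⟩
  rw [abs_mul, abs_of_pos (speed_pos t)]
  have := mul_le_mul_of_nonneg_left (hab t ht).2 (abs_nonneg l)
  linarith

lemma IsSlope.intervalIntegrable_zero_pi (hg : IsSlope g B) (l : ℝ) :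
    IntervalIntegrable (fun s => l * speed s * g s) volume 0 Real.pi := by
  rw [intervalIntegrable_iff_integrableOn_Ioo_of_le Real.pi_pos.le]
  have h1 : IntegrableOn (fun s => l * speed s) (Ioo 0 Real.pi) :=
    ((continuous_const.mul continuous_speed).integrableOn_Icc).mono_set Ioo_subset_Icc_self
  refine h1.mul_bdd (c := B) hg.measurable.aestronglyMeasurable ?_
  filter_upwards [ae_restrict_mem measurableSet_Ioo] with t ht
  exact hg.bound t ht

lemma IsSlope.intervalIntegrable (hg : IsSlope g B) (l : ℝ) {x t : ℝ} (hx : x ∈ Icc 0 Real.pi)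
    (ht : t ∈ Icc 0 Real.pi) :
    IntervalIntegrable (fun s => l * speed s * g s) volume x t := by
  refine (hg.intervalIntegrable_zero_pi l).mono_set ?_
  rw [uIcc_of_le Real.pi_pos.le]
  exact ordConnected_Icc.uIcc_subset hx ht

lemma IsSlope.continuousOn_radialProfile (hg : IsSlope g B) (l : ℝ) :
    ContinuousOn (radialProfile l g) (Icc 0 Real.pi) := by
  have := intervalIntegral.continuousOn_primitive_interval' (hg.intervalIntegrable_zero_pi l)
    left_mem_uIcc
  rwa [uIcc_of_le Real.pi_pos.le] at this

lemma IsSlope.hasDerivAt_radialProfile (hg : IsSlope g B) (l : ℝ) {t : ℝ}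
    (ht : t ∈ Ioo 0 Real.pi) : HasDerivAt (radialProfile l g) (l * speed t * g t) t :=
  intervalIntegral.integral_hasDerivAt_right
    (hg.intervalIntegrable l (left_mem_Icc.2 Real.pi_pos.le) (Ioo_subset_Icc_self ht))
    (((continuous_speed.measurable.const_mul l).mul hg.measurable).stronglyMeasurable
      |>.stronglyMeasurableAtFilter)
    (((continuous_const.mul continuous_speed).continuousAt).mul
      (hg.continuousOn.continuousAt (isOpen_Ioo.mem_nhds ht)))

lemma IsSlope.continuous_radialFun (hg : IsSlope g B) (l : ℝ) : Continuous (radialFun l g) :=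
  (hg.continuousOn_radialProfile l).comp_continuous (continuous_param₁ l) (param₁_mem l)

lemma radialFun_param (hl : 0 < l) {q : ℝ × ℝ} (hq : q.1 ∈ Icc 0 Real.pi) :
    radialFun l g (param l q) = radialProfile l g q.1 := by
  rw [radialFun, param₁_param hl hq]

lemma radialGrad_param (hl : 0 < l) {q : ℝ × ℝ} (hq : q.1 ∈ Ioo 0 Real.pi) :
    radialGrad l g (param l q) = g q.1 • frame q := by
  rw [radialGrad, param₁_param hl (Ioo_subset_Icc_self hq), merid_param hl hq]

/-- The factor by which the slope is multiplied to make a radial function continuously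
differentiable at the poles. -/
noncomputable def ramp (n : ℕ) (t : ℝ) : ℝ := min 1 (n * Real.sin t ^ 2)

lemma continuous_ramp (n : ℕ) : Continuous (ramp n) := by unfold ramp; fun_prop

lemma ramp_nonneg (n : ℕ) (t : ℝ) : 0 ≤ ramp n t := le_min zero_le_one (by positivity)

lemma ramp_le_one (n : ℕ) (t : ℝ) : ramp n t ≤ 1 := min_le_left _ _

lemma tendsto_ramp {t : ℝ} (ht : t ∈ Ioo 0 Real.pi) :
    Tendsto (fun n => ramp n t) atTop (𝓝 1) := by
  have h0 : 0 < Real.sin t ^ 2 := pow_pos (Real.sin_pos_of_mem_Ioo ht) 2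
  refine tendsto_const_nhds.congr' ?_
  have := (tendsto_natCast_atTop_atTop (R := ℝ)).atTop_mul_const h0
  filter_upwards [this.eventually_ge_atTop 1] with n hn
  exact (min_eq_left hn).symm

/-- The derivative, with respect to the height divided by `l`, of the radial function with slope
`g * ramp n` on the unscaled dumbbell. -/
noncomputable def heightSlope (g : ℝ → ℝ) (n : ℕ) (t : ℝ) : ℝ :=
  speed t * g t * (ramp n t / Real.sin t)

lemma ramp_div_sin_le (n : ℕ) {t : ℝ} (ht : t ∈ Icc 0 Real.pi) :
    |ramp n t / Real.sin t| ≤ n * Real.sin t := by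
  have h0 := Real.sin_nonneg_of_mem_Icc ht
  rw [abs_of_nonneg (div_nonneg (ramp_nonneg n t) h0)]
  rcases h0.eq_or_lt with h | h
  · rw [← h]; simp
  · rw [div_le_iff₀ h]
    exact (min_le_right _ _).trans_eq (by ring)

lemma IsSlope.continuousOn_heightSlope (hg : IsSlope g B) (n : ℕ) :
    ContinuousOn (heightSlope g n) (Icc 0 Real.pi) := by
  intro t ht
  by_cases h : t ∈ Ioo 0 Real.pi
  · refine ContinuousAt.continuousWithinAt ?_
    refine (continuous_speed.continuousAt.mul (hg.continuousOn.continuousAt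
      (isOpen_Ioo.mem_nhds h))).mul (ContinuousAt.div (continuous_ramp n).continuousAt
      Real.continuous_sin.continuousAt (Real.sin_pos_of_mem_Ioo h).ne')
  · have hsin : Real.sin t = 0 := by
      rcases eq_endpoints_or_mem_Ioo_of_mem_Icc ht with h1 | h1 | h1
      · rw [h1, Real.sin_zero]
      · rw [h1, Real.sin_pi]
      · exact absurd h1 h
    obtain ⟨M, hM, hM'⟩ := exists_speed_le 1
    have h0 : heightSlope g n t = 0 := by simp [heightSlope, hsin]
    rw [ContinuousWithinAt, h0]
    refine squeeze_zero_norm' (a := fun s => M * B * (n * Real.sin s)) ?_ ?_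
    · filter_upwards [self_mem_nhdsWithin] with s hs
      by_cases hs' : s ∈ Ioo 0 Real.pi
      · rw [heightSlope, norm_mul, norm_mul]
        have h2 := hM' s hs
        rw [one_mul] at h2
        exact mul_le_mul (mul_le_mul h2 (hg.bound s hs') (abs_nonneg _) hM.le)
          (ramp_div_sin_le n hs) (abs_nonneg _) (mul_nonneg hM.le hg.nonneg)
      · have hsin' : Real.sin s = 0 := by
          rcases eq_endpoints_or_mem_Ioo_of_mem_Icc hs with h1 | h1 | h1
          · rw [h1, Real.sin_zero]
          · rw [h1, Real.sin_pi]
          · exact absurd h1 hs'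
        simp [heightSlope, hsin']
    · have : Continuous fun s => M * B * (n * Real.sin s) := by fun_prop
      have := this.tendsto t
      rw [hsin, mul_zero, mul_zero] at this
      exact this.mono_left nhdsWithin_le_nhds

/-- A continuously differentiable function of the height which approximates the radial function
with slope `g`. -/
noncomputable def approx (l : ℝ) (g : ℝ → ℝ) (n : ℕ) (z : ℝ) : ℝ :=
  ∫ x in (-l)..z, heightSlope g n (Real.arccos (-x / l))

lemma IsSlope.continuous_heightSlope (hg : IsSlope g B) (l : ℝ) (n : ℕ) :
    Continuous fun x => heightSlope g n (Real.arccos (-x / l)) :=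
  (hg.continuousOn_heightSlope n).comp_continuous
    (Real.continuous_arccos.comp (continuous_neg.div_const l))
    fun _ => ⟨Real.arccos_nonneg _, Real.arccos_le_pi _⟩

lemma IsSlope.hasDerivAt_approx (hg : IsSlope g B) (l : ℝ) (n : ℕ) (z : ℝ) :
    HasDerivAt (approx l g n) (heightSlope g n (Real.arccos (-z / l))) z :=
  (hg.continuous_heightSlope l n).integral_hasStrictDerivAt _ _ |>.hasDerivAt

lemma IsSlope.contDiff_approx (hg : IsSlope g B) (l : ℝ) (n : ℕ) :
    ContDiff ℝ 1 (approx l g n) := by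
  rw [contDiff_one_iff_deriv]
  refine ⟨fun z => (hg.hasDerivAt_approx l n z).differentiableAt, ?_⟩
  have : deriv (approx l g n) = fun z => heightSlope g n (Real.arccos (-z / l)) :=
    funext fun z => (hg.hasDerivAt_approx l n z).deriv
  rw [this]
  exact hg.continuous_heightSlope l n

lemma IsSlope.approx_height (hg : IsSlope g B) (hl : 0 < l) (n : ℕ) {t : ℝ}
    (ht : t ∈ Icc 0 Real.pi) :
    approx l g n (-(l * Real.cos t)) = ∫ s in (0 : ℝ)..t, l * speed s * g s * ramp n s := by
  have h := intervalIntegral.integral_comp_mul_deriv (a := 0) (b := t)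
    (f := fun t => -(l * Real.cos t)) (f' := fun t => l * Real.sin t)
    (fun x _ => hasDerivAt_height l x) (by fun_prop) (hg.continuous_heightSlope l n)
  simp only [Real.cos_zero, mul_one] at h
  rw [approx, ← h]
  refine intervalIntegral.integral_congr fun s hs => ?_
  rw [uIcc_of_le ht.1] at hs
  have hs' : s ∈ Icc 0 Real.pi := ⟨hs.1, hs.2.trans ht.2⟩
  simp only [Function.comp, neg_neg, mul_div_cancel_left₀ _ hl.ne', Real.arccos_cos hs'.1 hs'.2,
    heightSlope]
  rcases eq_or_ne (Real.sin s) 0 with h0 | h0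
  · simp [h0, ramp]
  · field_simp

lemma IsSlope.tendsto_approx (hg : IsSlope g B) (hl : 0 < l) {t : ℝ} (ht : t ∈ Icc 0 Real.pi) :
    Tendsto (fun n => approx l g n (-(l * Real.cos t))) atTop (𝓝 (radialProfile l g t)) := by
  simp only [hg.approx_height hl _ ht]
  refine intervalIntegral.tendsto_integral_filter_of_dominated_convergence
    (fun s => |l * speed s * g s|) (Eventually.of_forall fun n => ?_)
    (Eventually.of_forall fun n => ae_of_all _ fun s _ => ?_)
    (hg.intervalIntegrable l (left_mem_Icc.2 Real.pi_pos.le) ht).abs ?_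
  · exact (((continuous_speed.measurable.const_mul l).mul hg.measurable).mul
      (continuous_ramp n).measurable).aestronglyMeasurable
  · rw [norm_mul, Real.norm_eq_abs, Real.norm_of_nonneg (ramp_nonneg n s)]
    exact mul_le_of_le_one_right (abs_nonneg _) (ramp_le_one n s)
  · have hne : ∀ᵐ s : ℝ ∂volume, s ≠ Real.pi := by simp [ae_iff]
    filter_upwards [hne] with s hs1 hs
    rw [uIoc_of_le ht.1] at hs
    have := (tendsto_ramp ⟨hs.1, lt_of_le_of_ne (hs.2.trans ht.2) hs1⟩).const_mul
      (l * speed s * g s)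
    rwa [mul_one] at this

lemma abs_integral_le_of_bound {f : ℝ → ℝ} {M t : ℝ} (hM : 0 ≤ M)
    (hf : ∀ s ∈ Ioo 0 Real.pi, |f s| ≤ M) (ht : t ∈ Icc 0 Real.pi) :
    |∫ s in (0 : ℝ)..t, f s| ≤ M * Real.pi := by
  have hne : ∀ᵐ s : ℝ ∂volume, s ≠ Real.pi := by simp [ae_iff]
  have h := intervalIntegral.norm_integral_le_of_norm_le_const_ae (f := f) (C := M) (a := 0)
    (b := t) (hne.mono fun s hs1 hs => by
      rw [uIoc_of_le ht.1] at hs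
      exact hf s ⟨hs.1, lt_of_le_of_ne (hs.2.trans ht.2) hs1⟩)
  rw [sub_zero, abs_of_nonneg ht.1] at h
  exact h.trans (mul_le_mul_of_nonneg_left ht.2 hM)

lemma exists_slope_le (hg : IsSlope g B) (l : ℝ) :
    ∃ M : ℝ, 0 ≤ M ∧ ∀ s ∈ Ioo 0 Real.pi, |l * speed s * g s| ≤ M := by
  obtain ⟨M, hM, h⟩ := exists_speed_le l
  refine ⟨M * B, mul_nonneg hM.le hg.nonneg, fun s hs => ?_⟩
  rw [abs_mul]
  exact mul_le_mul (h s (Ioo_subset_Icc_self hs)) (hg.bound s hs) (abs_nonneg _) hM.le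

/-- A radial function with bounded slope belongs to `H¹`, even though it is in general not
differentiable at the poles. -/
theorem IsSlope.hasSobolevGradient (hg : IsSlope g B) (hl : 0 < l) :
    (surf hl).HasSobolevGradient (radialFun l g) (radialGrad l g) := by
  obtain ⟨M, hM, hMg⟩ := exists_slope_le hg l
  have hub : ∀ t ∈ Icc 0 Real.pi, |radialProfile l g t| ≤ M * Real.pi := fun t ht =>
    abs_integral_le_of_bound hM hMg ht
  have hun : ∀ n, ∀ t ∈ Icc 0 Real.pi, |approx l g n (-(l * Real.cos t))| ≤ M * Real.pi :=
    fun n t ht => by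
      rw [hg.approx_height hl n ht]
      refine abs_integral_le_of_bound hM (fun s hs => ?_) ht
      rw [abs_mul, abs_of_nonneg (ramp_nonneg n s)]
      exact (mul_le_of_le_one_right (abs_nonneg _) (ramp_le_one n s)).trans (hMg s hs)
  have hcont := hg.continuous_radialFun l
  have hmeasG : Measurable (radialGrad l g) :=
    (hg.measurable.comp (continuous_param₁ l).measurable).smul (measurable_merid l)
  have hcontn : ∀ n, ContDiff ℝ 1 fun p : E3 => approx l g n (p 2) := fun n =>
    (hg.contDiff_approx l n).comp (contDiff_coord 2)
  refine ⟨MemLp.of_bound hcont.aestronglyMeasurable (M * Real.pi)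
      (ae_of_all _ fun p => hub _ (param₁_mem l p)),
    MemLp.of_bound hmeasG.aestronglyMeasurable B (ae_area_of_forall hl fun t ht θ _ => ?_),
    fun n p => approx l g n (p 2), hcontn, ?_, ?_⟩
  · rw [radialGrad_param hl ht, norm_smul, norm_frame, mul_one]
    exact hg.bound t ht
  · refine tendsto_eLpNorm_two_of_bound (B := M * Real.pi + M * Real.pi) (fun n =>
      ((hcontn n).continuous.sub hcont).aestronglyMeasurable)
      (fun n => ae_area_of_forall hl fun t ht θ _ => ?_) (ae_area_of_forall hl fun t ht θ _ => ?_)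
    · simp only [radialFun_param hl (q := (t, θ)) (Ioo_subset_Icc_self ht), param_two]
      exact (norm_sub_le _ _).trans (add_le_add (hun n t (Ioo_subset_Icc_self ht))
        (hub t (Ioo_subset_Icc_self ht)))
    · simp only [radialFun_param hl (q := (t, θ)) (Ioo_subset_Icc_self ht), param_two]
      have := (hg.tendsto_approx hl (Ioo_subset_Icc_self ht)).sub_const (radialProfile l g t)
      rwa [sub_self] at this
  · -- the gradient of the `n`-th approximation is the true gradient multiplied by `ramp n`
    have hsg : ∀ n, ∀ t ∈ Ioo 0 Real.pi, ∀ θ, (surf hl).surfaceGradient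
        (fun p => approx l g n (p 2)) (param l (t, θ)) =
        ramp n t • radialGrad l g (param l (t, θ)) := fun n t ht θ => by
      have h := hg.hasDerivAt_approx l n (-(l * Real.cos t))
      rw [neg_neg, mul_div_cancel_left₀ _ hl.ne', Real.arccos_cos ht.1.le ht.2.le] at h
      rw [surfaceGradient_height hl ht h, radialGrad_param hl ht, smul_smul]
      congr 1
      have h1 := (Real.sin_pos_of_mem_Ioo ht).ne'
      have h2 := (speed_pos t).ne'
      rw [heightSlope]
      field_simp
    have hae : ∀ n, (fun p => (surf hl).surfaceGradient (fun p => approx l g n (p 2)) p -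
        radialGrad l g p) =ᵐ[(surf hl).area]
        fun p => (ramp n (param₁ l p) - 1) • radialGrad l g p := fun n =>
      ae_area_of_forall hl fun t ht θ _ => by
        simp only [hsg n t ht, param₁_param hl (q := (t, θ)) (Ioo_subset_Icc_self ht), sub_smul,
          one_smul]
    refine (tendsto_eLpNorm_two_of_bound (B := B) (fun n => ?_)
      (fun n => ae_area_of_forall hl fun t ht θ _ => ?_)
      (ae_area_of_forall hl fun t ht θ _ => ?_)).congr fun n => (eLpNorm_congr_ae (hae n)).symm
    · exact (((continuous_ramp n).measurable.comp (continuous_param₁ l).measurable).sub_const 1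
        |>.smul hmeasG).aestronglyMeasurable
    · rw [norm_smul, radialGrad_param hl ht, norm_smul, norm_frame, mul_one,
        param₁_param hl (Ioo_subset_Icc_self ht)]
      refine (mul_le_of_le_one_left (abs_nonneg _) ?_).trans (hg.bound t ht)
      rw [Real.norm_eq_abs, abs_le]
      constructor <;> linarith [ramp_nonneg n t, ramp_le_one n t]
    · rw [param₁_param hl (Ioo_subset_Icc_self ht)]
      have := ((tendsto_ramp ht).sub_const 1).smul_const (radialGrad l g (param l (t, θ)))
      simpa using this

end slope

/-! ### The distance to the pole -/

section dist

variable {l : ℝ} (hl : 0 < l)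

lemma radialProfile_le_length {t θ : ℝ} (ht : t ∈ Ioo 0 Real.pi) {c : ℝ → E3}
    (hc : ContDiff ℝ 1 c) (hmem : ∀ s ∈ Icc (0 : ℝ) 1, c s ∈ (surf hl).carrier)
    (h0 : c 0 = (surf hl).base) (h1 : c 1 = param l (t, θ)) :
    radialProfile l (fun _ => 1) t ≤ ∫ s in (0 : ℝ)..1, ‖deriv c s‖ := by
  refine le_of_tendsto (isSlope_one.tendsto_approx hl (Ioo_subset_Icc_self ht))
    (Eventually.of_forall fun n => ?_)
  have hcd : ∀ s, HasDerivAt c (deriv c s) s := fun s =>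
    (hc.differentiable (by simp) s).hasDerivAt
  have hcc : Continuous (deriv c) := hc.continuous_deriv le_rfl
  have hcont : Continuous fun s => heightSlope (fun _ => 1) n (Real.arccos (-(c s 2) / l)) *
      deriv c s 2 :=
    ((isSlope_one.continuous_heightSlope l n).comp ((continuous_coord 2).comp hc.continuous)).mul
      ((continuous_coord 2).comp hcc)
  have hFTC := intervalIntegral.integral_eq_sub_of_hasDerivAt (a := 0) (b := 1)
    (f := fun s => approx l (fun _ => 1) n (c s 2))
    (f' := fun s => heightSlope (fun _ => 1) n (Real.arccos (-(c s 2) / l)) * deriv c s 2)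
    (fun s _ => HasDerivAt.comp (h₂ := approx l (fun _ => 1) n) (h := fun s => c s 2) s
      (isSlope_one.hasDerivAt_approx l n (c s 2)) (hasDerivAt_coord (hcd s) 2))
    (hcont.intervalIntegrable _ _)
  have hb : approx l (fun _ => 1) n (c 0 2) = 0 := by
    rw [h0, ← base_eq hl 0, param_two]
    simp [approx]
  rw [h1, hb, sub_zero, param_two] at hFTC
  rw [← hFTC]
  refine intervalIntegral.integral_mono_on_of_le_Ioo zero_le_one (hcont.intervalIntegrable _ _)
    (hcc.norm.intervalIntegrable _ _) fun s hs => ?_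
  have hs' := hmem s (Ioo_subset_Icc_self hs)
  rw [carrier_eq] at hs'
  obtain ⟨-, θ', -, hθ'⟩ := exists_param_eq hl hs'
  set τ := Real.arccos (-(c s 2) / l) with hτ
  have hτ0 : τ ∈ Icc 0 Real.pi := ⟨Real.arccos_nonneg _, Real.arccos_le_pi _⟩
  rcases (Real.sin_nonneg_of_mem_Icc hτ0).eq_or_lt with hsin | hsin
  · simp [heightSlope, ← hsin]
  have hτ1 : τ ∈ Ioo 0 Real.pi := by
    refine ⟨lt_of_le_of_ne hτ0.1 ?_, lt_of_le_of_ne hτ0.2 ?_⟩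
    · intro h; rw [← h, Real.sin_zero] at hsin; exact lt_irrefl _ hsin
    · intro h; rw [h, Real.sin_pi] at hsin; exact lt_irrefl _ hsin
  have htan : deriv c s ∈ (surf hl).tangentPlane (param l (τ, θ')) := by
    refine Submodule.subset_span ⟨fun x => c (s + x), by simp [hθ'], ?_, ?_⟩
    · have : ∀ᶠ x in 𝓝 (0 : ℝ), s + x ∈ Ioo (0 : ℝ) 1 := by
        refine (continuous_const.add continuous_id).continuousAt.eventually_mem
          (isOpen_Ioo.mem_nhds ?_)
        simpa using hs
      exact this.mono fun x hx => hmem _ (Ioo_subset_Icc_self hx)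
    · have := hcd s
      rw [← add_zero s] at this
      simpa using this.comp_const_add s 0
  rw [height_of_mem_tangentPlane hl hτ1 htan, heightSlope]
  have hsp := (speed_pos τ).ne'
  have : speed τ * 1 * (ramp n τ / Real.sin τ) *
      (Real.sin τ / speed τ * inner ℝ (frame (τ, θ')) (deriv c s)) =
      ramp n τ * inner ℝ (frame (τ, θ')) (deriv c s) := by
    field_simp
  rw [this]
  have hi : inner ℝ (frame (τ, θ')) (deriv c s) ≤ ‖deriv c s‖ := by
    refine (real_inner_le_norm _ _).trans_eq ?_
    rw [norm_frame, one_mul]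
  calc ramp n τ * inner ℝ (frame (τ, θ')) (deriv c s) ≤ ramp n τ * ‖deriv c s‖ :=
        mul_le_mul_of_nonneg_left hi (ramp_nonneg n τ)
    _ ≤ ‖deriv c s‖ := mul_le_of_le_one_left (norm_nonneg _) (ramp_le_one n τ)

/-- The distance to the pole `b` is the length of the arc of a meridian. -/
theorem distBase_param {t θ : ℝ} (ht : t ∈ Ioo 0 Real.pi) :
    (surf hl).distBase (param l (t, θ)) = radialProfile l (fun _ => 1) t := by
  have hmer : ∃ c : ℝ → E3, ContDiff ℝ 1 c ∧ (∀ s ∈ Icc (0 : ℝ) 1, c s ∈ (surf hl).carrier) ∧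
      c 0 = (surf hl).base ∧ c 1 = param l (t, θ) ∧
      radialProfile l (fun _ => 1) t = ∫ s in (0 : ℝ)..1, ‖deriv c s‖ := by
    refine ⟨fun s => param l (t * s, θ), ?_, fun s _ => param_mem_carrier hl _, ?_, by simp, ?_⟩
    · exact ((contDiff_param l).of_le (by simp)).comp
        ((contDiff_const.mul contDiff_id).prodMk contDiff_const)
    · simp [base_eq hl]
    · have hd : ∀ s, deriv (fun s => param l (t * s, θ)) s =
          t • ((l * speed (t * s)) • frame (t * s, θ)) := fun s => by
        have h1 : HasDerivAt (fun s => t * s) t s := by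
          simpa using (hasDerivAt_id s).const_mul t
        exact ((hasDerivAt_param l (t * s) θ).scomp s h1).deriv
      have hn : ∀ s, ‖deriv (fun s => param l (t * s, θ)) s‖ = t * (l * speed (t * s) * 1) :=
        fun s => by
          rw [hd, norm_smul, norm_smul, norm_frame, Real.norm_of_nonneg ht.1.le,
            Real.norm_of_nonneg (mul_pos hl (speed_pos _)).le]
      simp only [hn]
      rw [intervalIntegral.integral_const_mul, ← smul_eq_mul,
        intervalIntegral.smul_integral_comp_mul_left (fun x => l * speed x * 1)]
      simp [radialProfile]
  refine le_antisymm (csInf_le ⟨0, ?_⟩ hmer) (le_csInf ⟨_, hmer⟩ ?_)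
  · rintro _ ⟨c, -, -, -, -, rfl⟩
    exact intervalIntegral.integral_nonneg zero_le_one fun _ _ => norm_nonneg _
  · rintro _ ⟨c, hc, hmem, h0, h1, rfl⟩
    exact radialProfile_le_length hl ht hc hmem h0 h1

end dist

end Dumbbell

/-! ### Energies in coordinates -/

namespace Dumbbell

section energy

variable {l : ℝ} (hl : 0 < l) {m : ℝ} {g : ℝ → ℝ} {B : ℝ} {v : E3 → ℝ} {H : E3 → E3}

/-- The linear functional of `(v, H)` which appears when the energy is expanded around the radial
function with slope `g`. -/
noncomputable def linearized (l m : ℝ) (g : ℝ → ℝ) (v : E3 → ℝ) (H : E3 → E3) : ℝ :=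
  (∫ q, 2 * g q.1 * inner ℝ (frame q) (H (param l q)) ∂coordMeasure l) -
    m * ∫ q, v (param l q) ∂coordMeasure l

lemma integrable_fun (hv : (surf hl).HasSobolevGradient v H) :
    Integrable (fun q => v (param l q)) (coordMeasure l) :=
  (memLp_comp_param hl hv.1).integrable (by norm_num)

lemma integrable_grad (hv : (surf hl).HasSobolevGradient v H) :
    Integrable (fun q => H (param l q)) (coordMeasure l) :=
  (memLp_comp_param hl hv.2.1).integrable (by norm_num)

lemma abs_inner_frame_le (q : ℝ × ℝ) (w : E3) : |inner ℝ (frame q) w| ≤ ‖w‖ := by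
  simpa [norm_frame] using abs_real_inner_le_norm (frame q) w

lemma integrable_inner_frame (hv : (surf hl).HasSobolevGradient v H) :
    Integrable (fun q => inner ℝ (frame q) (H (param l q))) (coordMeasure l) :=
  (integrable_grad hl hv).norm.mono' (continuous_frame.aestronglyMeasurable.inner
    (integrable_grad hl hv).aestronglyMeasurable) (ae_of_all _ fun q => abs_inner_frame_le q _)

lemma IsSlope.ae_bound (hg : IsSlope g B) : ∀ᵐ q ∂coordMeasure l, ‖g q.1‖ ≤ B :=
  (ae_coordMeasure_fst l).mono fun q hq => hg.bound q.1 hq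

lemma IsSlope.aestronglyMeasurable (hg : IsSlope g B) :
    AEStronglyMeasurable (fun q : ℝ × ℝ => g q.1) (coordMeasure l) :=
  (hg.measurable.comp measurable_fst).aestronglyMeasurable

lemma IsSlope.memLp_frame (hg : IsSlope g B) :
    MemLp (fun q => g q.1 • frame q) 2 (coordMeasure l) := by
  refine MemLp.of_bound (hg.aestronglyMeasurable.smul continuous_frame.aestronglyMeasurable) B ?_
  filter_upwards [hg.ae_bound (l := l)] with q hq
  rwa [norm_smul, norm_frame, mul_one]

lemma energy_eq_coord (hv : (surf hl).HasSobolevGradient v H) :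
    (surf hl).energy m v H =
      ∫ q, (‖H (param l q)‖ ^ 2 - m * v (param l q)) ∂coordMeasure l := by
  have h : AEStronglyMeasurable (fun p => ‖H p‖ ^ 2 - m * v p) (surf hl).area :=
    (hv.2.1.aestronglyMeasurable.norm.pow 2).sub (hv.1.aestronglyMeasurable.const_mul m)
  rw [SurfaceOfRevolution.energy]
  rw [area_eq] at h ⊢
  exact integral_map (measurable_param l).aemeasurable h

lemma integrable_sq_sub (hg : IsSlope g B) (hv : (surf hl).HasSobolevGradient v H) :
    Integrable (fun q => ‖H (param l q) - g q.1 • frame q‖ ^ 2) (coordMeasure l) :=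
  ((memLp_comp_param hl hv.2.1).sub hg.memLp_frame).integrable_norm_pow (by norm_num)

lemma integrable_mul_inner_frame (hg : IsSlope g B) (hv : (surf hl).HasSobolevGradient v H) :
    Integrable (fun q => 2 * g q.1 * inner ℝ (frame q) (H (param l q))) (coordMeasure l) := by
  refine (integrable_inner_frame hl hv).bdd_mul (c := 2 * B) (hg.aestronglyMeasurable.const_mul 2)
    ?_
  filter_upwards [hg.ae_bound (l := l)] with q hq
  rw [norm_mul, Real.norm_ofNat]
  gcongr

/-- The energy expanded around the radial function with slope `g`. -/
lemma energy_expansion (hg : IsSlope g B) (hv : (surf hl).HasSobolevGradient v H) :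
    (surf hl).energy m v H = (∫ q, ‖H (param l q) - g q.1 • frame q‖ ^ 2 ∂coordMeasure l) +
      linearized l m g v H - ∫ q : ℝ × ℝ, g q.1 ^ 2 ∂coordMeasure l := by
  have i1 := integrable_sq_sub hl hg hv
  have i2 := integrable_mul_inner_frame hl hg hv
  have i3 := (integrable_fun hl hv).const_mul m
  have i4 : Integrable (fun q : ℝ × ℝ => g q.1 ^ 2) (coordMeasure l) := by
    refine Integrable.of_bound (hg.aestronglyMeasurable.pow 2) (B ^ 2) ?_
    filter_upwards [hg.ae_bound (l := l)] with q hq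
    rw [norm_pow]
    gcongr
  have i5 : Integrable (fun q => 2 * g q.1 * inner ℝ (frame q) (H (param l q)) -
      m * v (param l q)) (coordMeasure l) := i2.sub i3
  have i6 : Integrable (fun q => ‖H (param l q) - g q.1 • frame q‖ ^ 2 +
      (2 * g q.1 * inner ℝ (frame q) (H (param l q)) - m * v (param l q))) (coordMeasure l) :=
    i1.add i5
  rw [energy_eq_coord hl hv, linearized, ← integral_const_mul, ← integral_sub i2 i3,
    ← integral_add i1 i5, ← integral_sub i6 i4]
  refine integral_congr_ae (ae_of_all _ fun q => ?_)
  beta_reduce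
  rw [norm_sub_sq_real, norm_smul, norm_frame, real_inner_smul_right, real_inner_comm,
    Real.norm_eq_abs, mul_one, sq_abs]
  ring

lemma ae_radialGrad_param (hl : 0 < l) (g : ℝ → ℝ) : ∀ᵐ q ∂coordMeasure l,
    radialGrad l g (param l q) = g q.1 • frame q :=
  (ae_coordMeasure_fst l).mono fun _ hq => radialGrad_param hl hq

lemma energy_radial (hg : IsSlope g B) : (surf hl).energy m (radialFun l g) (radialGrad l g) =
    linearized l m g (radialFun l g) (radialGrad l g) -
      ∫ q : ℝ × ℝ, g q.1 ^ 2 ∂coordMeasure l := by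
  rw [energy_expansion hl hg (hg.hasSobolevGradient hl)]
  have : ∫ q, ‖radialGrad l g (param l q) - g q.1 • frame q‖ ^ 2 ∂coordMeasure l = 0 := by
    refine integral_eq_zero_of_ae ?_
    filter_upwards [ae_radialGrad_param hl g] with q hq
    simp [hq]
  rw [this, zero_add]

lemma energy_radial_le (hg : IsSlope g B) (hv : (surf hl).HasSobolevGradient v H)
    (h : linearized l m g (radialFun l g) (radialGrad l g) ≤ linearized l m g v H) :
    (surf hl).energy m (radialFun l g) (radialGrad l g) ≤ (surf hl).energy m v H := by
  rw [energy_radial hl hg, energy_expansion hl hg hv]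
  have : 0 ≤ ∫ q, ‖H (param l q) - g q.1 • frame q‖ ^ 2 ∂coordMeasure l :=
    integral_nonneg fun q => sq_nonneg _
  linarith

/-- Strict convexity: a competitor with the minimal energy has the same gradient. -/
lemma ae_eq_of_energy_le (hg : IsSlope g B) (hv : (surf hl).HasSobolevGradient v H)
    (h : linearized l m g (radialFun l g) (radialGrad l g) ≤ linearized l m g v H)
    (hE : (surf hl).energy m v H ≤ (surf hl).energy m (radialFun l g) (radialGrad l g)) :
    (∀ᵐ q ∂coordMeasure l, H (param l q) = g q.1 • frame q) ∧
      linearized l m g v H ≤ linearized l m g (radialFun l g) (radialGrad l g) := by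
  rw [energy_radial hl hg, energy_expansion hl hg hv] at hE
  have h0 : 0 ≤ ∫ q, ‖H (param l q) - g q.1 • frame q‖ ^ 2 ∂coordMeasure l :=
    integral_nonneg fun q => sq_nonneg _
  refine ⟨?_, by linarith⟩
  have h1 : ∫ q, ‖H (param l q) - g q.1 • frame q‖ ^ 2 ∂coordMeasure l = 0 := by linarith
  rw [integral_eq_zero_iff_of_nonneg (fun q => sq_nonneg _) (integrable_sq_sub hl hg hv)] at h1
  filter_upwards [h1] with q hq
  simpa [sub_eq_zero] using hq

/-- Functions on the dumbbell are determined by their integrals against continuous functions. -/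
lemma ae_eq_of_forall_integral_eq {u v : E3 → ℝ} (hu : MemLp u 2 (surf hl).area)
    (hv : MemLp v 2 (surf hl).area)
    (h : ∀ y : E3 → ℝ, Continuous y → ∫ q, y (param l q) * u (param l q) ∂coordMeasure l =
      ∫ q, y (param l q) * v (param l q) ∂coordMeasure l) : u =ᵐ[(surf hl).area] v := by
  have hui : Integrable u (surf hl).area := hu.integrable (by norm_num)
  have hvi : Integrable v (surf hl).area := hv.integrable (by norm_num)
  refine ae_eq_of_integral_contDiff_smul_eq hui.locallyIntegrable hvi.locallyIntegrable
    fun y hy hsupp => ?_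
  obtain ⟨C, hC⟩ := hsupp.exists_bound_of_continuous hy.continuous
  have j : ∀ w : E3 → ℝ, Integrable w (surf hl).area →
      Integrable (fun p => y p * w p) (surf hl).area := fun w hw =>
    hw.bdd_mul hy.continuous.aestronglyMeasurable (ae_of_all _ hC)
  have ju := (j u hui).aestronglyMeasurable
  have jv := (j v hvi).aestronglyMeasurable
  simp only [smul_eq_mul]
  rw [area_eq] at ju jv ⊢
  rw [integral_map (measurable_param l).aemeasurable ju,
    integral_map (measurable_param l).aemeasurable jv]
  exact h y hy.continuous

end energy

/-! ### Cutoffs near the pole -/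

/-- A cutoff which vanishes at the pole `b` and equals `1` away from it. -/
noncomputable def bump (n : ℕ) (t : ℝ) : ℝ := min 1 (n * (1 - Real.cos t))

/-- The derivative of `bump`. -/
noncomputable def dbump (n : ℕ) (t : ℝ) : ℝ :=
  if n * (1 - Real.cos t) < 1 then n * Real.sin t else 0

lemma continuous_bump (n : ℕ) : Continuous (bump n) := by unfold bump; fun_prop

lemma measurable_dbump (n : ℕ) : Measurable (dbump n) := by
  refine Measurable.ite ?_ (by fun_prop) measurable_const
  exact (isOpen_lt (by fun_prop) continuous_const).measurableSet

lemma bump_nonneg (n : ℕ) (t : ℝ) : 0 ≤ bump n t :=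
  le_min zero_le_one (mul_nonneg n.cast_nonneg (by linarith [Real.cos_le_one t]))

lemma bump_le_one (n : ℕ) (t : ℝ) : bump n t ≤ 1 := min_le_left _ _

lemma abs_bump_le_one (n : ℕ) (t : ℝ) : |bump n t| ≤ 1 := by
  rw [abs_of_nonneg (bump_nonneg n t)]; exact bump_le_one n t

lemma bump_eq_one {n : ℕ} {t : ℝ} (h : 1 ≤ n * (1 - Real.cos t)) : bump n t = 1 := min_eq_left h

lemma dbump_eq_zero {n : ℕ} {t : ℝ} (h : 1 ≤ n * (1 - Real.cos t)) : dbump n t = 0 :=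
  if_neg h.not_gt

lemma one_sub_cos_pos {t : ℝ} (h0 : 0 < t) (hpi : t ≤ Real.pi) : 0 < 1 - Real.cos t := by
  have := Real.cos_lt_cos_of_nonneg_of_le_pi le_rfl hpi h0
  rw [Real.cos_zero] at this
  linarith

lemma eventually_one_le {t₀ : ℝ} (h0 : 0 < t₀) (hpi : t₀ ≤ Real.pi) :
    ∀ᶠ n : ℕ in atTop, ∀ t ∈ Icc t₀ Real.pi, 1 ≤ n * (1 - Real.cos t) := by
  have := (tendsto_natCast_atTop_atTop (R := ℝ)).atTop_mul_const (one_sub_cos_pos h0 hpi)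
  filter_upwards [this.eventually_ge_atTop 1] with n hn t ht
  have := Real.cos_le_cos_of_nonneg_of_le_pi h0.le ht.2 ht.1
  exact hn.trans (mul_le_mul_of_nonneg_left (by linarith) n.cast_nonneg)

lemma tendsto_bump {t : ℝ} (ht : t ∈ Ioo 0 Real.pi) :
    Tendsto (fun n => bump n t) atTop (𝓝 1) :=
  tendsto_const_nhds.congr' ((eventually_one_le ht.1 ht.2.le).mono fun _ hn =>
    (bump_eq_one (hn t ⟨le_rfl, ht.2.le⟩)).symm)

lemma dbump_nonneg (n : ℕ) {t : ℝ} (ht : t ∈ Icc 0 Real.pi) : 0 ≤ dbump n t := by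
  unfold dbump
  split_ifs
  · exact mul_nonneg n.cast_nonneg (Real.sin_nonneg_of_mem_Icc ht)
  · exact le_rfl

lemma dbump_le (n : ℕ) {t : ℝ} (ht : t ∈ Icc 0 Real.pi) : dbump n t ≤ n * Real.sin t := by
  unfold dbump
  split_ifs
  · exact le_rfl
  · exact mul_nonneg n.cast_nonneg (Real.sin_nonneg_of_mem_Icc ht)

lemma hasDerivAt_bump (n : ℕ) {t : ℝ} (ht : t ∈ Icc 0 Real.pi)
    (hne : t ≠ Real.arccos (1 - 1 / n)) : HasDerivAt (bump n) (dbump n t) t := by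
  have hc : Continuous fun t => n * (1 - Real.cos t) := by fun_prop
  rcases lt_trichotomy ((n : ℝ) * (1 - Real.cos t)) 1 with h | h | h
  · have h1 : HasDerivAt (fun t => n * (1 - Real.cos t)) (n * Real.sin t) t := by
      simpa using ((Real.hasDerivAt_cos t).const_sub 1).const_mul (n : ℝ)
    rw [dbump, if_pos h]
    refine h1.congr_of_eventuallyEq ?_
    filter_upwards [hc.continuousAt.eventually_lt continuousAt_const h] with s hs
    exact min_eq_right hs.le
  · exfalso
    have hn : (n : ℝ) ≠ 0 := by intro h0; rw [h0] at h; norm_num at h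
    apply hne
    have : Real.cos t = 1 - 1 / n := by field_simp; linarith
    rw [← this, Real.arccos_cos ht.1 ht.2]
  · rw [dbump, if_neg h.not_gt]
    refine (hasDerivAt_const t (1 : ℝ)).congr_of_eventuallyEq ?_
    filter_upwards [continuousAt_const.eventually_lt hc.continuousAt h] with s hs
    exact min_eq_left hs.le

lemma isCutoff_bump (n : ℕ) : IsCutoff (bump n) (dbump n) n where
  continuousOn := (continuous_bump n).continuousOn
  measurable := (continuous_bump n).measurable
  measurable' := measurable_dbump n
  hasDerivAt := ⟨{Real.arccos (1 - 1 / n)}, countable_singleton _, fun _ ht =>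
    hasDerivAt_bump n (Ioo_subset_Icc_self ht.1) ht.2⟩
  bound := fun t _ => by
    rw [abs_of_nonneg (bump_nonneg n t)]
    exact min_le_right _ _
  bound' := fun t ht => by
    rw [abs_of_nonneg (dbump_nonneg n (Ioo_subset_Icc_self ht))]
    exact dbump_le n (Ioo_subset_Icc_self ht)

end Dumbbell

/-! ### The gradient constraint -/

namespace Dumbbell

section gradientConstraint

variable {l : ℝ} (hl : 0 < l) {y : E3 → ℝ} {v : E3 → ℝ} {H : E3 → E3}

lemma beyond_const (l k : ℝ) {q : ℝ × ℝ} (hq : q.1 ∈ Icc 0 Real.pi) :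
    beyond l (fun _ => k) q = k * (l ^ 2 * tail q.1) := by
  rw [beyond, tail, ← intervalIntegral.integral_const_mul, ← intervalIntegral.integral_const_mul]
  refine intervalIntegral.integral_congr fun s hs => ?_
  rw [uIcc_of_le hq.2] at hs
  simp only [dens, abs_of_nonneg (prof_nonneg ⟨hq.1.trans hs.1, hs.2⟩)]

lemma abs_beyond_le (hl : 0 < l) {M : ℝ}
    (hM : ∀ q ∈ Icc 0 Real.pi ×ˢ Icc 0 (2 * Real.pi), |y (param l q)| ≤ M) {q : ℝ × ℝ}
    (hq : q ∈ Icc 0 Real.pi ×ˢ Icc 0 (2 * Real.pi)) :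
    |beyond l y q| ≤ M * beyond l (fun _ => 1) q := by
  rw [beyond, beyond, ← intervalIntegral.integral_const_mul]
  refine intervalIntegral.norm_integral_le_of_norm_le
    (f := fun s => y (param l (s, q.2)) * dens l (s, q.2)) hq.1.2
    (ae_of_all _ fun s hs => ?_) (Continuous.intervalIntegrable ?_ _ _)
  · have hs' : s ∈ Icc 0 Real.pi := ⟨hq.1.1.trans hs.1.le, hs.2⟩
    obtain ⟨a, b, ha, -, hab⟩ := exists_dens_bounds hl
    have h3 : 0 ≤ dens l (s, q.2) :=
      (mul_nonneg ha.le (Real.sin_nonneg_of_mem_Icc hs')).trans (hab (s, q.2) hs').1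
    rw [norm_mul, Real.norm_of_nonneg h3, one_mul]
    exact mul_le_mul_of_nonneg_right (hM (s, q.2) ⟨hs', hq.2⟩) h3
  · exact continuous_const.mul (continuous_const.mul
      ((continuous_dens l).comp (continuous_id.prodMk continuous_const)))

lemma integrable_inv_radius (hl : 0 < l) :
    Integrable (fun q : ℝ × ℝ => (l * prof q.1)⁻¹) (coordMeasure l) := by
  rw [coordMeasure, integrable_withDensity_iff_integrable_smul'
    (continuous_dens l).measurable.ennreal_ofReal (ae_of_all _ fun _ => ENNReal.ofReal_lt_top)]
  have h : Continuous fun q : ℝ × ℝ => l * speed q.1 :=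
    continuous_const.mul (continuous_speed.comp continuous_fst)
  refine h.integrableOn_coordRect.congr ?_
  filter_upwards [ae_restrict_mem measurableSet_coordRect] with q hq
  have h1 := prof_pos hq.1
  rw [ENNReal.toReal_ofReal (dens_pos hl hq.1).le, dens, abs_of_pos h1, smul_eq_mul]
  field_simp

lemma exists_small_near_base (hv : ContinuousOn v (surf hl).carrier) (h0 : v (surf hl).base = 0)
    {ε : ℝ} (hε : 0 < ε) : ∃ t₀ ∈ Ioc 0 Real.pi, ∀ q : ℝ × ℝ, q.1 ∈ Ioo 0 t₀ →
      |v (param l q)| ≤ ε := by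
  have hb : (surf hl).base ∈ (surf hl).carrier := by
    rw [← base_eq hl 0]; exact param_mem_carrier hl _
  obtain ⟨δ, hδ, h⟩ := Metric.continuousWithinAt_iff.1 (hv _ hb) ε hε
  obtain ⟨M, hM, hspeed⟩ := exists_speed_le l
  refine ⟨min (δ / M) Real.pi, ⟨lt_min (by positivity) Real.pi_pos, min_le_right _ _⟩,
    fun q hq => ?_⟩
  have hq' : q.1 ∈ Icc 0 Real.pi := ⟨hq.1.le, hq.2.le.trans (min_le_right _ _)⟩
  have hd := norm_image_sub_le_of_norm_deriv_le_segment' (C := M)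
    (fun s (_ : s ∈ Icc 0 Real.pi) => (hasDerivAt_param l s q.2).hasDerivWithinAt)
    (fun s hs => by
      rw [norm_smul, norm_frame, mul_one]
      exact hspeed s (Ico_subset_Icc_self hs)) q.1 hq'
  rw [base_eq hl, sub_zero] at hd
  have h1 := h (param_mem_carrier hl q) (by
    rw [dist_eq_norm]
    refine hd.trans_lt ?_
    have := hq.2.trans_le (min_le_left _ _)
    rwa [lt_div_iff₀ hM, mul_comm] at this)
  rw [h0, dist_zero_right] at h1
  exact h1.le

/-- The layer in which the cutoff varies has a total weight bounded independently of the cutoff.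
This follows from integration by parts against the constant function. -/
lemma integral_layer_le (hl : 0 < l) (n : ℕ) :
    Integrable (fun q => dbump n q.1 * beyond l (fun _ => 1) q / dens l q) (coordMeasure l) ∧
    ∫ q, dbump n q.1 * beyond l (fun _ => 1) q / dens l q ∂coordMeasure l ≤
      (coordMeasure l).real univ := by
  have hparts := integral_parts_of_contDiff hl (continuous_const (y := (1 : ℝ)))
    (isCutoff_bump n) (contDiff_const (c := (1 : ℝ)))
  have hgrad : ∀ p : E3, gradient (fun _ : E3 => (1 : ℝ)) p = 0 := fun p => by simp [gradient]
  simp only [hgrad, inner_zero_right, mul_zero, integral_zero, mul_one] at hparts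
  obtain ⟨K, hK⟩ := funWeight_bounded hl (continuous_const (y := (1 : ℝ))) (isCutoff_bump n)
  have i1 : Integrable (funWeight l (fun _ => 1) (bump n) (dbump n)) (coordMeasure l) :=
    Integrable.of_bound (measurable_funWeight continuous_const (continuous_bump n).measurable
      (measurable_dbump n)).aestronglyMeasurable K hK
  have i2 : Integrable (fun q : ℝ × ℝ => bump n q.1) (coordMeasure l) :=
    ((continuous_bump n).comp continuous_fst).integrable_coordMeasure l
  have heq : ∀ q : ℝ × ℝ, dbump n q.1 * beyond l (fun _ => 1) q / dens l q =
      bump n q.1 - funWeight l (fun _ => 1) (bump n) (dbump n) q := fun q => by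
    simp [funWeight]
  simp only [heq]
  refine ⟨i2.sub i1, ?_⟩
  rw [integral_sub i2 i1, ← hparts, sub_zero]
  refine (integral_mono i2 (integrable_const 1) fun q => bump_le_one n q.1).trans_eq ?_
  simp

/-- Integration by parts along the meridians down to the pole, for a Sobolev function with bounded
gradient which vanishes at the pole: there is no boundary term. -/
theorem integral_parts_of_gradientAdmissible (hv : (surf hl).GradientAdmissible v H)
    (hy : Continuous y) :
    ∫ q, beyond l y q / (l * prof q.1) * inner ℝ (frame q) (H (param l q)) ∂coordMeasure l =
      ∫ q, y (param l q) * v (param l q) ∂coordMeasure l := by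
  obtain ⟨hS, hH1, hcont, hbase⟩ := hv
  obtain ⟨M, hM, hyM⟩ := exists_abs_le_of_continuous (hy.comp (continuous_param l))
  obtain ⟨D, hD, hyD⟩ := exists_beyond_le hl hy
  have hvi := integrable_fun hl hS
  have hHi := integrable_inner_frame hl hS
  have hbumpm : ∀ n, Measurable fun q : ℝ × ℝ => bump n q.1 := fun n =>
    (continuous_bump n).measurable.comp measurable_fst
  have hleft : Tendsto (fun n => ∫ q, gradWeight l y (bump n) q *
      inner ℝ (frame q) (H (param l q)) ∂coordMeasure l) atTop
      (𝓝 (∫ q, beyond l y q / (l * prof q.1) * inner ℝ (frame q) (H (param l q))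
        ∂coordMeasure l)) := by
    refine tendsto_integral_of_dominated_convergence (fun q => D * 2 * (l * prof q.1)⁻¹)
      (fun n => (measurable_gradWeight hy (continuous_bump n).measurable).aestronglyMeasurable.mul
        hHi.aestronglyMeasurable) ((integrable_inv_radius hl).const_mul _) (fun n => ?_) ?_
    · filter_upwards [ae_coordMeasure_mem l, ae_coordMeasure_of_ae_area hl hH1] with q hq hq1
      have h1 := mul_pos hl (prof_pos hq.1)
      have h2 : |beyond l y q| ≤ D * 2 :=
        (hyD q (coordRect_subset hq)).trans (by gcongr; linarith [Real.cos_le_one q.1])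
      have h3 : |bump n q.1 * beyond l y q| ≤ D * 2 := by
        rw [abs_mul]
        exact (mul_le_of_le_one_left (abs_nonneg _) (abs_bump_le_one n q.1)).trans h2
      rw [norm_mul, gradWeight, norm_div, Real.norm_of_nonneg h1.le, div_eq_mul_inv]
      refine (mul_le_of_le_one_right (by positivity) ((abs_inner_frame_le q _).trans hq1)).trans ?_
      exact mul_le_mul_of_nonneg_right h3 (inv_nonneg.2 h1.le)
    · filter_upwards [ae_coordMeasure_fst l] with q hq
      have h1 := (tendsto_bump hq).mul_const (beyond l y q / (l * prof q.1) *
        inner ℝ (frame q) (H (param l q)))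
      rw [one_mul] at h1
      refine h1.congr fun n => ?_
      rw [gradWeight]; ring
  have hright1 : Tendsto (fun n => ∫ q, bump n q.1 * (y (param l q) * v (param l q))
      ∂coordMeasure l) atTop (𝓝 (∫ q, y (param l q) * v (param l q) ∂coordMeasure l)) := by
    have hym : Measurable fun q => y (param l q) := hy.measurable.comp (measurable_param l)
    refine tendsto_integral_of_dominated_convergence (fun q => M * ‖v (param l q)‖)
      (fun n => (hbumpm n).aestronglyMeasurable.mul
        (hym.aestronglyMeasurable.mul hvi.aestronglyMeasurable))
      (hvi.norm.const_mul M) (fun n => ?_) ?_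
    · filter_upwards [ae_coordMeasure_mem l] with q hq
      rw [norm_mul, norm_mul]
      refine (mul_le_of_le_one_left (by positivity) (abs_bump_le_one n q.1)).trans ?_
      exact mul_le_mul_of_nonneg_right (hyM q (coordRect_subset hq)) (norm_nonneg _)
    · filter_upwards [ae_coordMeasure_fst l] with q hq
      simpa using (tendsto_bump hq).mul_const (y (param l q) * v (param l q))
  have hbumpi : ∀ n, Integrable (fun q : ℝ × ℝ => bump n q.1 * (y (param l q) * v (param l q)))
      (coordMeasure l) := fun n => by
    have h1 : Integrable (fun q => y (param l q) * v (param l q)) (coordMeasure l) := by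
      refine hvi.bdd_mul (c := M) (hy.measurable.comp (measurable_param l)).aestronglyMeasurable ?_
      filter_upwards [ae_coordMeasure_mem l] with q hq
      exact hyM q (coordRect_subset hq)
    exact h1.bdd_mul (hbumpm n).aestronglyMeasurable (ae_of_all _ fun q => abs_bump_le_one n q.1)
  have hfi : ∀ n, Integrable (fun q => funWeight l y (bump n) (dbump n) q * v (param l q))
      (coordMeasure l) := fun n => by
    obtain ⟨K, hK⟩ := funWeight_bounded hl hy (isCutoff_bump n)
    exact hvi.bdd_mul (measurable_funWeight hy (continuous_bump n).measurable
      (measurable_dbump n)).aestronglyMeasurable hK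
  -- the layer near the pole does not contribute in the limit, as `v` is small there
  have hright2 : Tendsto (fun n => ∫ q, (bump n q.1 * (y (param l q) * v (param l q)) -
      funWeight l y (bump n) (dbump n) q * v (param l q)) ∂coordMeasure l) atTop (𝓝 0) := by
    rw [Metric.tendsto_atTop']
    intro ε hε
    set κ := M * (coordMeasure l).real univ + 1 with hκ
    have hκ0 : 0 < κ := by positivity
    obtain ⟨t₀, ht₀, hsmall⟩ := exists_small_near_base hl hcont hbase (div_pos hε hκ0)
    obtain ⟨N, hN⟩ := eventually_atTop.1 (eventually_one_le ht₀.1 ht₀.2)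
    refine ⟨N, fun n hn => ?_⟩
    rw [dist_zero_right]
    obtain ⟨j1, j2⟩ := integral_layer_le hl n
    refine (norm_integral_le_of_norm_le (j1.const_mul (ε / κ * M)) ?_).trans_lt ?_
    · filter_upwards [ae_coordMeasure_mem l] with q hq
      have e1 : bump n q.1 * (y (param l q) * v (param l q)) -
          funWeight l y (bump n) (dbump n) q * v (param l q) =
          dbump n q.1 * beyond l y q / dens l q * v (param l q) := by
        rw [funWeight]; ring
      have h2 := dbump_nonneg n (Ioo_subset_Icc_self hq.1)
      have h3 := dens_pos hl hq.1
      have h4 := abs_beyond_le hl hyM (coordRect_subset hq)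
      rw [e1]
      by_cases htq : q.1 < t₀
      · have h5 := hsmall q ⟨hq.1.1, htq⟩
        rw [norm_mul, norm_div, norm_mul, Real.norm_of_nonneg h2, Real.norm_of_nonneg h3.le]
        calc dbump n q.1 * ‖beyond l y q‖ / dens l q * ‖v (param l q)‖
            ≤ dbump n q.1 * (M * beyond l (fun _ => 1) q) / dens l q * (ε / κ) := by
              gcongr
              · exact div_nonneg (mul_nonneg h2 ((abs_nonneg _).trans h4)) h3.le
              · exact h4
              · exact h5
          _ = _ := by ring
      · rw [dbump_eq_zero (hN n hn.le q.1 ⟨not_lt.1 htq, hq.1.2.le⟩)]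
        simp
    · rw [integral_const_mul]
      calc ε / κ * M * ∫ q, dbump n q.1 * beyond l (fun _ => 1) q / dens l q ∂coordMeasure l
          ≤ ε / κ * M * (coordMeasure l).real univ := by gcongr
        _ = ε * (M * (coordMeasure l).real univ / κ) := by ring
        _ < ε * 1 := by
            gcongr
            rw [div_lt_one hκ0, hκ]; linarith
        _ = ε := mul_one ε
  have hright : Tendsto (fun n => ∫ q, funWeight l y (bump n) (dbump n) q * v (param l q)
      ∂coordMeasure l) atTop (𝓝 (∫ q, y (param l q) * v (param l q) ∂coordMeasure l)) := by
    have := hright1.sub hright2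
    rw [sub_zero] at this
    refine this.congr fun n => ?_
    rw [integral_sub (hbumpi n) (hfi n)]
    ring
  refine tendsto_nhds_unique hleft (hright.congr fun n => ?_)
  exact (integral_parts hl hS hy (isCutoff_bump n)).symm

/-- The slope of the minimizer with the gradient constraint: the slope `quot / c` of the
unconstrained minimizer, truncated at `1`. -/
noncomputable def gradSlope (c t : ℝ) : ℝ := min 1 (quot t / c)

lemma measurable_quot : Measurable quot :=
  continuous_tail.measurable.div continuous_prof.measurable

lemma isSlope_gradSlope {c : ℝ} (hc : 0 < c) : IsSlope (gradSlope c) 1 where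
  measurable := measurable_const.min (measurable_quot.div_const c)
  continuousOn := continuousOn_const.inf (continuousOn_quot.div_const c)
  bound := fun t ht => by
    have h := div_nonneg (quot_nonneg (Ioo_subset_Icc_self ht)) hc.le
    rw [gradSlope, abs_of_nonneg (le_min zero_le_one h)]
    exact min_le_left _ _

lemma radialFun_base (g : ℝ → ℝ) : radialFun l g (surf hl).base = 0 := by
  rw [← base_eq hl 0, radialFun_param hl (left_mem_Icc.2 Real.pi_pos.le), radialProfile,
    intervalIntegral.integral_same]

lemma gradientAdmissible_radial {c : ℝ} (hc : 0 < c) : (surf hl).GradientAdmissible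
    (radialFun l (gradSlope c)) (radialGrad l (gradSlope c)) := by
  have hg := isSlope_gradSlope hc
  refine ⟨hg.hasSobolevGradient hl, ae_area_of_forall hl fun t ht θ _ => ?_,
    (hg.continuous_radialFun l).continuousOn, radialFun_base hl _⟩
  rw [radialGrad_param hl ht, norm_smul, norm_frame, mul_one]
  exact hg.bound t ht

/-- The gradient constraint is handled pointwise: integration by parts turns the linear term of
the energy into an integral of the radial derivative. -/
lemma linearized_eq_of_gradientAdmissible {c m : ℝ} (hcm : m * l * c = 2) (hc : 0 < c)
    (hv : (surf hl).GradientAdmissible v H) :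
    Integrable (fun q : ℝ × ℝ => (2 * gradSlope c q.1 - 2 * (quot q.1 / c)) *
      inner ℝ (frame q) (H (param l q))) (coordMeasure l) ∧
    linearized l m (gradSlope c) v H = ∫ q : ℝ × ℝ, (2 * gradSlope c q.1 - 2 * (quot q.1 / c)) *
      inner ℝ (frame q) (H (param l q)) ∂coordMeasure l := by
  have hparts := integral_parts_of_gradientAdmissible hl hv (continuous_const (y := m))
  have hae : ∀ᵐ q ∂coordMeasure l, beyond l (fun _ => m) q / (l * prof q.1) *
      inner ℝ (frame q) (H (param l q)) =
      2 * (quot q.1 / c) * inner ℝ (frame q) (H (param l q)) := by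
    filter_upwards [ae_coordMeasure_fst l] with q hq
    have h1 := (prof_pos hq).ne'
    rw [beyond_const l m (Ioo_subset_Icc_self hq), quot]
    congr 1
    field_simp
    linear_combination tail q.1 * hcm
  rw [integral_congr_ae hae, integral_const_mul] at hparts
  have i1 := integrable_mul_inner_frame hl (isSlope_gradSlope hc) hv.1
  have hHi := integrable_inner_frame hl hv.1
  have i2 : Integrable (fun q : ℝ × ℝ => 2 * (quot q.1 / c) *
      inner ℝ (frame q) (H (param l q))) (coordMeasure l) := by
    obtain ⟨M, hM, htail⟩ := exists_abs_le_of_continuous (F := fun q => tail q.1)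
      (continuous_tail.comp continuous_fst)
    refine ((integrable_inv_radius hl).const_mul (2 * (M / c * l))).mono'
      ((((measurable_quot.comp measurable_fst).div_const c).const_mul 2).aestronglyMeasurable.mul
        hHi.aestronglyMeasurable) ?_
    filter_upwards [ae_coordMeasure_mem l, ae_coordMeasure_of_ae_area hl hv.2.1] with q hq hq1
    have h1 := prof_pos hq.1
    have h2 := htail q (coordRect_subset hq)
    rw [norm_mul]
    refine (mul_le_of_le_one_right (norm_nonneg _) ((abs_inner_frame_le q _).trans hq1)).trans ?_
    rw [Real.norm_eq_abs, quot, abs_mul, abs_div, abs_div, abs_of_pos h1, abs_of_pos hc,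
      abs_two]
    calc 2 * (|tail q.1| / prof q.1 / c) ≤ 2 * (M / prof q.1 / c) := by gcongr
      _ = 2 * (M / c * l) * (l * prof q.1)⁻¹ := by field_simp
  have i3 := i1.sub i2
  have hsub : ∀ q : ℝ × ℝ, (2 * gradSlope c q.1 - 2 * (quot q.1 / c)) *
      inner ℝ (frame q) (H (param l q)) = 2 * gradSlope c q.1 * inner ℝ (frame q) (H (param l q)) -
      2 * (quot q.1 / c) * inner ℝ (frame q) (H (param l q)) := fun q => sub_mul _ _ _
  simp only [hsub]
  refine ⟨i3, ?_⟩
  rw [linearized, integral_sub i1 i2, hparts]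

lemma linearized_le_of_gradientAdmissible {c m : ℝ} (hcm : m * l * c = 2) (hc : 0 < c)
    (hv : (surf hl).GradientAdmissible v H) :
    linearized l m (gradSlope c) (radialFun l (gradSlope c)) (radialGrad l (gradSlope c)) ≤
      linearized l m (gradSlope c) v H := by
  obtain ⟨i1, e1⟩ := linearized_eq_of_gradientAdmissible hl hcm hc hv
  obtain ⟨i2, e2⟩ := linearized_eq_of_gradientAdmissible hl hcm hc (gradientAdmissible_radial hl hc)
  rw [e1, e2]
  refine integral_mono_ae i2 i1 ?_
  filter_upwards [ae_radialGrad_param hl (gradSlope c),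
    ae_coordMeasure_of_ae_area hl hv.2.1] with q hq hq1
  rw [hq, real_inner_smul_right, real_inner_self_eq_norm_sq, norm_frame, one_pow, mul_one]
  have h1 : inner ℝ (frame q) (H (param l q)) ≤ 1 :=
    (le_abs_self _).trans ((abs_inner_frame_le q _).trans hq1)
  -- the first factor is nonpositive, and it vanishes where the slope is less than `1`
  rcases le_total 1 (quot q.1 / c) with h | h
  · rw [gradSlope, min_eq_left h]
    nlinarith
  · rw [gradSlope, min_eq_right h]
    simp

theorem isGradientMinimizer_radial {c m : ℝ} (hcm : m * l * c = 2) (hc : 0 < c) :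
    (surf hl).IsGradientMinimizer m (radialFun l (gradSlope c)) :=
  ⟨radialGrad l (gradSlope c), gradientAdmissible_radial hl hc, fun _ _ hv =>
    energy_radial_le hl (isSlope_gradSlope hc) hv.1
      (linearized_le_of_gradientAdmissible hl hcm hc hv)⟩

theorem IsGradientMinimizer.ae_eq_radial {c m : ℝ} (hcm : m * l * c = 2) (hc : 0 < c)
    (hv : (surf hl).IsGradientMinimizer m v) :
    v =ᵐ[(surf hl).area] radialFun l (gradSlope c) := by
  obtain ⟨H, hadm, hmin⟩ := hv
  have hu := gradientAdmissible_radial hl hc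
  obtain ⟨hH, -⟩ := ae_eq_of_energy_le hl (isSlope_gradSlope hc) hadm.1
    (linearized_le_of_gradientAdmissible hl hcm hc hadm) (hmin _ _ hu)
  refine ae_eq_of_forall_integral_eq hl hadm.1.1 hu.1.1 fun y hy => ?_
  rw [← integral_parts_of_gradientAdmissible hl hadm hy,
    ← integral_parts_of_gradientAdmissible hl hu hy]
  refine integral_congr_ae ?_
  filter_upwards [hH, ae_radialGrad_param hl (gradSlope c)] with q h1 h2
  rw [h1, h2]

end gradientConstraint

end Dumbbell

/-! ### The distance constraint -/

namespace Dumbbell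

/-- The slope of the minimizer with the distance constraint: it is `1` on the contact set
`t ≤ t₀`, and beyond it the slope of the unconstrained minimizer. -/
noncomputable def distSlope (c t₀ t : ℝ) : ℝ := quot (max t t₀) / c

/-- The quotient of the slope `distSlope c t₀` and the slope of the unconstrained minimizer. -/
noncomputable def contactRatio (c t₀ t : ℝ) : ℝ := if t ≤ t₀ then c * prof t / tail t else 1

/-- The derivative of `contactRatio`. -/
noncomputable def dcontactRatio (c t₀ t : ℝ) : ℝ :=
  if t ≤ t₀ then c * (dprof t * tail t + prof t * (prof t * speed t)) / tail t ^ 2 else 0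

section contact

variable {c t₀ t : ℝ}

lemma tail_strictAntiOn : StrictAntiOn tail (Icc 0 Real.pi) := by
  refine strictAntiOn_of_deriv_neg (convex_Icc _ _) continuous_tail.continuousOn fun t ht => ?_
  rw [(hasDerivAt_tail t).deriv, interior_Icc] at *
  exact neg_neg_iff_pos.2 (mul_pos (prof_pos ht) (speed_pos t))

lemma lt_pi_of_mem (ht₀ : t₀ ∈ Ioo 0 (Real.pi / 4)) : t₀ ∈ Ioo 0 Real.pi :=
  ⟨ht₀.1, ht₀.2.trans (by linarith [Real.pi_pos])⟩

lemma tail_pos_of_le (ht₀ : t₀ ∈ Ioo 0 (Real.pi / 4)) (ht : t ∈ Icc 0 t₀) : 0 < tail t :=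
  tail_pos ⟨ht.1, ht.2.trans_lt (lt_pi_of_mem ht₀).2⟩

lemma contactRatio_nonneg (hc : 0 < c) (ht : t ∈ Icc 0 Real.pi) : 0 ≤ contactRatio c t₀ t := by
  unfold contactRatio
  split_ifs
  · exact div_nonneg (mul_nonneg hc.le (prof_nonneg ht)) (tail_nonneg ht)
  · exact zero_le_one

lemma contactRatio_lt_one (hc : 0 < c) (ht₀ : t₀ ∈ Ioo 0 (Real.pi / 4))
    (heq : tail t₀ = c * prof t₀) (ht : t ∈ Ico 0 t₀) : contactRatio c t₀ t < 1 := by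
  have h1 : tail t₀ < tail t := tail_strictAntiOn
    ⟨ht.1, ht.2.le.trans (lt_pi_of_mem ht₀).2.le⟩ (Ioo_subset_Icc_self (lt_pi_of_mem ht₀)) ht.2
  have h2 : prof t ≤ prof t₀ :=
    prof_monotoneOn ⟨ht.1, ht.2.le.trans ht₀.2.le⟩ (Ioo_subset_Icc_self ht₀) ht.2.le
  rw [contactRatio, if_pos ht.2.le, div_lt_one (tail_pos_of_le ht₀ (Ico_subset_Icc_self ht))]
  nlinarith

lemma contactRatio_contact (ht₀ : t₀ ∈ Ioo 0 (Real.pi / 4)) (heq : tail t₀ = c * prof t₀) :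
    contactRatio c t₀ t₀ = 1 := by
  rw [contactRatio, if_pos le_rfl, ← heq,
    div_self (tail_pos_of_le ht₀ (right_mem_Icc.2 ht₀.1.le)).ne']

lemma contactRatio_le_one (hc : 0 < c) (ht₀ : t₀ ∈ Ioo 0 (Real.pi / 4))
    (heq : tail t₀ = c * prof t₀) (ht : 0 ≤ t) : contactRatio c t₀ t ≤ 1 := by
  rcases lt_trichotomy t t₀ with h | h | h
  · exact (contactRatio_lt_one hc ht₀ heq ⟨ht, h⟩).le
  · rw [h, contactRatio_contact ht₀ heq]
  · rw [contactRatio, if_neg h.not_ge]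

lemma continuousOn_contactRatio (ht₀ : t₀ ∈ Ioo 0 (Real.pi / 4)) (heq : tail t₀ = c * prof t₀) :
    ContinuousOn (contactRatio c t₀) (Icc 0 Real.pi) := by
  -- freezing the parameter of the first expression at `t₀` yields the second one
  have h : ContinuousOn (fun t => c * prof (min t t₀) / tail (min t t₀)) (Icc 0 Real.pi) := by
    have hmin : Continuous fun t => min t t₀ := continuous_id.min continuous_const
    refine ContinuousOn.div (continuous_const.mul (continuous_prof.comp hmin)).continuousOn
      (continuous_tail.comp hmin).continuousOn fun t ht => ?_
    exact (tail_pos_of_le ht₀ ⟨le_min ht.1 ht₀.1.le, min_le_right _ _⟩).ne'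
  refine h.congr fun t _ => ?_
  beta_reduce
  rcases le_total t t₀ with h1 | h1
  · rw [contactRatio, if_pos h1, min_eq_left h1]
  · rw [min_eq_right h1]
    rcases h1.eq_or_lt with h2 | h2
    · rw [← h2, contactRatio, if_pos le_rfl]
    · rw [contactRatio, if_neg h2.not_ge, ← heq,
        div_self (tail_pos_of_le ht₀ (right_mem_Icc.2 ht₀.1.le)).ne']

lemma hasDerivAt_contactRatio (ht₀ : t₀ ∈ Ioo 0 (Real.pi / 4)) (ht : t ∈ Ioo 0 Real.pi)
    (hne : t ≠ t₀) : HasDerivAt (contactRatio c t₀) (dcontactRatio c t₀ t) t := by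
  rcases lt_or_gt_of_ne hne with h | h
  · have h1 := ((hasDerivAt_prof t).const_mul c).div (hasDerivAt_tail t)
      (tail_pos_of_le ht₀ ⟨ht.1.le, h.le⟩).ne'
    rw [dcontactRatio, if_pos h.le]
    refine (h1.congr_deriv (by ring)).congr_of_eventuallyEq ?_
    filter_upwards [eventually_lt_nhds h] with s hs
    rw [contactRatio, if_pos hs.le, Pi.div_apply]
  · rw [dcontactRatio, if_neg h.not_ge]
    refine (hasDerivAt_const t (1 : ℝ)).congr_of_eventuallyEq ?_
    filter_upwards [eventually_gt_nhds h] with s hs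
    rw [contactRatio, if_neg hs.not_ge]

lemma dcontactRatio_nonneg (hc : 0 < c) (ht₀ : t₀ ∈ Ioo 0 (Real.pi / 4))
    (ht : t ∈ Icc 0 Real.pi) : 0 ≤ dcontactRatio c t₀ t := by
  unfold dcontactRatio
  split_ifs with h
  · have h1 := dprof_nonneg ⟨ht.1, h.trans ht₀.2.le⟩
    have h2 := prof_nonneg ht
    have h3 := tail_nonneg ht
    have h4 := speed_pos t
    positivity
  · exact le_rfl

lemma exists_dcontactRatio_le (ht₀ : t₀ ∈ Ioo 0 (Real.pi / 4)) :
    ∃ K : ℝ, 0 ≤ K ∧ ∀ t ∈ Icc 0 t₀, |dcontactRatio c t₀ t| ≤ K := by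
  have h : ContinuousOn (fun t => c * (dprof t * tail t + prof t * (prof t * speed t)) /
      tail t ^ 2) (Icc 0 t₀) := by
    have h1 := continuous_dprof
    have h2 := continuous_tail
    have h3 := continuous_prof
    have h4 := continuous_speed
    refine ContinuousOn.div (Continuous.continuousOn (by fun_prop))
      (Continuous.continuousOn (by fun_prop)) fun t ht => ?_
    exact (pow_pos (tail_pos_of_le ht₀ ht) 2).ne'
  obtain ⟨K, hK⟩ := isCompact_Icc.exists_bound_of_continuousOn h
  refine ⟨|K|, abs_nonneg K, fun t ht => ?_⟩
  rw [dcontactRatio, if_pos ht.2]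
  exact (hK t ht).trans (le_abs_self K)

lemma measurable_contactRatio : Measurable (contactRatio c t₀) :=
  Measurable.ite measurableSet_Iic
    ((continuous_prof.measurable.const_mul c).div continuous_tail.measurable) measurable_const

lemma measurable_dcontactRatio : Measurable (dcontactRatio c t₀) := by
  have h1 := continuous_dprof.measurable
  have h2 := continuous_tail.measurable
  have h3 := continuous_prof.measurable
  have h4 := continuous_speed.measurable
  exact Measurable.ite measurableSet_Iic (by fun_prop) measurable_const

/-- The product of the bump and of the contact ratio is an admissible cutoff. -/
lemma exists_isCutoff_contact (hc : 0 < c) (ht₀ : t₀ ∈ Ioo 0 (Real.pi / 4))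
    (heq : tail t₀ = c * prof t₀) (n : ℕ) : ∃ C, IsCutoff (fun t => bump n t * contactRatio c t₀ t)
      (fun t => dbump n t * contactRatio c t₀ t + bump n t * dcontactRatio c t₀ t) C := by
  obtain ⟨K, hK0, hK⟩ := exists_dcontactRatio_le (c := c) ht₀
  have habs : ∀ t ∈ Icc 0 Real.pi, |contactRatio c t₀ t| ≤ 1 := fun t ht => by
    rw [abs_of_nonneg (contactRatio_nonneg hc ht)]
    exact contactRatio_le_one hc ht₀ heq ht.1
  have hcut := isCutoff_bump n
  refine ⟨n * (1 + K), ?_, ?_, ?_, ?_, fun t ht => ?_, fun t ht => ?_⟩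
  · exact (continuous_bump n).continuousOn.mul (continuousOn_contactRatio ht₀ heq)
  · exact (continuous_bump n).measurable.mul measurable_contactRatio
  · exact ((measurable_dbump n).mul measurable_contactRatio).add
      ((continuous_bump n).measurable.mul measurable_dcontactRatio)
  · refine ⟨{Real.arccos (1 - 1 / n), t₀}, (countable_singleton _).insert _, fun t ht => ?_⟩
    have h := ht.2
    simp only [mem_insert_iff, mem_singleton_iff, not_or] at h
    exact (hasDerivAt_bump n (Ioo_subset_Icc_self ht.1) h.1).mul
      (hasDerivAt_contactRatio ht₀ ht.1 h.2)
  · rw [abs_mul]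
    have h1 := hcut.bound t ht
    have h2 : 0 ≤ n * (1 - Real.cos t) := (abs_nonneg _).trans h1
    calc |bump n t| * |contactRatio c t₀ t| ≤ n * (1 - Real.cos t) * 1 := by
          gcongr
          exact habs t ht
      _ ≤ n * (1 - Real.cos t) + K * (n * (1 - Real.cos t)) := by
          have := mul_nonneg hK0 h2
          linarith
      _ = n * (1 + K) * (1 - Real.cos t) := by ring
  · have ht' := Ioo_subset_Icc_self ht
    have hsin := Real.sin_pos_of_mem_Ioo ht
    have h1 : |dbump n t * contactRatio c t₀ t| ≤ n * Real.sin t := by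
      rw [abs_mul]
      exact (mul_le_of_le_one_right (abs_nonneg _) (habs t ht')).trans (hcut.bound' t ht)
    have h2 : |bump n t * dcontactRatio c t₀ t| ≤ n * Real.sin t * K := by
      rcases le_or_gt t t₀ with h | h
      · have hcos : 0 ≤ Real.cos t := Real.cos_nonneg_of_mem_Icc
          ⟨by linarith [ht.1, Real.pi_pos], by linarith [ht₀.2, Real.pi_pos]⟩
        have hle : 1 - Real.cos t ≤ Real.sin t := by
          nlinarith [Real.sin_sq_add_cos_sq t, Real.sin_le_one t, Real.cos_le_one t]
        rw [abs_mul]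
        refine mul_le_mul ((hcut.bound t ht').trans ?_) (hK t ⟨ht.1.le, h⟩) (abs_nonneg _)
          (by positivity)
        gcongr
      · rw [dcontactRatio, if_neg h.not_ge, mul_zero, abs_zero]
        positivity
    refine (abs_add_le _ _).trans ((add_le_add h1 h2).trans_eq ?_)
    ring

lemma quot_contact (ht₀ : t₀ ∈ Ioo 0 (Real.pi / 4)) (heq : tail t₀ = c * prof t₀) :
    quot t₀ = c := by
  rw [quot, heq, mul_div_cancel_right₀ _ (prof_pos (lt_pi_of_mem ht₀)).ne']

lemma distSlope_of_le (hc : 0 < c) (ht₀ : t₀ ∈ Ioo 0 (Real.pi / 4))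
    (heq : tail t₀ = c * prof t₀) (ht : t ≤ t₀) : distSlope c t₀ t = 1 := by
  rw [distSlope, max_eq_right ht, quot_contact ht₀ heq, div_self hc.ne']

lemma distSlope_of_ge (ht : t₀ ≤ t) : distSlope c t₀ t = quot t / c := by
  rw [distSlope, max_eq_left ht]

lemma contactRatio_mul_quot (hc : 0 < c) (ht₀ : t₀ ∈ Ioo 0 (Real.pi / 4))
    (heq : tail t₀ = c * prof t₀) (ht : t ∈ Ioo 0 Real.pi) :
    contactRatio c t₀ t * (quot t / c) = distSlope c t₀ t := by
  rcases le_or_gt t t₀ with h | h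
  · have h1 := (tail_pos_of_le ht₀ ⟨ht.1.le, h⟩).ne'
    have h2 := (prof_pos ht).ne'
    rw [distSlope_of_le hc ht₀ heq h, contactRatio, if_pos h, quot]
    field_simp
  · rw [contactRatio, if_neg h.not_ge, one_mul, distSlope_of_ge h.le]

lemma exists_isSlope_distSlope (hc : 0 < c) (ht₀ : t₀ ∈ Ioo 0 (Real.pi / 4)) :
    ∃ B, IsSlope (distSlope c t₀) B := by
  obtain ⟨C, hC, hle⟩ := exists_quot_le ht₀.1 (lt_pi_of_mem ht₀).2
  have hmax : ∀ t ∈ Ioo 0 Real.pi, max t t₀ ∈ Ico t₀ Real.pi := fun t ht =>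
    ⟨le_max_right _ _, max_lt ht.2 (lt_pi_of_mem ht₀).2⟩
  have hsub : Ico t₀ Real.pi ⊆ Ioo 0 Real.pi := fun t ht => ⟨ht₀.1.trans_le ht.1, ht.2⟩
  refine ⟨C / c, (measurable_quot.comp (measurable_id.max measurable_const)).div_const c, ?_,
    fun t ht => ?_⟩
  · exact (continuousOn_quot.comp (continuous_id.max continuous_const).continuousOn
      fun t ht => hsub (hmax t ht)).div_const c
  · rw [distSlope, abs_div, abs_of_pos hc,
      abs_of_nonneg (quot_nonneg (Ioo_subset_Icc_self (hsub (hmax t ht))))]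
    gcongr
    exact hle _ (hmax t ht)

end contact

section distanceConstraint

variable {l : ℝ} (hl : 0 < l) {c t₀ m B : ℝ} {v : E3 → ℝ} {H : E3 → E3}

lemma radialProfile_distSlope_of_le (hc : 0 < c) (ht₀ : t₀ ∈ Ioo 0 (Real.pi / 4))
    (heq : tail t₀ = c * prof t₀) {t : ℝ} (ht : t ∈ Icc 0 t₀) :
    radialProfile l (distSlope c t₀) t = radialProfile l (fun _ => 1) t := by
  refine intervalIntegral.integral_congr fun s hs => ?_
  rw [uIcc_of_le ht.1] at hs
  simp only [distSlope_of_le hc ht₀ heq (hs.2.trans ht.2)]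

/-- The minimizer stays below the distance: what it gains on the neck, where its slope exceeds
`1`, is less than what it lost before. -/
lemma radialProfile_distSlope_le (hl : 0 < l) (hc : 0 < c) (ht₀ : t₀ ∈ Ioo 0 (Real.pi / 4))
    (heq : tail t₀ = c * prof t₀)
    (hpos : ∀ t ∈ Ico t₀ Real.pi, 0 ≤ ∫ s in t₀..t, speed s * (c - quot s))
    (hg : IsSlope (distSlope c t₀) B) {t : ℝ} (ht : t ∈ Ioo 0 Real.pi) :
    radialProfile l (distSlope c t₀) t ≤ radialProfile l (fun _ => 1) t := by
  rcases le_total t t₀ with h | h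
  · exact (radialProfile_distSlope_of_le hc ht₀ heq ⟨ht.1.le, h⟩).le
  have ht' := Ioo_subset_Icc_self ht
  have ht₀' := Ioo_subset_Icc_self (lt_pi_of_mem ht₀)
  have h0 : (0 : ℝ) ∈ Icc 0 Real.pi := left_mem_Icc.2 Real.pi_pos.le
  have e1 := intervalIntegral.integral_add_adjacent_intervals (hg.intervalIntegrable l h0 ht₀')
    (hg.intervalIntegrable l ht₀' ht')
  have e2 := intervalIntegral.integral_add_adjacent_intervals
    (isSlope_one.intervalIntegrable l h0 ht₀') (isSlope_one.intervalIntegrable l ht₀' ht')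
  have e3 := radialProfile_distSlope_of_le (l := l) hc ht₀ heq (right_mem_Icc.2 ht₀.1.le)
  have e4 : (∫ s in t₀..t, l * speed s * 1) - ∫ s in t₀..t, l * speed s * distSlope c t₀ s =
      l / c * ∫ s in t₀..t, speed s * (c - quot s) := by
    rw [← intervalIntegral.integral_sub (isSlope_one.intervalIntegrable l ht₀' ht')
      (hg.intervalIntegrable l ht₀' ht'), ← intervalIntegral.integral_const_mul]
    refine intervalIntegral.integral_congr fun s hs => ?_
    rw [uIcc_of_le h] at hs
    simp only [distSlope_of_ge hs.1]
    field_simp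
  have e5 := mul_nonneg (div_pos hl hc).le (hpos t ⟨h, ht.2⟩)
  unfold radialProfile at e3 ⊢
  rw [← e1, ← e2]
  linarith

lemma distanceAdmissible_radial (hc : 0 < c) (ht₀ : t₀ ∈ Ioo 0 (Real.pi / 4))
    (heq : tail t₀ = c * prof t₀)
    (hpos : ∀ t ∈ Ico t₀ Real.pi, 0 ≤ ∫ s in t₀..t, speed s * (c - quot s))
    (hg : IsSlope (distSlope c t₀) B) : (surf hl).DistanceAdmissible
      (radialFun l (distSlope c t₀)) (radialGrad l (distSlope c t₀)) := by
  refine ⟨hg.hasSobolevGradient hl, ae_area_of_forall hl fun t ht θ _ => ?_⟩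
  rw [distBase_param hl ht, radialFun_param hl (Ioo_subset_Icc_self ht)]
  exact radialProfile_distSlope_le hl hc ht₀ heq hpos hg ht

lemma integrable_contact (hc : 0 < c) (ht₀ : t₀ ∈ Ioo 0 (Real.pi / 4))
    (heq : tail t₀ = c * prof t₀) {w : ℝ × ℝ → ℝ} (hw : Integrable w (coordMeasure l)) :
    Integrable (fun q => (1 - contactRatio c t₀ q.1) * w q) (coordMeasure l) := by
  refine hw.bdd_mul (c := 1)
    ((measurable_contactRatio.comp measurable_fst).const_sub 1).aestronglyMeasurable ?_
  filter_upwards [ae_coordMeasure_fst l] with q hq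
  have h1 := contactRatio_nonneg (t₀ := t₀) hc (Ioo_subset_Icc_self hq)
  have h2 := contactRatio_le_one hc ht₀ heq hq.1.le
  rw [Real.norm_of_nonneg (by linarith)]
  linarith

/-- The linearized functional grows, away from the radial minimizer, at least as much as a weighted
integral of the gap between the competitor and the obstacle over the contact set. -/
lemma contact_le_linearized_sub (hcm : m * l * c = 2) (hm : 0 < m) (hc : 0 < c)
    (ht₀ : t₀ ∈ Ioo 0 (Real.pi / 4)) (heq : tail t₀ = c * prof t₀)
    (hg : IsSlope (distSlope c t₀) B) (hv : (surf hl).DistanceAdmissible v H) :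
    m * ∫ q, (1 - contactRatio c t₀ q.1) *
        (radialFun l (distSlope c t₀) (param l q) - v (param l q)) ∂coordMeasure l ≤
      linearized l m (distSlope c t₀) v H - linearized l m (distSlope c t₀)
        (radialFun l (distSlope c t₀)) (radialGrad l (distSlope c t₀)) := by
  set g := distSlope c t₀ with hgdef
  have hu := hg.hasSobolevGradient hl
  -- the linearized functional is the limit of its versions with a cutoff near the pole
  have hlim : ∀ w K, (surf hl).HasSobolevGradient w K →
      Tendsto (fun n => (∫ q, bump n q.1 * (2 * g q.1 * inner ℝ (frame q) (K (param l q)))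
        ∂coordMeasure l) - m * ∫ q, w (param l q) ∂coordMeasure l) atTop
        (𝓝 (linearized l m g w K)) := by
    intro w K hw
    have hi := integrable_mul_inner_frame hl hg hw
    refine Tendsto.sub_const ?_ _
    refine tendsto_integral_of_dominated_convergence
      (fun q => ‖2 * g q.1 * inner ℝ (frame q) (K (param l q))‖)
      (fun n => ((continuous_bump n).measurable.comp measurable_fst).aestronglyMeasurable.mul
        hi.aestronglyMeasurable) hi.norm (fun n => ae_of_all _ fun q => ?_) ?_
    · rw [norm_mul]
      exact mul_le_of_le_one_left (norm_nonneg _) (abs_bump_le_one n q.1)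
    · filter_upwards [ae_coordMeasure_fst l] with q hq
      simpa using (tendsto_bump hq).mul_const (2 * g q.1 * inner ℝ (frame q) (K (param l q)))
  refine ge_of_tendsto ((hlim v H hv.1).sub (hlim _ _ hu)) ?_
  filter_upwards [eventually_one_le ht₀.1 (lt_pi_of_mem ht₀).2.le] with n hn
  obtain ⟨C, hcut⟩ := exists_isCutoff_contact hc ht₀ heq n
  set χ := fun t => bump n t * contactRatio c t₀ t with hχ
  set χ' := fun t => dbump n t * contactRatio c t₀ t + bump n t * dcontactRatio c t₀ t with hχ'
  have hy : Continuous fun _ : E3 => m := continuous_const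
  have hparts : ∀ w K, (surf hl).HasSobolevGradient w K →
      ∫ q, bump n q.1 * (2 * g q.1 * inner ℝ (frame q) (K (param l q))) ∂coordMeasure l =
        ∫ q, funWeight l (fun _ => m) χ χ' q * w (param l q) ∂coordMeasure l := by
    intro w K hw
    rw [← integral_parts hl hw hy hcut]
    refine integral_congr_ae ?_
    filter_upwards [ae_coordMeasure_fst l] with q hq
    have h1 := (prof_pos hq).ne'
    rw [gradWeight, beyond_const l m (Ioo_subset_Icc_self hq), hgdef,
      ← contactRatio_mul_quot hc ht₀ heq hq, quot, hχ]
    field_simp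
    linear_combination -(bump n q.1 * contactRatio c t₀ q.1 * tail q.1 *
      inner ℝ (frame q) (K (param l q))) * hcm
  rw [hparts v H hv.1, hparts _ _ hu]
  obtain ⟨D, hD⟩ := funWeight_bounded hl hy hcut
  have hwm := (measurable_funWeight (l := l) hy hcut.measurable
    hcut.measurable').aestronglyMeasurable (μ := coordMeasure l)
  have hvi := integrable_fun hl hv.1
  have hui := integrable_fun hl hu
  have i1 := hvi.bdd_mul hwm hD
  have i2 := hui.bdd_mul hwm hD
  have hdiff : (∫ q, funWeight l (fun _ => m) χ χ' q * v (param l q) ∂coordMeasure l) -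
      m * (∫ q, v (param l q) ∂coordMeasure l) -
      ((∫ q, funWeight l (fun _ => m) χ χ' q * radialFun l g (param l q) ∂coordMeasure l) -
        m * ∫ q, radialFun l g (param l q) ∂coordMeasure l) =
      ∫ q, ((funWeight l (fun _ => m) χ χ' q * v (param l q) - m * v (param l q)) -
        (funWeight l (fun _ => m) χ χ' q * radialFun l g (param l q) -
          m * radialFun l g (param l q))) ∂coordMeasure l := by
    rw [← integral_const_mul, ← integral_const_mul, ← integral_sub i1 (hvi.const_mul m),
      ← integral_sub i2 (hui.const_mul m)]
    exact (integral_sub (i1.sub (hvi.const_mul m)) (i2.sub (hui.const_mul m))).symm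
  rw [hdiff, ← integral_const_mul]
  refine integral_mono_ae ((integrable_contact hc ht₀ heq (hui.sub hvi)).const_mul m)
    ((i1.sub (hvi.const_mul m)).sub (i2.sub (hui.const_mul m))) ?_
  filter_upwards [ae_coordMeasure_fst l, ae_coordMeasure_of_ae_area hl hv.2] with q hq hvq
  have hq' := Ioo_subset_Icc_self hq
  have hsplit : (funWeight l (fun _ => m) χ χ' q * v (param l q) - m * v (param l q)) -
      (funWeight l (fun _ => m) χ χ' q * radialFun l g (param l q) -
        m * radialFun l g (param l q)) =
      (m - funWeight l (fun _ => m) χ χ' q) * (radialFun l g (param l q) - v (param l q)) := by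
    ring
  simp only [hsplit, ← mul_assoc]
  rcases le_or_gt q.1 t₀ with h | h
  · -- on the contact set the gap is nonnegative, and so is the derivative of the cutoff
    have hgap : 0 ≤ radialFun l g (param l q) - v (param l q) := by
      rw [distBase_param hl (t := q.1) (θ := q.2) hq] at hvq
      rw [radialFun_param hl hq', hgdef, radialProfile_distSlope_of_le hc ht₀ heq ⟨hq.1.le, h⟩]
      linarith
    refine mul_le_mul_of_nonneg_right ?_ hgap
    have h1 := contactRatio_nonneg (t₀ := t₀) hc hq'
    have h2 : 0 ≤ χ' q.1 := add_nonneg (mul_nonneg (dbump_nonneg n hq') h1)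
      (mul_nonneg (bump_nonneg n q.1) (dcontactRatio_nonneg hc ht₀ hq'))
    have h3 : 0 ≤ χ' q.1 * beyond l (fun _ => m) q / dens l q := by
      rw [beyond_const l m hq']
      have h4 := tail_nonneg hq'
      have h5 := dens_pos hl hq
      positivity
    have h6 : χ q.1 ≤ contactRatio c t₀ q.1 := mul_le_of_le_one_left h1 (bump_le_one n q.1)
    rw [funWeight]
    nlinarith
  · have h1 := hn q.1 ⟨h.le, hq.2.le⟩
    have h2 : contactRatio c t₀ q.1 = 1 := if_neg h.not_ge
    have h3 : dcontactRatio c t₀ q.1 = 0 := if_neg h.not_ge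
    simp [funWeight, hχ, hχ', bump_eq_one h1, dbump_eq_zero h1, h2, h3]

lemma ae_contact_nonneg (hc : 0 < c) (ht₀ : t₀ ∈ Ioo 0 (Real.pi / 4))
    (heq : tail t₀ = c * prof t₀) (hv : (surf hl).DistanceAdmissible v H) :
    ∀ᵐ q ∂coordMeasure l, 0 ≤ (1 - contactRatio c t₀ q.1) *
      (radialFun l (distSlope c t₀) (param l q) - v (param l q)) := by
  filter_upwards [ae_coordMeasure_fst l, ae_coordMeasure_of_ae_area hl hv.2] with q hq hvq
  have hq' := Ioo_subset_Icc_self hq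
  rcases le_or_gt q.1 t₀ with h | h
  · refine mul_nonneg ?_ ?_
    · linarith [contactRatio_le_one hc ht₀ heq hq.1.le]
    · rw [distBase_param hl (t := q.1) (θ := q.2) hq] at hvq
      rw [radialFun_param hl hq', radialProfile_distSlope_of_le hc ht₀ heq ⟨hq.1.le, h⟩]
      linarith
  · rw [contactRatio, if_neg h.not_ge]
    simp

lemma linearized_le_of_distanceAdmissible (hcm : m * l * c = 2) (hm : 0 < m) (hc : 0 < c)
    (ht₀ : t₀ ∈ Ioo 0 (Real.pi / 4)) (heq : tail t₀ = c * prof t₀)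
    (hg : IsSlope (distSlope c t₀) B) (hv : (surf hl).DistanceAdmissible v H) :
    linearized l m (distSlope c t₀) (radialFun l (distSlope c t₀))
      (radialGrad l (distSlope c t₀)) ≤ linearized l m (distSlope c t₀) v H := by
  have h1 := contact_le_linearized_sub hl hcm hm hc ht₀ heq hg hv
  have h2 := mul_nonneg hm.le (integral_nonneg_of_ae (ae_contact_nonneg hl hc ht₀ heq hv))
  linarith

theorem isDistanceMinimizer_radial (hcm : m * l * c = 2) (hm : 0 < m) (hc : 0 < c)
    (ht₀ : t₀ ∈ Ioo 0 (Real.pi / 4)) (heq : tail t₀ = c * prof t₀)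
    (hpos : ∀ t ∈ Ico t₀ Real.pi, 0 ≤ ∫ s in t₀..t, speed s * (c - quot s)) :
    (surf hl).IsDistanceMinimizer m (radialFun l (distSlope c t₀)) := by
  obtain ⟨B, hg⟩ := exists_isSlope_distSlope hc ht₀
  exact ⟨_, distanceAdmissible_radial hl hc ht₀ heq hpos hg, fun _ _ hv =>
    energy_radial_le hl hg hv.1
      (linearized_le_of_distanceAdmissible hl hcm hm hc ht₀ heq hg hv)⟩

/-- A second minimizer has the same gradient, and it touches the obstacle on the contact set. Hence
integration by parts with a cutoff that varies within the contact set identifies the two. -/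
theorem IsDistanceMinimizer.ae_eq_radial (hcm : m * l * c = 2) (hm : 0 < m) (hc : 0 < c)
    (ht₀ : t₀ ∈ Ioo 0 (Real.pi / 4)) (heq : tail t₀ = c * prof t₀)
    (hpos : ∀ t ∈ Ico t₀ Real.pi, 0 ≤ ∫ s in t₀..t, speed s * (c - quot s))
    (hv : (surf hl).IsDistanceMinimizer m v) :
    v =ᵐ[(surf hl).area] radialFun l (distSlope c t₀) := by
  obtain ⟨B, hg⟩ := exists_isSlope_distSlope hc ht₀
  obtain ⟨H, hadm, hmin⟩ := hv
  have hu := distanceAdmissible_radial hl hc ht₀ heq hpos hg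
  obtain ⟨hH, hlin⟩ := ae_eq_of_energy_le hl hg hadm.1
    (linearized_le_of_distanceAdmissible hl hcm hm hc ht₀ heq hg hadm) (hmin _ _ hu)
  have hvi := integrable_fun hl hadm.1
  have hui := integrable_fun hl hu.1
  have hnonneg := ae_contact_nonneg hl hc ht₀ heq hadm
  have hle := contact_le_linearized_sub hl hcm hm hc ht₀ heq hg hadm
  have hzero : ∫ q, (1 - contactRatio c t₀ q.1) *
      (radialFun l (distSlope c t₀) (param l q) - v (param l q)) ∂coordMeasure l = 0 := by
    refine le_antisymm ?_ (integral_nonneg_of_ae hnonneg)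
    by_contra! h
    have := mul_pos hm h
    linarith
  rw [integral_eq_zero_iff_of_nonneg_ae hnonneg
    (integrable_contact hc ht₀ heq (hui.sub hvi))] at hzero
  have hcontact : ∀ᵐ q ∂coordMeasure l, q.1 < t₀ →
      v (param l q) = radialFun l (distSlope c t₀) (param l q) := by
    filter_upwards [hzero, ae_coordMeasure_fst l] with q h1 hq h
    have h2 := contactRatio_lt_one hc ht₀ heq ⟨hq.1.le, h⟩
    rcases mul_eq_zero.1 h1 with h3 | h3
    · linarith
    · linarith
  obtain ⟨n, hn⟩ := (eventually_one_le ht₀.1 (lt_pi_of_mem ht₀).2.le).exists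
  have hcut := isCutoff_bump n
  refine ae_eq_of_forall_integral_eq hl hadm.1.1 hu.1.1 fun y hy => ?_
  have e1 := integral_parts hl hadm.1 hy hcut
  have e2 := integral_parts hl hu.1 hy hcut
  have e3 : ∫ q, gradWeight l y (bump n) q * inner ℝ (frame q) (H (param l q)) ∂coordMeasure l =
      ∫ q, gradWeight l y (bump n) q * inner ℝ (frame q)
        (radialGrad l (distSlope c t₀) (param l q)) ∂coordMeasure l := by
    refine integral_congr_ae ?_
    filter_upwards [hH, ae_radialGrad_param hl (distSlope c t₀)] with q h1 h2
    rw [h1, h2]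
  rw [e1, e2] at e3
  obtain ⟨K, hK⟩ := funWeight_bounded hl hy hcut
  obtain ⟨M, -, hM⟩ := ae_abs_le_of_continuous l (hy.comp (continuous_param l))
  have hwm := (measurable_funWeight (l := l) hy hcut.measurable
    hcut.measurable').aestronglyMeasurable (μ := coordMeasure l)
  have hym := (hy.comp (continuous_param l)).aestronglyMeasurable (μ := coordMeasure l)
  have i1 := hvi.bdd_mul hwm hK
  have i2 := hui.bdd_mul hwm hK
  have i3 := hvi.bdd_mul hym hM
  have i4 := hui.bdd_mul hym hM
  rw [← sub_eq_zero, ← integral_sub i1 i2] at e3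
  refine sub_eq_zero.1 ((integral_sub i3 i4).symm.trans (Eq.trans (integral_congr_ae ?_) e3))
  filter_upwards [hcontact, ae_coordMeasure_fst l] with q h1 hq
  rcases lt_or_ge q.1 t₀ with h | h
  · simp [h1 h]
  · have h2 := hn q.1 ⟨h, hq.2.le⟩
    simp [funWeight, bump_eq_one h2, dbump_eq_zero h2]

end distanceConstraint

/-! ### The two minimizers differ -/

/-- Radial functions which agree almost everywhere have the same slope. -/
lemma slope_eq_of_ae_eq {l : ℝ} (hl : 0 < l) {g₁ g₂ : ℝ → ℝ} {B₁ B₂ : ℝ} (h₁ : IsSlope g₁ B₁)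
    (h₂ : IsSlope g₂ B₂) (h : radialFun l g₁ =ᵐ[(surf hl).area] radialFun l g₂) {t : ℝ}
    (ht : t ∈ Ioo 0 Real.pi) : g₁ t = g₂ t := by
  have hae := ae_restrict_of_ae_coordMeasure hl (ae_coordMeasure_of_ae_area hl h)
  have hopen : IsOpen (Ioo 0 Real.pi ×ˢ Ioo 0 (2 * Real.pi)) := isOpen_Ioo.prod isOpen_Ioo
  have hon := Measure.eqOn_open_of_ae_eq hae hopen
    ((h₁.continuous_radialFun l).comp (continuous_param l)).continuousOn
    ((h₂.continuous_radialFun l).comp (continuous_param l)).continuousOn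
  have hprofile : ∀ s ∈ Ioo 0 Real.pi, radialProfile l g₁ s = radialProfile l g₂ s :=
    fun s hs => by
      have := hon (x := (s, Real.pi)) ⟨hs, Real.pi_pos, by linarith [Real.pi_pos]⟩
      simpa only [radialFun_param hl (q := (s, Real.pi)) (Ioo_subset_Icc_self hs)] using this
  have hev : radialProfile l g₁ =ᶠ[𝓝 t] radialProfile l g₂ := by
    filter_upwards [isOpen_Ioo.mem_nhds ht] with s hs
    exact hprofile s hs
  have := ((h₁.hasDerivAt_radialProfile l ht).congr_of_eventuallyEq hev.symm).unique
    (h₂.hasDerivAt_radialProfile l ht)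
  exact mul_left_cancel₀ (mul_pos hl (speed_pos t)).ne' this

end Dumbbell

theorem theoremB1 :
    ∃ (S : SurfaceOfRevolution) (m : ℝ), 0 < m ∧ m = 1 / 10 ^ 10 ∧
      ∃ um umd : E3 → ℝ,
        (S.IsGradientMinimizer m um ∧
          ∀ w, S.IsGradientMinimizer m w → w =ᵐ[S.area] um) ∧
        (S.IsDistanceMinimizer m umd ∧
          ∀ w, S.IsDistanceMinimizer m w → w =ᵐ[S.area] umd) ∧
        ¬ um =ᵐ[S.area] umd := by
  obtain ⟨c, t₀, hc, ht₀, heq, hpos, t₁, ht₁, hlt⟩ := Dumbbell.exists_level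
  have hm : (0 : ℝ) < 1 / 10 ^ 10 := by norm_num
  -- the scale at which the unconstrained slope is `1` where `quot` equals `c`
  have hl : (0 : ℝ) < 2 * 10 ^ 10 / c := by positivity
  have hcm : (1 / 10 ^ 10 : ℝ) * (2 * 10 ^ 10 / c) * c = 2 := by field_simp
  refine ⟨Dumbbell.surf hl, 1 / 10 ^ 10, hm, rfl, _, _,
    ⟨Dumbbell.isGradientMinimizer_radial hl hcm hc, fun w hw =>
      Dumbbell.IsGradientMinimizer.ae_eq_radial hl hcm hc hw⟩,
    ⟨Dumbbell.isDistanceMinimizer_radial hl hcm hm hc ht₀ heq hpos, fun w hw =>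
      Dumbbell.IsDistanceMinimizer.ae_eq_radial hl hcm hm hc ht₀ heq hpos hw⟩, fun h => ?_⟩
  -- on the neck the distance constraint allows a slope greater than `1`
  obtain ⟨B, hg⟩ := Dumbbell.exists_isSlope_distSlope hc ht₀
  have hs := Dumbbell.slope_eq_of_ae_eq hl (Dumbbell.isSlope_gradSlope hc) hg h
    ⟨ht₀.1.trans ht₁.1, ht₁.2⟩
  have h1 : 1 < Dumbbell.quot t₁ / c := (one_lt_div hc).2 hlt
  rw [Dumbbell.distSlope_of_ge ht₁.1.le] at hs
  have h2 : Dumbbell.gradSlope c t₁ ≤ 1 := min_le_left _ _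
  linarith
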